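/- Let $k$ be an algebraically closed field of characteristic different from $2$. Let $p(x) \in k[x]$ be monic of degree at least $2$, and write $p(x) = (x-\alpha_1)^{e_1} \cdots (x-\alpha_v)^{e_v}$ with $\alpha_1, \dots, \alpha_v \in k$ distinct and every $e_i \ge 1$. Put $D = \gcd(e_1, \dots, e_v)$ and $T = k[x,y,z]/(z^2 - y^2 + p(x))$, and let $P_i$ be the point of $\operatorname{Spec} T$ where $x = \alpha_i$, $y = z = 0$. For a Noetherian normal domain $R$, let $\operatorname{Cl}(R)$ be the group of Weil divisors of $\operatorname{Spec} R$ modulo principal divisors. The ring $T$ is a normal domain, and the following are true. (a) The singular locus of $T$ (the set of $P \in \operatorname{Spec} T$ such that $T_P$ is not a regular local ring) is equal to $\{P_i \mid e_i \ge 2\}$. (b) $T$ is rational: $\operatorname{Spec} T$ is birational over $k$ to the affine plane $\mathbb{A}^2_k$. (c) $\operatorname{Cl}(T) \cong \mathbb{Z}/D \oplus \mathbb{Z}^{v-1}$. (d) $T^\ast = k^\ast$. (e) If $e_i \ge 2$, the singular point $P_i$ is a rational double point of type $A_n$ with $n = e_i - 1$; that is, the completed local ring $\hat T_{P_i}$ is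 isomorphic as a $k$-algebra to $k[[a,b,c]]/(ab + c^{n+1})$. (f) For every $i$, the completed local ring $\hat T_{P_i}$ is a Noetherian normal domain, and the natural homomorphism $\operatorname{Cl}(T_{P_i}) \to \operatorname{Cl}(\hat T_{P_i})$, which sends the class of a prime divisor to the class of its pullback (the pullback of $\mathfrak q$ being $\sum_{\mathfrak r} \operatorname{length}\bigl((\hat T_{P_i})_{\mathfrak r}/\mathfrak q (\hat T_{P_i})_{\mathfrak r}\bigr)\, \mathfrak r$ over the primes $\mathfrak r$ of height one), is an isomorphism. Both groups are cyclic of order $e_i$. -/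

import Mathlib

open AlgebraicGeometry

universe u

noncomputable section

/-! ### Weil divisors and the divisor class group -/

/-- A prime divisor of `Spec R`: a prime ideal of height one. -/
def PrimeDivisor (R : Type*) [CommRing R] : Type _ :=
  {q : PrimeSpectrum R // q.asIdeal.height = 1}

/-- The group of Weil divisors of `Spec R`: the free abelian group on the prime divisors. -/
abbrev WeilDivisor (R : Type*) [CommRing R] : Type _ :=
  PrimeDivisor R →₀ ℤ

/-- The multiplicity of the closed subscheme `V(I)` along the prime divisor `q`: the length of
`R_q / I R_q` over `R_q`.  When `R_q` is a discrete valuation ring and `I R_q ≠ 0`, this is the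
valuation of the ideal `I R_q`. -/
def multAlong {R : Type*} [CommRing R] (I : Ideal R) (q : PrimeDivisor R) : ℕ :=
  (Module.length (Localization.AtPrime q.1.asIdeal)
    (Localization.AtPrime q.1.asIdeal ⧸
      I.map (algebraMap R (Localization.AtPrime q.1.asIdeal)))).toNat

/-- The Weil divisor `D` is the divisor of the ring element `f`. -/
def IsDivisorOf {R : Type*} [CommRing R] (D : WeilDivisor R) (f : R) : Prop :=
  ∀ q : PrimeDivisor R, D q = (multAlong (Ideal.span {f}) q : ℤ)

/-- The group of principal divisors, generated by the divisors of the nonzero-divisors of `R`.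
(For a Noetherian normal domain these are the divisors `div f - div g = div (f / g)`
of the nonzero elements `f / g` of the fraction field.) -/
def principalDivisors (R : Type*) [CommRing R] : AddSubgroup (WeilDivisor R) :=
  AddSubgroup.closure {D | ∃ f ∈ nonZeroDivisors R, IsDivisorOf D f}

/-- The Weil divisor class group `Cl(R)`, meant for Noetherian normal domains. -/
abbrev DivisorClassGroup (R : Type*) [CommRing R] : Type _ :=
  WeilDivisor R ⧸ principalDivisors R

/-- The class of a Weil divisor. -/
def divisorClass {R : Type*} [CommRing R] (D : WeilDivisor R) : DivisorClassGroup R :=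
  QuotientAddGroup.mk D

/-- The Weil divisor `E` of `B` is the pullback of the prime divisor `q` of `A`: it is the divisor
of the closed subscheme `V(q B)` of `Spec B`. -/
def IsPullbackOf {A B : Type*} [CommRing A] [CommRing B] [Algebra A B]
    (E : WeilDivisor B) (q : PrimeDivisor A) : Prop :=
  ∀ r : PrimeDivisor B, E r = (multAlong (q.1.asIdeal.map (algebraMap A B)) r : ℤ)

/-- `φ` is the natural homomorphism `Cl(A) → Cl(B)` of a flat `A`-algebra `B`, sending the class of
each prime divisor to the class of its pullback.  At most one homomorphism has this property,
since the prime divisors generate `Cl(A)`. -/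
def IsNaturalClassMap {A B : Type*} [CommRing A] [CommRing B] [Algebra A B]
    (φ : DivisorClassGroup A →+ DivisorClassGroup B) : Prop :=
  ∀ q : PrimeDivisor A, ∃ E : WeilDivisor B,
    IsPullbackOf E q ∧ φ (divisorClass (Finsupp.single q 1)) = divisorClass E

/-! ### Singular locus, rationality, and singularities of type `A_n` -/

/-- The singular locus of `Spec R`: the points whose local ring is not regular. -/
def singularLocus (R : Type*) [CommRing R] : Set (PrimeSpectrum R) :=
  {P | ¬ IsRegularLocalRing (Localization.AtPrime P.asIdeal)}

/-- `Spec R` is a rational surface over `k`: it is integral and birational over `k` to the affine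
plane. -/
def IsRationalSurface (k R : Type u) [Field k] [CommRing R] [Algebra k R] : Prop :=
  IsDomain R ∧
    Scheme.BirationalOver
      (Spec.map (CommRingCat.ofHom (algebraMap k R)) :
        Spec (CommRingCat.of R) ⟶ Spec (CommRingCat.of k))
      (𝔸(ULift (Fin 2); Spec (CommRingCat.of k)) ↘ Spec (CommRingCat.of k))

/-- The completion of a local ring at its maximal ideal. -/
abbrev LocalCompletion (R : Type*) [CommRing R] [IsLocalRing R] : Type _ :=
  AdicCompletion (IsLocalRing.maximalIdeal R) R

/-- The complete local ring `k[[a, b, c]] / (a b + c ^ (n + 1))`. -/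
abbrev CompleteA (k : Type*) [Field k] (n : ℕ) : Type _ :=
  MvPowerSeries (Fin 3) k ⧸
    Ideal.span {(MvPowerSeries.X 0 * MvPowerSeries.X 1 + MvPowerSeries.X 2 ^ (n + 1) :
      MvPowerSeries (Fin 3) k)}

/-- The local ring `R` (of a closed point of a surface over the algebraically closed field `k`) is
a rational double point of type `A_n`, `n ≥ 1`: it is Noetherian and its completion is
isomorphic over `k` to the standard form `k[[a, b, c]] / (a b + c ^ (n + 1))`. -/
def IsRationalDoublePointA (k R : Type*) [Field k] [CommRing R] [IsLocalRing R] [Algebra k R]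
    (n : ℕ) : Prop :=
  1 ≤ n ∧ IsNoetherianRing R ∧ Nonempty (LocalCompletion R ≃ₐ[k] CompleteA k n)

/-! ### The affine double plane -/

/-- The polynomial `z ^ 2 - y ^ 2 + p(x)` in `k[x, y, z]`,
with `x = X 0`, `y = X 1`, `z = X 2`. -/
def doublePlaneEq {k : Type*} [Field k] (p : Polynomial k) : MvPolynomial (Fin 3) k :=
  MvPolynomial.X 2 ^ 2 - MvPolynomial.X 1 ^ 2 + Polynomial.aeval (MvPolynomial.X 0) p

/-- The ring `T = k[x, y, z] / (z ^ 2 - y ^ 2 + p(x))`. -/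
abbrev DoublePlane {k : Type*} [Field k] (p : Polynomial k) : Type _ :=
  MvPolynomial (Fin 3) k ⧸ Ideal.span {doublePlaneEq p}

/-- Evaluation `T → k` at the point `(a, 0, 0)`, where `a` is a root of `p`. -/
def DoublePlane.evalAt {k : Type*} [Field k] (p : Polynomial k) (a : k) (ha : p.IsRoot a) :
    DoublePlane p →ₐ[k] k :=
  Ideal.Quotient.liftₐ _ (MvPolynomial.aeval ![a, 0, 0]) (by
    intro f hf
    have h : Ideal.span {doublePlaneEq p} ≤
        RingHom.ker (MvPolynomial.aeval (R := k) ![a, 0, 0]) := by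
      rw [Ideal.span_singleton_le_iff_mem, RingHom.mem_ker]
      have h1 : MvPolynomial.eval ![a, 0, 0]
          (Polynomial.aeval (MvPolynomial.X 0 : MvPolynomial (Fin 3) k) p) = 0 := by
        rw [← MvPolynomial.coe_aeval_eq_eval, RingHom.coe_coe, ← Polynomial.aeval_algHom_apply]
        simpa [Polynomial.aeval_def, Polynomial.eval₂_eq_eval_map] using ha
      simp [doublePlaneEq, h1]
    exact h hf)

/-- The point of `Spec T` where `x = a` and `y = z = 0`, where `a` is a root of `p`. -/
def DoublePlane.point {k : Type*} [Field k] (p : Polynomial k) (a : k) (ha : p.IsRoot a) :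
    PrimeSpectrum (DoublePlane p) :=
  ⟨RingHom.ker (DoublePlane.evalAt p a ha), RingHom.ker_isPrime _⟩

theorem isRoot_of_factorization {k : Type*} [Field k] {p : Polynomial k} {v : ℕ} {α : Fin v → k}
    {e : Fin v → ℕ} (hp : p = ∏ i, (Polynomial.X - Polynomial.C (α i)) ^ e i)
    (he : ∀ i, 1 ≤ e i) (i : Fin v) : p.IsRoot (α i) := by
  rw [hp, Polynomial.IsRoot, Polynomial.eval_prod]
  refine Finset.prod_eq_zero (Finset.mem_univ i) ?_
  have := he i
  simp [show e i ≠ 0 by omega]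

/-- The local ring `T_P` at the point `P = (a, 0, 0)`. -/
abbrev DoublePlane.localRing {k : Type*} [Field k] (p : Polynomial k) (a : k) (ha : p.IsRoot a) :
    Type _ :=
  Localization.AtPrime (DoublePlane.point p a ha).asIdeal

end

/-! Since 2 is invertible, the coordinates a = y - z and b = y + z rewrite the surface as ab = p(x).
Inverting a eliminates b, so T[1/a] = k[x][a, 1/a], a localization of a factorial ring. This
identification gives rationality. It also embeds T in a Laurent polynomial ring
(`DoublePlane.toLaurent_injective`), so T is a domain. By the symmetry exchanging a and b, T is
normal away from V(a) and away from V(b); as a, b is a regular sequence, T is normal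
(`isIntegrallyClosed_of_away`). Units of T[1/a] are constants times powers of a, and a itself
vanishes somewhere, so the units of T are constants.

For Cl(T) the argument is Nagata's. A prime divisor off V(a) becomes principal in T[1/a], so the
components of V(a), the lines L_i given by a = 0, x = α_i, generate the class group. A relation
among them is the divisor of a unit of T[1/a], hence a multiple of div a = ∑ e_i L_i. Thus Cl(T) is
ℤ^v modulo the vector (e_i), and Bézout splits this quotient.

The singular locus comes from the Jacobian criterion at closed points. If a, b or p' is nonzero at
the point, one of three generators of the maximal ideal is redundant. Otherwise T maps onto a
square-zero extension of k by k^3, which shows that the embedding dimension exceeds the dimension.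
Non-maximal primes have height at most one and are regular by normality.

Near a root of multiplicity e = n + 1, write p = (x - α)^e w with w a unit. Absorbing -w into b
gives the standard A_n equation, and `exists_adicCompletion_algEquiv` identifies the completion with
k[[a,b,c]]/(ab + c^e). The substitution a = u^e, b = -v^e, c = uv embeds that ring in k[[u,v]] as
the degree-zero part of a ℤ/e-grading (`IsDegreeZeroSubring`). Working with a grading instead of a
cyclic group action makes the argument independent of whether the characteristic divides e.
Factoriality of k[[u,v]] yields normality, irreducibility of a, and principality of all other prime
divisors after inverting a. With div a = e q for q = (a, c), the class group is cyclic of order e,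
generated by q.

The same criterion applies to the local ring of T, where a is irreducible because it is so in the
completion. The generator (a, x - α) extends to the generator (a, c) upstairs, so the natural map
carries a generator to a generator of the same order and is bijective. -/

set_option linter.unusedSectionVars false

/-! ### Weil divisors on Noetherian normal domains. -/

section DivisorTheory

open IsLocalRing

variable {R : Type*} [CommRing R]

instance PrimeDivisor.isDiscreteValuationRing [IsDomain R] [IsNoetherianRing R]
    [IsIntegrallyClosed R] (q : PrimeDivisor R) :
    IsDiscreteValuationRing (Localization.AtPrime q.1.asIdeal) := by
  have hq := q.2
  have hnf : ¬ IsField (Localization.AtPrime q.1.asIdeal) := by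
    rw [isField_iff_maximalIdeal_eq, ← Localization.AtPrime.map_eq_maximalIdeal,
      Ideal.map_eq_bot_iff_of_injective
        (IsLocalization.injective _ q.1.asIdeal.primeCompl_le_nonZeroDivisors)]
    exact Ideal.ne_bot_of_height_eq_one hq
  have hcl : IsIntegrallyClosed (Localization.AtPrime q.1.asIdeal) :=
    isIntegrallyClosed_of_isLocalization _ q.1.asIdeal.primeCompl
      q.1.asIdeal.primeCompl_le_nonZeroDivisors
  have tfae : IsDiscreteValuationRing (Localization.AtPrime q.1.asIdeal) ↔
      IsIntegrallyClosed (Localization.AtPrime q.1.asIdeal) ∧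
        ∃! P : Ideal (Localization.AtPrime q.1.asIdeal), P ≠ ⊥ ∧ P.IsPrime :=
    (IsDiscreteValuationRing.TFAE _ hnf).out 0 3
  refine tfae.mpr ⟨hcl, maximalIdeal _,
    ⟨fun h => hnf (isField_iff_maximalIdeal_eq.mpr h), inferInstance⟩, ?_⟩
  rintro P ⟨hP0, hP⟩
  have h1 : (maximalIdeal (Localization.AtPrime q.1.asIdeal)).height = 1 := by
    refine Eq.trans ?_ hq
    rw [← WithBot.coe_inj, maximalIdeal_height_eq_ringKrullDim,
      IsLocalization.AtPrime.ringKrullDim_eq_height q.1.asIdeal]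
  refine (Ideal.IsPrime.ne_top hP |> le_maximalIdeal).eq_of_not_lt fun hlt => ?_
  have h2 := Ideal.height_add_one_le_of_lt_of_isPrime hlt
  rw [h1] at h2
  have h3 : P.height = 0 := by
    by_contra h
    have := Order.one_le_iff_ne_zero.mpr h
    have := (add_le_add_left this 1).trans h2
    norm_num at this
  exact hP0 (Ideal.height_eq_zero_iff_eq_bot.mp h3)

theorem length_quotient_maximalIdeal_pow {A : Type*} [CommRing A] [IsDomain A]
    [IsDiscreteValuationRing A] (n : ℕ) :
    Module.length A (A ⧸ maximalIdeal A ^ n) = n := by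
  obtain ⟨π, hπ⟩ := IsDiscreteValuationRing.exists_irreducible A
  rw [hπ.maximalIdeal_eq, Ideal.span_singleton_pow]
  have := Ring.ord_pow (mem_nonZeroDivisors_of_ne_zero hπ.ne_zero) n
  rw [Ring.ord_of_irreducible hπ] at this
  simpa [Ring.ord] using this

variable [IsDomain R] [IsNoetherianRing R] [IsIntegrallyClosed R]

/-- The length of a quotient by a power of the maximal ideal is finite, so `toNat` loses nothing
here. This and `map_eq_pow_multAlong` let multiplicities be handled as exponents instead of lengths.
-/
theorem multAlong_eq_of_map_eq_pow {I : Ideal R} {q : PrimeDivisor R} {n : ℕ}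
    (h : I.map (algebraMap R (Localization.AtPrime q.1.asIdeal)) = maximalIdeal _ ^ n) :
    multAlong I q = n := by
  rw [multAlong, h, length_quotient_maximalIdeal_pow, ENat.toNat_natCast]

theorem map_eq_pow_multAlong {I : Ideal R} (hI : I ≠ ⊥) (q : PrimeDivisor R) :
    I.map (algebraMap R (Localization.AtPrime q.1.asIdeal)) =
      maximalIdeal _ ^ multAlong I q := by
  have h : I.map (algebraMap R (Localization.AtPrime q.1.asIdeal)) ≠ ⊥ := by
    rwa [ne_eq, Ideal.map_eq_bot_iff_of_injective
        (IsLocalization.injective _ q.1.asIdeal.primeCompl_le_nonZeroDivisors)]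
  obtain ⟨n, hn⟩ := exists_maximalIdeal_pow_eq_of_principal _
    (IsPrincipalIdealRing.principal _) _ h
  rw [multAlong_eq_of_map_eq_pow hn, hn]

theorem maximalIdeal_pow_injective_of_dvr {A : Type*} [CommRing A] [IsDomain A]
    [IsDiscreteValuationRing A] {m n : ℕ} (h : maximalIdeal A ^ m = maximalIdeal A ^ n) :
    m = n := by
  have h1 := length_quotient_maximalIdeal_pow (A := A) m
  rw [h, length_quotient_maximalIdeal_pow] at h1
  exact_mod_cast h1.symm

theorem multAlong_mul {I J : Ideal R} (hI : I ≠ ⊥) (hJ : J ≠ ⊥) (q : PrimeDivisor R) :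
    multAlong (I * J) q = multAlong I q + multAlong J q := by
  apply multAlong_eq_of_map_eq_pow
  rw [Ideal.map_mul, map_eq_pow_multAlong hI, map_eq_pow_multAlong hJ, pow_add]

theorem multAlong_eq_zero_iff {I : Ideal R} (hI : I ≠ ⊥) {q : PrimeDivisor R} :
    multAlong I q = 0 ↔ ¬ I ≤ q.1.asIdeal := by
  have key : I.map (algebraMap R (Localization.AtPrime q.1.asIdeal)) = ⊤ ↔
      ¬ I ≤ q.1.asIdeal := by
    rw [← not_iff_not, not_not]
    constructor
    · intro h
      have := le_maximalIdeal h
      rw [Ideal.map_le_iff_le_comap] at this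
      exact this.trans_eq Localization.AtPrime.under_maximalIdeal
    · intro h h'
      have := Ideal.map_mono (f := algebraMap R (Localization.AtPrime q.1.asIdeal)) h
      rw [h', Localization.AtPrime.map_eq_maximalIdeal, top_le_iff] at this
      exact Ideal.IsPrime.ne_top' this
  rw [← key, map_eq_pow_multAlong hI]
  constructor
  · intro h; rw [h, pow_zero, Ideal.one_eq_top]
  · intro h
    rw [← Ideal.one_eq_top, ← pow_zero (maximalIdeal _)] at h
    exact maximalIdeal_pow_injective_of_dvr h

theorem PrimeDivisor.asIdeal_ne_bot (q : PrimeDivisor R) : q.1.asIdeal ≠ ⊥ :=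
  Ideal.ne_bot_of_height_eq_one q.2

theorem PrimeDivisor.eq_of_le {q r : PrimeDivisor R} (h : q.1.asIdeal ≤ r.1.asIdeal) : q = r := by
  have hr : r.1.asIdeal.FiniteHeight := ⟨Or.inr (by rw [r.2]; simp)⟩
  have := Ideal.finiteHeight_of_le h r.1.2.ne_top
  have h' : r.1.asIdeal.height ≤ q.1.asIdeal.height := by rw [q.2, r.2]
  exact Subtype.ext (PrimeSpectrum.ext (Ideal.eq_of_le_of_height_le _ h h'))

theorem multAlong_self (q : PrimeDivisor R) : multAlong q.1.asIdeal q = 1 := by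
  apply multAlong_eq_of_map_eq_pow
  rw [Localization.AtPrime.map_eq_maximalIdeal, pow_one]

theorem multAlong_of_ne {q r : PrimeDivisor R} (h : q ≠ r) : multAlong q.1.asIdeal r = 0 :=
  (multAlong_eq_zero_iff q.asIdeal_ne_bot).mpr fun h' => h (PrimeDivisor.eq_of_le h')

/-- A nonzero ideal has height at least one, so a height-one prime above it is minimal over it, and
a Noetherian ring has only finitely many such primes. -/
theorem finite_primeDivisor_le {I : Ideal R} (hI : I ≠ ⊥) :
    {q : PrimeDivisor R | I ≤ q.1.asIdeal}.Finite := by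
  have h := I.finite_minimalPrimes_of_isNoetherianRing R
  refine Set.Finite.of_finite_image (f := fun q : PrimeDivisor R => q.1.asIdeal)
    (h.subset ?_) ?_
  · rintro _ ⟨q, hq, rfl⟩
    have hr : q.1.asIdeal.FiniteHeight := ⟨Or.inr (by rw [q.2]; simp)⟩
    refine Ideal.mem_minimalPrimes_of_height_le hq ?_
    rw [q.2]
    exact Order.one_le_iff_ne_zero.mpr fun h0 => hI (by
      by_contra; exact hI (Ideal.height_eq_zero_iff_eq_bot.mp h0))
  · intro q _ r _ h
    exact Subtype.ext (PrimeSpectrum.ext h)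

open Classical in
/-- The divisor of the closed subscheme `V(I)`, for a nonzero ideal `I`. -/
noncomputable def idealDivisor (I : Ideal R) : WeilDivisor R :=
  if hI : I = ⊥ then 0 else Finsupp.ofSupportFinite (fun q => (multAlong I q : ℤ))
    ((finite_primeDivisor_le hI).subset fun q hq => by
      by_contra h
      exact hq (by simpa using (multAlong_eq_zero_iff hI).mpr h))

theorem idealDivisor_apply {I : Ideal R} (hI : I ≠ ⊥) (q : PrimeDivisor R) :
    idealDivisor I q = multAlong I q := by
  rw [idealDivisor, dif_neg hI]; rfl

theorem idealDivisor_mul {I J : Ideal R} (hI : I ≠ ⊥) (hJ : J ≠ ⊥) :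
    idealDivisor (I * J) = idealDivisor I + idealDivisor J := by
  ext q
  rw [Finsupp.add_apply, idealDivisor_apply hI, idealDivisor_apply hJ,
    idealDivisor_apply (mul_ne_zero hI hJ), multAlong_mul hI hJ]
  push_cast; rfl

theorem idealDivisor_asIdeal (q : PrimeDivisor R) :
    idealDivisor q.1.asIdeal = Finsupp.single q 1 := by
  classical
  ext r
  rw [idealDivisor_apply q.asIdeal_ne_bot, Finsupp.single_apply]
  split_ifs with h
  · rw [← h, multAlong_self]; rfl
  · rw [multAlong_of_ne h]; rfl

/-- The divisor of a nonzero element. -/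
noncomputable def elemDivisor (f : R) : WeilDivisor R := idealDivisor (Ideal.span {f})

theorem span_singleton_ne_bot {f : R} (hf : f ≠ 0) : Ideal.span {f} ≠ ⊥ := by simpa

theorem elemDivisor_apply {f : R} (hf : f ≠ 0) (q : PrimeDivisor R) :
    elemDivisor f q = multAlong (Ideal.span {f}) q :=
  idealDivisor_apply (span_singleton_ne_bot hf) q

theorem elemDivisor_mul {f g : R} (hf : f ≠ 0) (hg : g ≠ 0) :
    elemDivisor (f * g) = elemDivisor f + elemDivisor g := by
  rw [elemDivisor, ← Ideal.span_singleton_mul_span_singleton,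
    idealDivisor_mul (span_singleton_ne_bot hf) (span_singleton_ne_bot hg)]; rfl

theorem elemDivisor_of_isUnit {f : R} (hf : IsUnit f) : elemDivisor f = 0 := by
  ext q
  rw [elemDivisor_apply hf.ne_zero, Ideal.span_singleton_eq_top.mpr hf,
    (multAlong_eq_zero_iff top_ne_bot).mpr fun h => q.1.2.ne_top (top_le_iff.mp h)]
  rfl

theorem elemDivisor_pow {f : R} (hf : f ≠ 0) (n : ℕ) :
    elemDivisor (f ^ n) = n • elemDivisor f := by
  induction n with
  | zero => simp [elemDivisor_of_isUnit]
  | succ n ih => rw [pow_succ, elemDivisor_mul (pow_ne_zero n hf) hf, ih, succ_nsmul]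

theorem isDivisorOf_iff {D : WeilDivisor R} {f : R} (hf : f ≠ 0) :
    IsDivisorOf D f ↔ D = elemDivisor f := by
  rw [Finsupp.ext_iff]
  exact forall_congr' fun q => by rw [elemDivisor_apply hf]

/-- Additivity of `elemDivisor` makes the differences already closed under the group operations, so
the closure adds nothing. -/
theorem mem_principalDivisors_iff {D : WeilDivisor R} :
    D ∈ principalDivisors R ↔ ∃ f g : R, f ≠ 0 ∧ g ≠ 0 ∧ D = elemDivisor f - elemDivisor g := by
  constructor
  · intro h
    induction h using AddSubgroup.closure_induction with
    | mem D h =>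
      obtain ⟨f, hf, hD⟩ := h
      have hf := nonZeroDivisors.ne_zero hf
      exact ⟨f, 1, hf, one_ne_zero, by
        rw [elemDivisor_of_isUnit isUnit_one, sub_zero, (isDivisorOf_iff hf).mp hD]⟩
    | zero => exact ⟨1, 1, one_ne_zero, one_ne_zero, by simp⟩
    | add D E _ _ hD hE =>
      obtain ⟨f, g, hf, hg, rfl⟩ := hD
      obtain ⟨f', g', hf', hg', rfl⟩ := hE
      exact ⟨f * f', g * g', mul_ne_zero hf hf', mul_ne_zero hg hg', by
        rw [elemDivisor_mul hf hf', elemDivisor_mul hg hg']; abel⟩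
    | neg D _ hD =>
      obtain ⟨f, g, hf, hg, rfl⟩ := hD
      exact ⟨g, f, hg, hf, by abel⟩
  · rintro ⟨f, g, hf, hg, rfl⟩
    have key : ∀ f : R, f ≠ 0 → elemDivisor f ∈ principalDivisors R := fun f hf =>
      AddSubgroup.subset_closure
        ⟨f, mem_nonZeroDivisors_of_ne_zero hf, (isDivisorOf_iff hf).mpr rfl⟩
    exact sub_mem (key f hf) (key g hg)

theorem divisorClass_elemDivisor {f : R} (hf : f ≠ 0) :
    divisorClass (elemDivisor f) = 0 :=
  (QuotientAddGroup.eq_zero_iff _).mpr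
    (mem_principalDivisors_iff.mpr ⟨f, 1, hf, one_ne_zero, by simp [elemDivisor_of_isUnit]⟩)

theorem divisorClass_add (D E : WeilDivisor R) :
    divisorClass (D + E) = divisorClass D + divisorClass E := rfl

theorem mem_map_atPrime_iff {I P : Ideal R} [P.IsPrime] {x : R} :
    algebraMap R (Localization.AtPrime P) x ∈ I.map (algebraMap R (Localization.AtPrime P)) ↔
      ∃ s ∉ P, s * x ∈ I := by
  rw [IsLocalization.algebraMap_mem_map_algebraMap_iff P.primeCompl]
  rfl

/-- In a normal Noetherian local domain, the maximal ideal is principal if it is an associated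
prime of a nonzero principal ideal. -/
theorem isPrincipal_maximalIdeal_of_forall_dvd {A : Type*} [CommRing A] [IsDomain A]
    [IsNoetherianRing A] [IsIntegrallyClosed A] [IsLocalRing A] {f g : A} (hf : f ≠ 0)
    (h : ∀ z ∈ maximalIdeal A, f ∣ g * z) (hfg : ¬ f ∣ g) : (maximalIdeal A).IsPrincipal := by
  let K := FractionRing A
  have hfK : algebraMap A K f ≠ 0 := IsFractionRing.to_map_eq_zero_iff.not.mpr hf
  -- Put x = g/f, which maps the maximal ideal m into A. If x m lies in m, then x is integral by the
  -- determinant trick, hence in A, against f not dividing g. Otherwise x y is a unit for some y in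
  -- m, and y generates m.
  by_cases hm : ∀ z ∈ maximalIdeal A, ∃ y ∈ maximalIdeal A, g * z = f * y
  · exfalso
    let x : K := algebraMap A K g / algebraMap A K f
    have hxf : x * algebraMap A K f = algebraMap A K g := div_mul_cancel₀ _ hfK
    let N := Submodule.map (Algebra.linearMap A K) (maximalIdeal A)
    have hx : IsIntegral A x := by
      by_cases hfm : f ∈ maximalIdeal A
      · refine isIntegral_of_smul_mem_submodule N ?_ ?_ x ?_
        · rw [Submodule.ne_bot_iff]
          exact ⟨_, ⟨f, hfm, rfl⟩, hfK⟩
        · exact Submodule.FG.map _ (IsNoetherian.noetherian _)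
        · rintro _ ⟨z, hz, rfl⟩
          obtain ⟨y, hy, e⟩ := hm z hz
          refine ⟨y, hy, ?_⟩
          have e' := congrArg (algebraMap A K) e
          rw [map_mul, map_mul] at e'
          refine mul_right_cancel₀ hfK ?_
          simp only [Algebra.linearMap_apply, smul_eq_mul]
          linear_combination -e' - algebraMap A K z * hxf
      · exact absurd ((not_not.mp hfm : IsUnit f).dvd) hfg
    obtain ⟨y, hy⟩ := IsIntegrallyClosed.algebraMap_eq_of_integral hx
    refine hfg ⟨y, IsFractionRing.injective A K ?_⟩
    rw [map_mul, hy, mul_comm, hxf]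
  · push Not at hm
    obtain ⟨y, hy, hy'⟩ := hm
    obtain ⟨u, hu⟩ := h y hy
    have hunit : IsUnit u := by
      by_contra hn
      exact hy' u hn hu
    have hg : f ∣ g * y ∧ g * y ∣ f := by
      obtain ⟨w, rfl⟩ := hunit
      exact ⟨⟨_, hu⟩, ⟨↑w⁻¹, by rw [hu, mul_assoc, Units.mul_inv, mul_one]⟩⟩
    obtain ⟨w, hw⟩ := hg.2
    have hg0 : g ≠ 0 := by
      rintro rfl
      exact hfg (dvd_zero f)
    refine ⟨⟨y, le_antisymm (fun z hz => ?_) ?_⟩⟩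
    · obtain ⟨t, ht⟩ := h z hz
      refine Ideal.mem_span_singleton'.mpr ⟨w * t, mul_left_cancel₀ hg0 ?_⟩
      rw [ht, hw]; ring
    · rwa [Submodule.span_le, Set.singleton_subset_iff]

/-- A nonzero `g` is divisible by `f` as soon as the divisor of `g` dominates that of `f`. -/
theorem dvd_of_elemDivisor_le {f g : R} (hf : f ≠ 0) (hg : g ≠ 0)
    (h : elemDivisor f ≤ elemDivisor g) : f ∣ g := by
  by_contra hfg
  have hne : (Ideal.Quotient.mk (Ideal.span {f}) g) ≠ 0 := by
    rwa [ne_eq, Ideal.Quotient.eq_zero_iff_dvd]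
  -- Take an associated prime P of R/(f) containing the annihilator of g. The preceding lemma makes
  -- the maximal ideal of R_P principal, so P has height one. Then the hypothesis at P gives s
  -- outside P with f dividing s g, yet every such s lies in the annihilator, hence in P.
  obtain ⟨P, hP, hle⟩ := exists_le_isAssociatedPrime_of_isNoetherianRing R _ hne
  rw [isAssociatedPrime_iff] at hP
  obtain ⟨hP, y, hy⟩ := hP
  obtain ⟨y, rfl⟩ := Ideal.Quotient.mk_surjective y
  have memP : ∀ z, z ∈ P ↔ f ∣ z * y := fun z => by
    rw [hy, Submodule.mem_colon_singleton, Submodule.mem_bot, ← Ideal.Quotient.eq_zero_iff_dvd,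
      map_mul, Algebra.smul_def]; rfl
  have hle' : ∀ z, f ∣ z * g → z ∈ P := fun z hz => hle (by
    rw [Submodule.mem_colon_singleton, Submodule.mem_bot, Algebra.smul_def]
    rw [← Ideal.Quotient.eq_zero_iff_dvd, map_mul] at hz
    exact hz)
  let A := Localization.AtPrime P
  have hinj : Function.Injective (algebraMap R A) :=
    IsLocalization.injective _ P.primeCompl_le_nonZeroDivisors
  have : IsIntegrallyClosed A := isIntegrallyClosed_of_isLocalization _ P.primeCompl
    P.primeCompl_le_nonZeroDivisors
  have hdvd : ∀ z : R, algebraMap R A f ∣ algebraMap R A z ↔ ∃ s ∉ P, f ∣ s * z := fun z => by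
    simp_rw [← Ideal.mem_span_singleton]
    rw [← mem_map_atPrime_iff, Ideal.map_span, Set.image_singleton]
  have hprin : (maximalIdeal A).IsPrincipal := by
    refine isPrincipal_maximalIdeal_of_forall_dvd (f := algebraMap R A f) (g := algebraMap R A y)
      (by rwa [ne_eq, map_eq_zero_iff _ hinj]) (fun z hz => ?_) fun hd => ?_
    · rw [← Localization.AtPrime.map_eq_maximalIdeal] at hz
      obtain ⟨⟨⟨a, ha⟩, s⟩, hs⟩ := (IsLocalization.mem_map_algebraMap_iff P.primeCompl A).mp hz
      have hs' : IsUnit (algebraMap R A s) := IsLocalization.map_units A s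
      rw [← hs'.dvd_mul_right, mul_assoc, hs, ← map_mul, hdvd]
      exact ⟨1, P.one_notMem, by rw [one_mul, mul_comm]; exact (memP a).mp ha⟩
    · obtain ⟨s, hs, hsy⟩ := (hdvd y).mp hd
      exact hs ((memP s).mpr hsy)
  have hfP : f ∈ P := (memP f).mpr (dvd_mul_right f y)
  have hht : P.height = 1 := by
    apply le_antisymm
    · have := Ideal.height_le_one_of_isPrincipal_of_mem_minimalPrimes (maximalIdeal A)
        (maximalIdeal A) (by rw [Ideal.minimalPrimes_eq_subsingleton_self]; rfl)
      rwa [← IsLocalization.height_under P.primeCompl,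
        Localization.AtPrime.under_maximalIdeal] at this
    · refine Order.one_le_iff_ne_zero.mpr fun h0 => hf ?_
      rw [Ideal.height_eq_zero_iff_eq_bot] at h0
      simpa [h0] using hfP
  let q : PrimeDivisor R := ⟨⟨P, hP⟩, hht⟩
  have h1 := h q
  rw [elemDivisor_apply hf, elemDivisor_apply hg, Nat.cast_le] at h1
  have h2 := Ideal.pow_le_pow_right (I := maximalIdeal A) h1
  rw [← map_eq_pow_multAlong (span_singleton_ne_bot hf) q,
    ← map_eq_pow_multAlong (span_singleton_ne_bot hg) q, Ideal.map_span, Ideal.map_span,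
    Set.image_singleton, Set.image_singleton, Ideal.span_singleton_le_span_singleton] at h2
  obtain ⟨s, hs, hsg⟩ := (hdvd g).mp h2
  exact hs (hle' s hsg)

end DivisorTheory

/-! ### Orders and relations in a class group. -/

section ClassGroupLemmas

open IsLocalRing

variable {R : Type*} [CommRing R] [IsDomain R] [IsNoetherianRing R] [IsIntegrallyClosed R]

theorem map_atPrime_le_of_forall_exists {P I J : Ideal R} [P.IsPrime]
    (h : ∀ x ∈ I, ∃ s ∉ P, s * x ∈ J) :
    I.map (algebraMap R (Localization.AtPrime P)) ≤
      J.map (algebraMap R (Localization.AtPrime P)) := by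
  rw [Ideal.map_le_iff_le_comap]
  exact fun x hx => mem_map_atPrime_iff.mpr (h x hx)

theorem multAlong_congr {I J : Ideal R} {q : PrimeDivisor R}
    (h : I.map (algebraMap R (Localization.AtPrime q.1.asIdeal)) =
      J.map (algebraMap R (Localization.AtPrime q.1.asIdeal))) :
    multAlong I q = multAlong J q := by
  rw [multAlong, multAlong, h]

/-- If `q = (a, t)` and `a b = t ^ e w` with `b, w ∉ q`, then `a` vanishes to order `e`
along `q`. -/
theorem multAlong_eq_of_mul_eq_pow_mul {q : PrimeDivisor R} {a b t w : R} {e : ℕ} (he : 1 ≤ e)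
    (hq : q.1.asIdeal = Ideal.span {a, t}) (hb : b ∉ q.1.asIdeal) (hw : w ∉ q.1.asIdeal)
    (h : a * b = t ^ e * w) : multAlong (Ideal.span {a}) q = e := by
  have ha : (Ideal.span {a}).map (algebraMap R (Localization.AtPrime q.1.asIdeal)) =
      (Ideal.span {t ^ e}).map (algebraMap R (Localization.AtPrime q.1.asIdeal)) := by
    apply le_antisymm <;> apply map_atPrime_le_of_forall_exists <;> intro x hx <;>
      obtain ⟨y, rfl⟩ := Ideal.mem_span_singleton'.mp hx
    · exact ⟨b, hb, Ideal.mem_span_singleton'.mpr ⟨y * w, by linear_combination -y * h⟩⟩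
    · exact ⟨w, hw, Ideal.mem_span_singleton'.mpr ⟨y * b, by linear_combination y * h⟩⟩
  -- At q the element b is invertible and ab is a multiple of t because e ≥ 1, so the generator a is
  -- redundant and t is a uniformizer.
  have ht : (Ideal.span {t}).map (algebraMap R (Localization.AtPrime q.1.asIdeal)) =
      maximalIdeal _ := by
    apply le_antisymm
    · rw [← Localization.AtPrime.map_eq_maximalIdeal]
      exact Ideal.map_mono (hq ▸ Ideal.span_mono (by simp))
    · rw [← Localization.AtPrime.map_eq_maximalIdeal]
      apply map_atPrime_le_of_forall_exists
      intro x hx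
      rw [hq, Ideal.mem_span_pair] at hx
      obtain ⟨c, d, rfl⟩ := hx
      refine ⟨b, hb, Ideal.mem_span_singleton'.mpr ⟨c * t ^ (e - 1) * w + b * d, ?_⟩⟩
      obtain ⟨e, rfl⟩ := Nat.exists_eq_add_of_le' he
      rw [Nat.add_sub_cancel]
      linear_combination -c * h
  apply multAlong_eq_of_map_eq_pow
  rw [ha, ← Ideal.span_singleton_pow, Ideal.map_pow, ht]

/-- If the prime divisor `r` is generated by `g` away from `V(a)`, then `div g` and `r` agree
away from `V(a)`. -/
theorem elemDivisor_apply_of_forall_dvd {r s : PrimeDivisor R} {a g : R} (hg0 : g ≠ 0)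
    (hg : g ∈ r.1.asIdeal) (hr : ∀ x ∈ r.1.asIdeal, ∃ n : ℕ, g ∣ a ^ n * x)
    (hs : a ∉ s.1.asIdeal) : elemDivisor g s = Finsupp.single r 1 s := by
  rw [← idealDivisor_asIdeal, elemDivisor_apply hg0, idealDivisor_apply r.asIdeal_ne_bot]
  refine congrArg _ (multAlong_congr (le_antisymm ?_ ?_))
  · exact Ideal.map_mono ((Ideal.span_singleton_le_iff_mem _).mpr hg)
  · apply map_atPrime_le_of_forall_exists
    intro x hx
    obtain ⟨n, hn⟩ := hr x hx
    exact ⟨a ^ n, fun h => hs (s.1.2.mem_of_pow_mem n h), Ideal.mem_span_singleton.mpr hn⟩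

theorem divisorClass_sub_smul (D E : WeilDivisor R) (n : ℤ) :
    divisorClass (D - n • E) = divisorClass D - n • divisorClass E := rfl

/-- Assume `div a = e q`.  If `r` is generated by `g` away from `V(a)`, then the class of `r` is a
multiple of the class of `q`. -/
theorem exists_divisorClass_single_eq_smul {q r : PrimeDivisor R} {a g : R}
    (hq : ∀ s : PrimeDivisor R, a ∈ s.1.asIdeal → s = q) (hg0 : g ≠ 0)
    (hg : g ∈ r.1.asIdeal) (hr : ∀ x ∈ r.1.asIdeal, ∃ n : ℕ, g ∣ a ^ n * x)
    (hqr : r ≠ q) :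
    ∃ m : ℤ, divisorClass (Finsupp.single r 1) = m • divisorClass (Finsupp.single q 1) := by
  classical
  -- Away from q the divisor of g is r, so div g = r + ord_q(g) q.
  refine ⟨-(elemDivisor g q), ?_⟩
  have h : elemDivisor g = Finsupp.single r 1 - (-(elemDivisor g q)) • Finsupp.single q 1 := by
    ext s
    by_cases hs : s = q
    · subst hs
      simp [hqr]
    · rw [elemDivisor_apply_of_forall_dvd hg0 hg hr fun h => hs (hq s h)]
      simp [Finsupp.single_apply, Ne.symm hs]
  rw [← sub_eq_zero, ← divisorClass_sub_smul, ← h, divisorClass_elemDivisor hg0]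

theorem mem_zmultiples_of_forall_single {c : DivisorClassGroup R}
    (h : ∀ r : PrimeDivisor R, divisorClass (Finsupp.single r 1) ∈ AddSubgroup.zmultiples c)
    (x : DivisorClassGroup R) : x ∈ AddSubgroup.zmultiples c := by
  obtain ⟨D, rfl⟩ := QuotientAddGroup.mk_surjective x
  induction D using Finsupp.induction_linear with
  | zero => exact zero_mem _
  | add D E hD hE => exact add_mem hD hE
  | single r n =>
    have : Finsupp.single r n = n • (Finsupp.single r 1 : WeilDivisor R) := by simp
    rw [this]
    exact zsmul_mem (h r) n

/-- If `a` is irreducible and `div a = e q`, then the class of `q` has order `e`. -/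
theorem addOrderOf_divisorClass_single {q : PrimeDivisor R} {a : R} {e : ℕ} (he : 1 ≤ e)
    (ha : Irreducible a) (hdiv : elemDivisor a = Finsupp.single q (e : ℤ)) :
    addOrderOf (divisorClass (Finsupp.single q 1) : DivisorClassGroup R) = e := by
  have hsm : ∀ n : ℕ, n • (divisorClass (Finsupp.single q 1) : DivisorClassGroup R) =
      divisorClass (Finsupp.single q (n : ℤ)) := fun n => by
    have : Finsupp.single q (n : ℤ) = n • (Finsupp.single q 1 : WeilDivisor R) := by simp
    rw [this]; rfl
  refine (addOrderOf_eq_iff (by omega)).mpr ⟨?_, fun n hn hn0 h => ?_⟩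
  · rw [hsm, ← hdiv, divisorClass_elemDivisor ha.ne_zero]
  -- Suppose n q is principal with 0 < n < e. Being effective, it is div u for some u in R, and div
  -- u ≤ div a makes u divide a. Irreducibility then forces n = 0 or n = e.
  · rw [hsm] at h
    obtain ⟨f, g, hf, hg, hfg⟩ := mem_principalDivisors_iff.mp
      ((QuotientAddGroup.eq_zero_iff _).mp h)
    have hle : elemDivisor g ≤ elemDivisor f := by
      rw [← sub_nonneg, ← hfg]
      exact Finsupp.single_nonneg.mpr (Int.natCast_nonneg n)
    obtain ⟨u, rfl⟩ := dvd_of_elemDivisor_le hg hf hle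
    have hu := right_ne_zero_of_mul hf
    rw [elemDivisor_mul hg hu, add_sub_cancel_left] at hfg
    have hle' : elemDivisor u ≤ elemDivisor a := by
      rw [hdiv, ← hfg]
      exact Finsupp.single_le_single.mpr (by exact_mod_cast hn.le)
    obtain ⟨w, hw⟩ := dvd_of_elemDivisor_le hu ha.ne_zero hle'
    rcases ha.isUnit_or_isUnit hw with h1 | h1
    · rw [elemDivisor_of_isUnit h1, Finsupp.single_eq_zero] at hfg
      omega
    · rw [hw, elemDivisor_mul hu h1.ne_zero, elemDivisor_of_isUnit h1, add_zero, ← hfg] at hdiv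
      have := Finsupp.single_injective q hdiv
      omega

end ClassGroupLemmas

/-! ### Pullback of divisors and the natural map of class groups. -/

section NaturalMap

open IsLocalRing

variable {A B : Type*} [CommRing A] [IsDomain A] [IsNoetherianRing A] [IsIntegrallyClosed A]
  [CommRing B] [IsDomain B] [IsNoetherianRing B] [IsIntegrallyClosed B] [Algebra A B]

/-- The pullback of Weil divisors along `A → B`. -/
noncomputable def divisorPullback (A B : Type*) [CommRing A] [IsDomain A] [IsNoetherianRing A]
    [IsIntegrallyClosed A] [CommRing B] [IsDomain B] [IsNoetherianRing B] [IsIntegrallyClosed B]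
    [Algebra A B] : WeilDivisor A →+ WeilDivisor B :=
  Finsupp.liftAddHom fun q =>
    (zmultiplesHom _) (idealDivisor (q.1.asIdeal.map (algebraMap A B)))

theorem divisorPullback_single (q : PrimeDivisor A) (n : ℤ) :
    divisorPullback A B (Finsupp.single q n) =
      n • idealDivisor (q.1.asIdeal.map (algebraMap A B)) := by
  simp [divisorPullback]

theorem divisorPullback_apply (D : WeilDivisor A) (r : PrimeDivisor B) :
    divisorPullback A B D r =
      D.sum fun q n => n * idealDivisor (q.1.asIdeal.map (algebraMap A B)) r := by
  simp [divisorPullback, Finsupp.liftAddHom_apply, Finsupp.sum_apply]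

/-- The extension of (f) to B_r can be computed through A_q, where (f) is a power of the maximal
ideal. The second factor is the ramification index of r over q. -/
theorem multAlong_map_eq_mul (hinj : Function.Injective (algebraMap A B)) {f : A} (hf : f ≠ 0)
    {q : PrimeDivisor A} {r : PrimeDivisor B}
    (hqr : q.1.asIdeal = r.1.asIdeal.comap (algebraMap A B)) :
    multAlong (Ideal.span {algebraMap A B f}) r =
      multAlong (Ideal.span {f}) q * multAlong (q.1.asIdeal.map (algebraMap A B)) r := by
  have hmap : ∀ I : Ideal A,
      (I.map (algebraMap A B)).map (algebraMap B (Localization.AtPrime r.1.asIdeal)) =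
        (I.map (algebraMap A (Localization.AtPrime q.1.asIdeal))).map
          (Localization.localRingHom q.1.asIdeal r.1.asIdeal (algebraMap A B) hqr) := fun I => by
    rw [Ideal.map_map, Ideal.map_map]
    congr 1
    ext x
    simp [Localization.localRingHom_to_map]
  apply multAlong_eq_of_map_eq_pow
  have hne : q.1.asIdeal.map (algebraMap A B) ≠ ⊥ := by
    rw [ne_eq, Ideal.map_eq_bot_iff_of_injective hinj]
    exact q.asIdeal_ne_bot
  have h1 : Ideal.span {algebraMap A B f} = (Ideal.span {f}).map (algebraMap A B) := by
    rw [Ideal.map_span, Set.image_singleton]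
  rw [h1, hmap, map_eq_pow_multAlong (span_singleton_ne_bot hf), Ideal.map_pow,
    ← Localization.AtPrime.map_eq_maximalIdeal, ← hmap, map_eq_pow_multAlong hne, ← pow_mul,
    mul_comm]

/-- Compare coefficients at r. If r contracts to zero, both vanish. Otherwise `hht` makes the
contraction a prime divisor, it is the only one whose extension lies in r, and multiplicities
multiply. -/
theorem divisorPullback_elemDivisor (hinj : Function.Injective (algebraMap A B))
    (hht : ∀ r : PrimeDivisor B, r.1.asIdeal.comap (algebraMap A B) ≠ ⊥ →
      (r.1.asIdeal.comap (algebraMap A B)).height = 1) {f : A} (hf : f ≠ 0) :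
    divisorPullback A B (elemDivisor f) = elemDivisor (algebraMap A B f) := by
  classical
  have hf' : algebraMap A B f ≠ 0 := by rwa [ne_eq, map_eq_zero_iff _ hinj]
  have hne : ∀ q : PrimeDivisor A, q.1.asIdeal.map (algebraMap A B) ≠ ⊥ := fun q => by
    rw [ne_eq, Ideal.map_eq_bot_iff_of_injective hinj]
    exact q.asIdeal_ne_bot
  ext r
  rw [divisorPullback_apply, elemDivisor_apply hf']
  by_cases hr : r.1.asIdeal.comap (algebraMap A B) = ⊥
  · have h1 : multAlong (Ideal.span {algebraMap A B f}) r = 0 := by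
      rw [multAlong_eq_zero_iff (span_singleton_ne_bot hf'), Ideal.span_singleton_le_iff_mem]
      intro h
      have : f ∈ r.1.asIdeal.comap (algebraMap A B) := h
      rw [hr] at this
      exact hf this
    rw [h1]
    refine Finset.sum_eq_zero fun q _ => ?_
    dsimp only
    rw [idealDivisor_apply (hne q), (multAlong_eq_zero_iff (hne q)).mpr, Nat.cast_zero, mul_zero]
    rw [Ideal.map_le_iff_le_comap, hr, le_bot_iff]
    exact q.asIdeal_ne_bot
  · let q : PrimeDivisor A :=
      ⟨⟨r.1.asIdeal.comap (algebraMap A B), Ideal.IsPrime.comap _⟩, hht r hr⟩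
    rw [multAlong_map_eq_mul (q := q) hinj hf rfl, Finsupp.sum, Finset.sum_eq_single q]
    · rw [elemDivisor_apply hf, idealDivisor_apply (hne q)]
      push_cast; rfl
    · intro s _ hs
      rw [idealDivisor_apply (hne s), (multAlong_eq_zero_iff (hne s)).mpr, Nat.cast_zero, mul_zero]
      rw [Ideal.map_le_iff_le_comap]
      exact fun h => hs (PrimeDivisor.eq_of_le (r := q) h)
    · intro h
      rw [Finsupp.notMem_support_iff.mp h, zero_mul]

/-- The natural homomorphism of class groups exists if the primes of height one of `B` contract to
primes of height at most one. -/
theorem exists_isNaturalClassMap (hinj : Function.Injective (algebraMap A B))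
    (hht : ∀ r : PrimeDivisor B, r.1.asIdeal.comap (algebraMap A B) ≠ ⊥ →
      (r.1.asIdeal.comap (algebraMap A B)).height = 1) :
    ∃ φ : DivisorClassGroup A →+ DivisorClassGroup B, IsNaturalClassMap φ ∧
      ∀ q : PrimeDivisor A, φ (divisorClass (Finsupp.single q 1)) =
        divisorClass (idealDivisor (q.1.asIdeal.map (algebraMap A B))) := by
  have hle : principalDivisors A ≤ (principalDivisors B).comap (divisorPullback A B) := by
    intro D hD
    obtain ⟨f, g, hf, hg, rfl⟩ := mem_principalDivisors_iff.mp hD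
    rw [AddSubgroup.mem_comap, map_sub, divisorPullback_elemDivisor hinj hht hf,
      divisorPullback_elemDivisor hinj hht hg]
    exact mem_principalDivisors_iff.mpr ⟨_, _, by rwa [ne_eq, map_eq_zero_iff _ hinj],
      by rwa [ne_eq, map_eq_zero_iff _ hinj], rfl⟩
  have key : ∀ q : PrimeDivisor A, (QuotientAddGroup.map (principalDivisors A)
      (principalDivisors B) (divisorPullback A B) hle) (divisorClass (Finsupp.single q 1)) =
        divisorClass (idealDivisor (q.1.asIdeal.map (algebraMap A B))) := fun q => by
    refine (QuotientAddGroup.map_mk _ _ _ _ _).trans ?_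
    rw [divisorPullback_single, one_smul]; rfl
  refine ⟨_, fun q => ⟨_, fun r => idealDivisor_apply ?_ r, key q⟩, key⟩
  rw [ne_eq, Ideal.map_eq_bot_iff_of_injective hinj]
  exact q.asIdeal_ne_bot

end NaturalMap

/-! ### The quotient of a lattice by one vector. -/

section QuotientByVector

/-- The quotient of `ℤ^v` by a vector whose entries have gcd `D` is `ℤ/D × ℤ^(v-1)`. -/
theorem nonempty_quotient_zmultiples_addEquiv {v : ℕ} (hv : 0 < v) (e : Fin v → ℕ)
    (he : ∀ i, 1 ≤ e i) :
    Nonempty ((Fin v → ℤ) ⧸ AddSubgroup.zmultiples (fun i => (e i : ℤ)) ≃+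
      ZMod (Finset.univ.gcd e) × (Fin (v - 1) → ℤ)) := by
  set D := Finset.univ.gcd e with hD
  have hD0 : D ≠ 0 := fun h => by
    have := Finset.gcd_eq_zero_iff.mp h ⟨0, hv⟩ (Finset.mem_univ _)
    have := he ⟨0, hv⟩
    omega
  have hdvd : ∀ i, D ∣ e i := fun i => Finset.gcd_dvd (Finset.mem_univ i)
  choose e' he' using hdvd
  obtain ⟨c, hc⟩ : ∃ c : Fin v → ℤ, ∑ i, c i * e i = D := by
    obtain ⟨g, hg⟩ := Finset.gcd_eq_sum_mul Finset.univ (fun i => (e i : ℤ))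
    obtain ⟨m, hm⟩ : Finset.univ.gcd (fun i => (e i : ℤ)) ∣ (D : ℤ) := by
      rw [← Int.natAbs_dvd_natAbs, Int.natAbs_natCast]
      refine Finset.dvd_gcd fun i _ => ?_
      have := Int.natAbs_dvd_natAbs.mpr
        (Finset.gcd_dvd (f := fun i => (e i : ℤ)) (Finset.mem_univ i))
      rwa [Int.natAbs_natCast] at this
    refine ⟨fun i => m * g i, ?_⟩
    rw [hm, hg, Finset.sum_mul]
    exact Finset.sum_congr rfl fun i _ => by ring
  -- By Bézout, l takes the value 1 on w = e/D. Hence ℤ^v = ℤw ⊕ ker l with ker l free of rank v -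
  -- 1, and dividing by e = Dw only affects the first summand.
  let l : (Fin v → ℤ) →ₗ[ℤ] ℤ := ∑ i, c i • LinearMap.proj i
  have hl : ∀ x, l x = ∑ i, c i * x i := fun x => by simp [l]
  let w : Fin v → ℤ := fun i => e' i
  have hlw : l w = 1 := by
    have : (D : ℤ) * l w = D * 1 := by
      rw [mul_one, hl, Finset.mul_sum]
      refine Eq.trans ?_ hc
      refine Finset.sum_congr rfl fun i _ => ?_
      simp only [w, he' i]; push_cast; ring
    exact mul_left_cancel₀ (by exact_mod_cast hD0) this
  have hsurj : LinearMap.range l = ⊤ := LinearMap.range_eq_top.mpr fun n =>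
    ⟨n • w, by rw [map_smul, hlw, smul_eq_mul, mul_one]⟩
  have hrank : Module.finrank ℤ (LinearMap.ker l) = v - 1 := by
    have := Submodule.finrank_quotient_add_finrank (LinearMap.ker l)
    rw [l.quotKerEquivRange.finrank_eq, hsurj, finrank_top, Module.finrank_self,
      Module.finrank_fin_fun] at this
    omega
  let b : LinearMap.ker l ≃ₗ[ℤ] (Fin (v - 1) → ℤ) :=
    (Module.finBasisOfFinrankEq ℤ (LinearMap.ker l) hrank).equivFun
  let pr : (Fin v → ℤ) →ₗ[ℤ] LinearMap.ker l :=
    LinearMap.codRestrict _ (LinearMap.id - l.smulRight w) fun x => by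
      rw [LinearMap.mem_ker, LinearMap.sub_apply, map_sub, LinearMap.smulRight_apply, map_smul,
        hlw]
      simp
  let F : (Fin v → ℤ) →+ ZMod D × (Fin (v - 1) → ℤ) :=
    ((Int.castAddHom (ZMod D)).comp l.toAddMonoidHom).prod (b.toAddMonoidHom.comp pr.toAddMonoidHom)
  have hF : ∀ x, F x = ((l x : ZMod D), b (pr x)) := fun x => rfl
  have hpr : ∀ x, (pr x : Fin v → ℤ) = x - l x • w := fun x => rfl
  have hker : F.ker = AddSubgroup.zmultiples (fun i => (e i : ℤ)) := by
    have hew : (fun i => (e i : ℤ)) = (D : ℤ) • w := by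
      ext i; simp [w, he' i]
    ext x
    rw [AddMonoidHom.mem_ker, hF, Prod.mk_eq_zero, hew, AddSubgroup.mem_zmultiples_iff,
      LinearEquiv.map_eq_zero_iff, ← Submodule.coe_eq_zero, hpr, sub_eq_zero,
      ZMod.intCast_zmod_eq_zero_iff_dvd]
    constructor
    · rintro ⟨⟨n, hn⟩, hx⟩
      exact ⟨n, by rw [smul_smul, mul_comm, ← hn, ← hx]⟩
    · rintro ⟨n, rfl⟩
      rw [map_smul, map_smul, hlw, smul_eq_mul, smul_eq_mul, mul_one, smul_smul]
      exact ⟨dvd_mul_left _ _, rfl⟩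
  have hFs : Function.Surjective F := by
    rintro ⟨m, y⟩
    obtain ⟨n, rfl⟩ := ZMod.intCast_surjective m
    refine ⟨n • w + (b.symm y : LinearMap.ker l), ?_⟩
    have h1 : l (n • w + (b.symm y : LinearMap.ker l)) = n := by
      rw [map_add, map_smul, hlw, LinearMap.mem_ker.mp (b.symm y).2]; simp
    have h2 : pr (n • w + (b.symm y : LinearMap.ker l)) = b.symm y := by
      apply Subtype.ext
      rw [hpr, h1, add_sub_cancel_left]
    rw [hF, h1, h2, LinearEquiv.apply_symm_apply]
  exact ⟨(QuotientAddGroup.quotientAddEquivOfEq hker.symm).trans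
    (QuotientAddGroup.quotientKerEquivOfSurjective F hFs)⟩

end QuotientByVector

/-! ### Coordinates and normal forms on the double plane. -/

namespace DoublePlane

open Polynomial

variable {k : Type*} [Field k] (p : k[X])

/-- The coordinate `x` on the double plane. -/
noncomputable def x : DoublePlane p := Ideal.Quotient.mk _ (MvPolynomial.X 0)

/-- The function `a = y - z` on the double plane. -/
noncomputable def a : DoublePlane p :=
  Ideal.Quotient.mk _ (MvPolynomial.X 1 - MvPolynomial.X 2)

/-- The function `b = y + z` on the double plane. -/
noncomputable def b : DoublePlane p :=
  Ideal.Quotient.mk _ (MvPolynomial.X 1 + MvPolynomial.X 2)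

theorem a_mul_b : a p * b p = aeval (x p) p := by
  have h : aeval (x p) p = Ideal.Quotient.mk (Ideal.span {doublePlaneEq p})
      (aeval (MvPolynomial.X 0) p) :=
    aeval_algHom_apply (Ideal.Quotient.mkₐ k (Ideal.span {doublePlaneEq p}))
      (MvPolynomial.X 0 : MvPolynomial (Fin 3) k) p
  rw [h, a, b, ← map_mul, Ideal.Quotient.mk_eq_mk_iff_sub_mem]
  refine Ideal.mem_span_singleton'.mpr ⟨-1, ?_⟩
  rw [doublePlaneEq]; ring

variable {A : Type*} [CommRing A] [Algebra k A] [NeZero (2 : k)]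

theorem inv_two_add_inv_two : (2 : k)⁻¹ + 2⁻¹ = 1 := by
  rw [← two_mul, mul_inv_cancel₀ two_ne_zero]

theorem inv_two_smul_add_self (c : A) : (2 : k)⁻¹ • (c + c) = c := by
  rw [smul_add, ← add_smul, inv_two_add_inv_two, one_smul]

theorem algHom_ext {f g : DoublePlane p →ₐ[k] A} (hx : f (x p) = g (x p)) (ha : f (a p) = g (a p))
    (hb : f (b p) = g (b p)) : f = g := by
  apply Ideal.Quotient.algHom_ext
  apply MvPolynomial.algHom_ext
  have h1 : (Ideal.Quotient.mk (Ideal.span {doublePlaneEq p}) (MvPolynomial.X 1)) =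
      (2 : k)⁻¹ • (a p + b p) := by
    rw [a, b, ← map_add, ← inv_two_smul_add_self (k := k)
      (Ideal.Quotient.mk (Ideal.span {doublePlaneEq p}) (MvPolynomial.X 1)), ← map_add]
    congr 2; ring
  have h2 : (Ideal.Quotient.mk (Ideal.span {doublePlaneEq p}) (MvPolynomial.X 2)) =
      (2 : k)⁻¹ • (b p - a p) := by
    rw [a, b, ← map_sub, ← inv_two_smul_add_self (k := k)
      (Ideal.Quotient.mk (Ideal.span {doublePlaneEq p}) (MvPolynomial.X 2)), ← map_add]
    congr 2; ring
  intro i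
  fin_cases i
  · exact hx
  · change f (Ideal.Quotient.mk _ (MvPolynomial.X 1)) = g (Ideal.Quotient.mk _ (MvPolynomial.X 1))
    rw [h1, map_smul, map_smul, map_add, map_add, ha, hb]
  · change f (Ideal.Quotient.mk _ (MvPolynomial.X 2)) = g (Ideal.Quotient.mk _ (MvPolynomial.X 2))
    rw [h2, map_smul, map_smul, map_sub, map_sub, ha, hb]

/-- The homomorphism from `T` to a `k`-algebra given by elements with `a b = p(x)`. -/
noncomputable def lift (x' a' b' : A) (h : a' * b' = aeval x' p) : DoublePlane p →ₐ[k] A :=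
  Ideal.Quotient.liftₐ _ (MvPolynomial.aeval
    ![x', (2 : k)⁻¹ • (a' + b'), (2 : k)⁻¹ • (b' - a')]) (by
    intro f hf
    have h1 : Ideal.span {doublePlaneEq p} ≤ RingHom.ker (MvPolynomial.aeval (R := k)
        ![x', (2 : k)⁻¹ • (a' + b'), (2 : k)⁻¹ • (b' - a')]) := by
      rw [Ideal.span_singleton_le_iff_mem, RingHom.mem_ker]
      have h4 : algebraMap k A (2 : k)⁻¹ * 2 = 1 := by
        rw [← map_ofNat (algebraMap k A) 2, ← map_mul, inv_mul_cancel₀ two_ne_zero, map_one]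
      rw [doublePlaneEq, map_add, map_sub, map_pow, map_pow, ← aeval_algHom_apply]
      simp only [MvPolynomial.aeval_X, Matrix.cons_val, ← h, Algebra.smul_def]
      linear_combination -(a' * b') * (1 + algebraMap k A (2 : k)⁻¹ * 2) * h4
    exact h1 hf)

variable {x' a' b' : A} (h : a' * b' = aeval x' p)

@[simp] theorem lift_x : lift p x' a' b' h (x p) = x' := by
  change MvPolynomial.aeval _ (MvPolynomial.X 0) = _
  simp

@[simp] theorem lift_a : lift p x' a' b' h (a p) = a' := by
  change MvPolynomial.aeval _ (MvPolynomial.X 1 - MvPolynomial.X 2) = _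
  rw [map_sub, MvPolynomial.aeval_X, MvPolynomial.aeval_X]
  simp only [Matrix.cons_val]
  rw [← smul_sub, show a' + b' - (b' - a') = a' + a' by ring, inv_two_smul_add_self]

@[simp] theorem lift_b : lift p x' a' b' h (b p) = b' := by
  change MvPolynomial.aeval _ (MvPolynomial.X 1 + MvPolynomial.X 2) = _
  rw [map_add, MvPolynomial.aeval_X, MvPolynomial.aeval_X]
  simp only [Matrix.cons_val]
  rw [← smul_add, show a' + b' + (b' - a') = b' + b' by ring, inv_two_smul_add_self]

/-- The generators satisfy ab = p(x) inside the subalgebra, so `lift` factors the identity of T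
through it. -/
theorem adjoin_eq_top : Algebra.adjoin k {x p, a p, b p} = ⊤ := by
  let S := Algebra.adjoin k {x p, a p, b p}
  have hx : x p ∈ S := Algebra.subset_adjoin (by simp)
  have ha : a p ∈ S := Algebra.subset_adjoin (by simp)
  have hb : b p ∈ S := Algebra.subset_adjoin (by simp)
  let f : DoublePlane p →ₐ[k] S := lift p (⟨x p, hx⟩ : S) ⟨a p, ha⟩ ⟨b p, hb⟩ (by
    apply Subtype.ext
    change a p * b p = S.val _
    rw [← aeval_algHom_apply]
    exact a_mul_b p)
  have hf : S.val.comp f = AlgHom.id k _ := algHom_ext p (by simp [f]) (by simp [f]) (by simp [f])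
  refine eq_top_iff.mpr fun s _ => ?_
  have := congrArg (fun g => g s) hf
  simp only [AlgHom.comp_apply, AlgHom.id_apply] at this
  rw [← this]
  exact (f s).2

theorem induction_on {P : DoublePlane p → Prop} (s : DoublePlane p)
    (hC : ∀ c, P (algebraMap k _ c)) (hadd : ∀ s t, P s → P t → P (s + t))
    (hmul : ∀ s t, P s → P t → P (s * t)) (hx : P (x p)) (ha : P (a p)) (hb : P (b p)) : P s := by
  have hs : s ∈ Algebra.adjoin k {x p, a p, b p} := by rw [adjoin_eq_top]; trivial
  induction hs using Algebra.adjoin_induction with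
  | mem y hy => rcases hy with rfl | rfl | rfl <;> assumption
  | algebraMap c => exact hC c
  | add s t _ _ hs ht => exact hadd s t hs ht
  | mul s t _ _ hs ht => exact hmul s t hs ht

/-- The automorphism of `T` exchanging `a` and `b`. -/
noncomputable def swap : DoublePlane p ≃ₐ[k] DoublePlane p :=
  AlgEquiv.ofAlgHom (lift p (x p) (b p) (a p) (by rw [mul_comm, a_mul_b]))
    (lift p (x p) (b p) (a p) (by rw [mul_comm, a_mul_b]))
    (algHom_ext p (by simp) (by simp) (by simp)) (algHom_ext p (by simp) (by simp) (by simp))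

@[simp] theorem swap_a : swap p (a p) = b p := lift_a p (by rw [mul_comm, a_mul_b])

/-- Evaluation of a polynomial in two variables. -/
noncomputable def biEval (x' y' : A) : k[X][X] →ₐ[k] A :=
  { eval₂RingHom (aeval x' : k[X] →ₐ[k] A).toRingHom y' with
    commutes' := fun r => by
      have : algebraMap k k[X][X] r = C (C r) := rfl
      simp [this] }

@[simp] theorem biEval_C (x' y' : A) (f : k[X]) : biEval x' y' (C f) = aeval x' f :=
  eval₂_C _ _

@[simp] theorem biEval_X (x' y' : A) : biEval (k := k) x' y' X = y' := eval₂_X _ _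

/-- The homomorphism `k[x][a] → T`. -/
noncomputable def ofPoly : k[X][X] →ₐ[k] DoublePlane p := biEval (x p) (a p)

@[simp] theorem ofPoly_C (f : k[X]) : ofPoly p (C f) = aeval (x p) f := biEval_C _ _ _

@[simp] theorem ofPoly_X : ofPoly p X = a p := biEval_X _ _

/-- The homomorphism `k[x][b] → T`. -/
noncomputable def ofPoly' : k[X][X] →ₐ[k] DoublePlane p := biEval (x p) (b p)

@[simp] theorem ofPoly'_C (f : k[X]) : ofPoly' p (C f) = aeval (x p) f := biEval_C _ _ _

@[simp] theorem ofPoly'_X : ofPoly' p X = b p := biEval_X _ _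

/-- Every element of `T` is of the form `f(x, a) + b g(x, b)`. -/
theorem exists_normalForm (s : DoublePlane p) :
    ∃ f g : k[X][X], s = ofPoly p f + b p * ofPoly' p g := by
  -- Normal forms include 1, so stability under multiplication by every s suffices, and this needs
  -- checking only on generators.
  suffices h : ∀ f g : k[X][X], ∃ f' g' : k[X][X],
      s * (ofPoly p f + b p * ofPoly' p g) = ofPoly p f' + b p * ofPoly' p g' by
    simpa using h 1 0
  induction s using induction_on p with
  | hC c => exact fun f g => ⟨algebraMap k _ c * f, algebraMap k _ c * g, by
      rw [map_mul, map_mul, AlgHom.commutes, AlgHom.commutes]; ring⟩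
  | hadd s t hs ht =>
    intro f g
    obtain ⟨f₁, g₁, h₁⟩ := hs f g
    obtain ⟨f₂, g₂, h₂⟩ := ht f g
    exact ⟨f₁ + f₂, g₁ + g₂, by rw [add_mul, h₁, h₂, map_add, map_add]; ring⟩
  | hmul s t hs ht =>
    intro f g
    obtain ⟨f₁, g₁, h₁⟩ := ht f g
    obtain ⟨f₂, g₂, h₂⟩ := hs f₁ g₁
    exact ⟨f₂, g₂, by rw [mul_assoc, h₁, h₂]⟩
  | hx => exact fun f g => ⟨C X * f, C X * g, by
      rw [map_mul, map_mul, ofPoly_C, ofPoly'_C, aeval_X]; ring⟩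
  | ha =>
    intro f g
    -- Since ab = p(x), multiplication by a turns b g(x,b) into p(x) g(x,b); its constant term in b
    -- joins the first summand and the rest is again divisible by b.
    refine ⟨X * f + C p * C (g.coeff 0), C p * g.divX, ?_⟩
    have hg : ofPoly' p g = ofPoly' p g.divX * b p + aeval (x p) (g.coeff 0) := by
      conv_lhs => rw [← g.divX_mul_X_add]
      rw [map_add, map_mul, ofPoly'_X, ofPoly'_C]
    rw [hg, map_add, map_mul, map_mul, map_mul, ofPoly_X, ofPoly_C, ofPoly_C, ofPoly'_C]
    linear_combination (ofPoly' p g.divX * b p + aeval (x p) (g.coeff 0)) * a_mul_b p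
  | hb =>
    intro f g
    refine ⟨C p * f.divX, C (f.coeff 0) + X * g, ?_⟩
    have hf : ofPoly p f = ofPoly p f.divX * a p + aeval (x p) (f.coeff 0) := by
      conv_lhs => rw [← f.divX_mul_X_add]
      rw [map_add, map_mul, ofPoly_X, ofPoly_C]
    rw [hf, map_add, map_mul, map_mul, ofPoly_C, ofPoly'_X, ofPoly'_C]
    linear_combination (ofPoly p f.divX) * a_mul_b p

/-- The homomorphism `T → k[x][a, 1/a]`. -/
noncomputable def toLaurent : DoublePlane p →ₐ[k] LaurentPolynomial k[X] :=
  lift p (LaurentPolynomial.C X) (LaurentPolynomial.T 1)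
    (LaurentPolynomial.C p * LaurentPolynomial.T (-1)) (by
      rw [mul_left_comm, ← LaurentPolynomial.T_add]
      have := aeval_algHom_apply (IsScalarTower.toAlgHom k k[X] (LaurentPolynomial k[X])) X p
      rw [aeval_X_left_apply] at this
      simpa using this.symm)

theorem toLaurent_aeval_x (f : k[X]) :
    toLaurent p (aeval (x p) f) = LaurentPolynomial.C f := by
  rw [← aeval_algHom_apply, toLaurent, lift_x]
  have := aeval_algHom_apply (IsScalarTower.toAlgHom k k[X] (LaurentPolynomial k[X])) X f
  rw [aeval_X_left_apply] at this
  simpa using this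

theorem toLaurent_ofPoly (f : k[X][X]) : toLaurent p (ofPoly p f) = f.toLaurent := by
  have h : (toLaurent p).toRingHom.comp (ofPoly p).toRingHom = Polynomial.toLaurent := by
    refine Polynomial.ringHom_ext (fun r => ?_) ?_
    · simp [toLaurent_aeval_x]
    · simp [toLaurent]
  exact RingHom.congr_fun h f

theorem toLaurent_b_mul_ofPoly' (g : k[X][X]) : toLaurent p (b p * ofPoly' p g) =
    LaurentPolynomial.invert ((X * g).comp (C p * X)).toLaurent := by
  have h : (toLaurent p).toRingHom.comp (ofPoly' p).toRingHom =
      (LaurentPolynomial.invert (R := k[X])).toRingHom.comp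
        (Polynomial.toLaurent.comp (compRingHom (C p * X))) := by
    refine Polynomial.ringHom_ext (fun r => ?_) ?_
    · simp [toLaurent_aeval_x]
    · simp [toLaurent]
  rw [← ofPoly'_X, ← map_mul]
  exact RingHom.congr_fun h (X * g)

/-- In a normal form, f(x,a) has only nonnegative exponents of a, while b g(x,b) with b = p/a has
only negative ones. So the two parts vanish separately, and g = 0 because the substitution X ↦ pX is
injective. -/
theorem toLaurent_injective (hp : p ≠ 0) : Function.Injective (toLaurent p) := by
  rw [injective_iff_map_eq_zero]
  intro s hs
  obtain ⟨f, g, rfl⟩ := exists_normalForm p s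
  rw [map_add, toLaurent_ofPoly, toLaurent_b_mul_ofPoly'] at hs
  set g' := (X * g).comp (C p * X) with hg'
  have hneg : ∀ (q : k[X][X]) (n : ℕ), q.toLaurent.coeff (-(n + 1 : ℤ)) = 0 := by
    intro q n
    by_contra h
    have := Finsupp.mem_support_iff.mpr h
    rw [LaurentPolynomial.support_coeff_toLaurent] at this
    obtain ⟨m, -, hm⟩ := Finset.mem_map.mp this
    simp at hm
    omega
  have hpos : ∀ (q : k[X][X]) (n : ℕ), q.toLaurent.coeff (n : ℤ) = q.coeff n := by
    intro q n
    rw [LaurentPolynomial.coeff_toLaurent]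
    exact Finsupp.mapDomain_apply Nat.castEmbedding.injective _ _
  have h0 : g'.coeff 0 = 0 := by
    simp [hg', Polynomial.coeff_zero_eq_eval_zero]
  have hf : f = 0 := by
    ext1 n
    have h1 := congrArg (fun q => q.coeff (n : ℤ)) hs
    simp only [AddMonoidAlgebra.coeff_add, Finsupp.add_apply, LaurentPolynomial.invert_apply,
      hpos] at h1
    rcases n with _ | n
    · have h2 := hpos g' 0
      rw [h0] at h2
      simp only [Nat.cast_zero, neg_zero] at h1 h2
      rw [h2, add_zero] at h1
      exact h1
    · have h2 := hneg g' n
      push_cast at h1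
      rw [h2, add_zero] at h1
      exact h1
  rw [hf, map_zero, zero_add, EmbeddingLike.map_eq_zero_iff, Polynomial.toLaurent_eq_zero, hg',
    comp_C_mul_X_eq_zero_iff (mem_nonZeroDivisors_of_ne_zero hp)] at hs
  rw [hf, (mul_eq_zero_iff_left X_ne_zero).mp hs]
  simp

end DoublePlane

/-! ### Normality from two principal open subsets. -/

section IntegrallyClosedAway

variable {R : Type*} [CommRing R] [IsDomain R]

/-- An element integral over R is integral over the normal ring R[1/a], hence lies in it; clearing
the denominator gives the power. -/
theorem exists_pow_mul_eq_algebraMap_of_isIntegral {a : R} (ha : a ≠ 0)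
    [IsIntegrallyClosed (Localization.Away a)] {z : FractionRing R} (hz : IsIntegral R z) :
    ∃ (n : ℕ) (s : R), algebraMap R (FractionRing R) a ^ n * z = algebraMap R _ s := by
  have hle : Submonoid.powers a ≤ nonZeroDivisors R := powers_le_nonZeroDivisors_of_noZeroDivisors ha
  let f : Localization.Away a →+* FractionRing R :=
    IsLocalization.Away.lift (S := Localization.Away a) (g := algebraMap R (FractionRing R)) a
      (IsUnit.mk0 _ (by simpa using ha))
  let _ : Algebra (Localization.Away a) (FractionRing R) := f.toAlgebra
  have : IsScalarTower R (Localization.Away a) (FractionRing R) :=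
    IsScalarTower.of_algebraMap_eq fun r => (IsLocalization.Away.lift_eq a _ r).symm
  have : IsDomain (Localization.Away a) := IsLocalization.isDomain_localization hle
  have : IsFractionRing (Localization.Away a) (FractionRing R) :=
    IsFractionRing.isFractionRing_of_isDomain_of_isLocalization (Submonoid.powers a) _ _
  obtain ⟨y, rfl⟩ := IsIntegrallyClosed.algebraMap_eq_of_integral
    (hz.tower_top (A := Localization.Away a))
  obtain ⟨n, s, h⟩ := IsLocalization.Away.surj a y
  refine ⟨n, s, ?_⟩
  rw [IsScalarTower.algebraMap_apply R (Localization.Away a) (FractionRing R) s, ← h, map_mul,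
    map_pow, ← IsScalarTower.algebraMap_apply, mul_comm]

/-- A domain is normal if it is normal away from `V(a)` and away from `V(b)`, and `a, b` is a
regular sequence. -/
theorem isIntegrallyClosed_of_away {a b : R} (ha : a ≠ 0) (hb : b ≠ 0)
    [IsIntegrallyClosed (Localization.Away a)] [IsIntegrallyClosed (Localization.Away b)]
    (hab : ∀ s, a ∣ b * s → a ∣ s) : IsIntegrallyClosed R := by
  have h1 : ∀ (m : ℕ) s, a ∣ b ^ m * s → a ∣ s := by
    intro m
    induction m with
    | zero => intro s h; simpa using h
    | succ m ih => exact fun s h => ih s (hab _ (by rwa [pow_succ', mul_assoc] at h))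
  have h2 : ∀ (n m : ℕ) s, a ^ n ∣ b ^ m * s → a ^ n ∣ s := by
    intro n m
    induction n with
    | zero => intro s _; simp
    | succ n ih =>
      intro s h
      obtain ⟨t, rfl⟩ := h1 m s ((dvd_pow_self a n.succ_ne_zero).trans h)
      rw [pow_succ', mul_left_comm, mul_dvd_mul_iff_left ha] at h
      rw [pow_succ']
      exact mul_dvd_mul_left a (ih t h)
  refine (isIntegrallyClosed_iff (FractionRing R)).mpr fun {z} hz => ?_
  obtain ⟨n, s, hs⟩ := exists_pow_mul_eq_algebraMap_of_isIntegral ha hz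
  obtain ⟨m, t, ht⟩ := exists_pow_mul_eq_algebraMap_of_isIntegral hb hz
  -- The same fraction is s/a^n and t/b^m, and regularity of the sequence lets a^n be divided out of
  -- s.
  have hst : b ^ m * s = a ^ n * t := by
    apply IsFractionRing.injective R (FractionRing R)
    rw [map_mul, map_mul, ← hs, ← ht, map_pow, map_pow]; ring
  obtain ⟨y, rfl⟩ := h2 n m s ⟨t, hst⟩
  refine ⟨y, mul_left_cancel₀ (pow_ne_zero n (?_ : algebraMap R (FractionRing R) a ≠ 0)) ?_⟩
  · simpa using ha
  · rw [hs, map_mul, map_pow]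

end IntegrallyClosedAway

/-! ### Normality and units of the double plane. -/

namespace DoublePlane

open Polynomial

variable {k : Type*} [Field k] (p : k[X]) [NeZero (2 : k)]

theorem isDomain (hp : p ≠ 0) : IsDomain (DoublePlane p) :=
  (toLaurent_injective p hp).isDomain (toLaurent p).toRingHom

theorem ofPoly_injective : Function.Injective (ofPoly p) := fun f g h => by
  have := congrArg (toLaurent p) h
  rwa [toLaurent_ofPoly, toLaurent_ofPoly, Polynomial.toLaurent_inj] at this

/-- Multiplying by a replaces b by p(x). This is the surjectivity half of T[1/a] = k[x][a, 1/a] and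
the device for moving questions about T to the factorial ring k[x][a]. -/
theorem exists_pow_a_mul_eq_ofPoly (s : DoublePlane p) :
    ∃ (n : ℕ) (f : k[X][X]), a p ^ n * s = ofPoly p f := by
  induction s using induction_on p with
  | hC c => exact ⟨0, algebraMap k _ c, by rw [AlgHom.commutes, pow_zero, one_mul]⟩
  | hadd s t hs ht =>
    obtain ⟨n, f, hf⟩ := hs
    obtain ⟨m, g, hg⟩ := ht
    exact ⟨n + m, X ^ m * f + X ^ n * g, by
      rw [map_add, map_mul, map_mul, map_pow, map_pow, ofPoly_X, ← hf, ← hg]; ring⟩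
  | hmul s t hs ht =>
    obtain ⟨n, f, hf⟩ := hs
    obtain ⟨m, g, hg⟩ := ht
    exact ⟨n + m, f * g, by rw [map_mul, ← hf, ← hg]; ring⟩
  | hx => exact ⟨0, C X, by rw [ofPoly_C, aeval_X, pow_zero, one_mul]⟩
  | ha => exact ⟨0, X, by rw [ofPoly_X, pow_zero, one_mul]⟩
  | hb => exact ⟨1, C p, by rw [ofPoly_C, pow_one, a_mul_b]⟩

theorem a_ne_zero : a p ≠ 0 := by
  rw [← ofPoly_X, ne_eq, map_eq_zero_iff _ (ofPoly_injective p)]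
  exact X_ne_zero

theorem b_ne_zero : b p ≠ 0 := by
  rw [← swap_a, ne_eq, EmbeddingLike.map_eq_zero_iff]
  exact a_ne_zero p

/-- The homomorphism `T → (k[x]/p)[b]` with kernel `(a)`. -/
noncomputable def modA : DoublePlane p →ₐ[k] (AdjoinRoot p)[X] :=
  lift p (C (AdjoinRoot.root p)) 0 X (by
    have := aeval_algHom_apply (IsScalarTower.toAlgHom k (AdjoinRoot p) (AdjoinRoot p)[X])
      (AdjoinRoot.root p) p
    simp only [IsScalarTower.coe_toAlgHom', algebraMap_eq] at this
    rw [this, AdjoinRoot.aeval_eq, AdjoinRoot.mk_self, zero_mul, map_zero])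

theorem modA_ofPoly' (g : k[X][X]) : modA p (ofPoly' p g) = g.map (AdjoinRoot.mk p) := by
  have h : (modA p).toRingHom.comp (ofPoly' p).toRingHom = mapRingHom (AdjoinRoot.mk p) := by
    refine Polynomial.ringHom_ext (fun r => ?_) ?_
    · have := aeval_algHom_apply (IsScalarTower.toAlgHom k (AdjoinRoot p) (AdjoinRoot p)[X])
        (AdjoinRoot.root p) r
      simp only [IsScalarTower.coe_toAlgHom', algebraMap_eq, AdjoinRoot.aeval_eq] at this
      simp [← aeval_algHom_apply, modA, this]
    · simp [modA]
  exact RingHom.congr_fun h g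

/-- Modulo a, a normal form is a polynomial in b over k[x]. If its reduction mod p is zero, every
coefficient is a multiple of p(x) = ab. -/
theorem a_dvd_iff (s : DoublePlane p) : a p ∣ s ↔ modA p s = 0 := by
  constructor
  · rintro ⟨t, rfl⟩
    rw [map_mul, modA, lift_a, zero_mul]
  · intro h
    obtain ⟨f, g, rfl⟩ := exists_normalForm p s
    have hf : ofPoly p f = ofPoly p f.divX * a p + ofPoly' p (C (f.coeff 0)) := by
      conv_lhs => rw [← f.divX_mul_X_add]
      rw [map_add, map_mul, ofPoly_X, ofPoly_C, ofPoly'_C]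
    rw [hf, ← ofPoly'_X, add_assoc, ← map_mul, ← map_add] at h ⊢
    rw [map_add, map_mul, modA_ofPoly', modA, lift_a, mul_zero, zero_add] at h
    refine dvd_add (dvd_mul_left _ _) ?_
    obtain ⟨q, hq⟩ : C p ∣ C (f.coeff 0) + X * g := by
      rw [C_dvd_iff_dvd_coeff]
      intro i
      rw [← AdjoinRoot.mk_eq_zero, ← coeff_map, h, coeff_zero]
    rw [hq, map_mul, ofPoly'_C, ← a_mul_b, mul_assoc]
    exact dvd_mul_right _ _

/-- In (k[x]/p)[b] the variable b is a nonzerodivisor. This is the regular-sequence condition needed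
for normality. -/
theorem a_dvd_of_dvd_b_mul {s : DoublePlane p} (h : a p ∣ b p * s) : a p ∣ s := by
  rw [a_dvd_iff, map_mul, modA, lift_b] at h
  rw [a_dvd_iff, modA]
  ext i
  rw [← coeff_X_mul, h]; simp

/-- `T[1/a]` as an algebra over `k[x][a]`. -/
noncomputable abbrev polyAlgebraAway : Algebra k[X][X] (Localization.Away (a p)) :=
  ((algebraMap (DoublePlane p) (Localization.Away (a p))).comp (ofPoly p).toRingHom).toAlgebra

theorem isLocalization_away_X (hp : p ≠ 0) :
    letI := polyAlgebraAway p
    IsLocalization.Away (X : k[X][X]) (Localization.Away (a p)) := by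
  let _ := polyAlgebraAway p
  have := isDomain p hp
  have halg : ∀ f : k[X][X], algebraMap k[X][X] (Localization.Away (a p)) f =
    algebraMap _ _ (ofPoly p f) := fun f => rfl
  have hle : Submonoid.powers (a p) ≤ nonZeroDivisors (DoublePlane p) :=
    powers_le_nonZeroDivisors_of_noZeroDivisors (a_ne_zero p)
  have hinj : Function.Injective (algebraMap (DoublePlane p) (Localization.Away (a p))) :=
    IsLocalization.injective _ hle
  refine IsLocalization.Away.mk _ ?_ ?_ ?_
  · rw [halg, ofPoly_X]
    exact IsLocalization.Away.algebraMap_isUnit (a p)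
  · intro z
    obtain ⟨n, s, hs⟩ := IsLocalization.Away.surj (a p) z
    obtain ⟨m, f, hf⟩ := exists_pow_a_mul_eq_ofPoly p s
    refine ⟨n + m, f, ?_⟩
    rw [halg, halg, ofPoly_X, ← hf, map_mul, ← hs, map_pow]
    ring
  · intro f g hfg
    exact ⟨0, by rw [ofPoly_injective p (hinj hfg)]⟩

theorem isIntegrallyClosed_away_a (hp : p ≠ 0) :
    IsIntegrallyClosed (Localization.Away (a p)) := by
  let _ := polyAlgebraAway p
  have := isLocalization_away_X p hp
  exact isIntegrallyClosed_of_isLocalization _ (Submonoid.powers (X : k[X][X]))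
    (powers_le_nonZeroDivisors_of_noZeroDivisors X_ne_zero)

theorem isIntegrallyClosed_away_b (hp : p ≠ 0) :
    IsIntegrallyClosed (Localization.Away (b p)) := by
  have := isIntegrallyClosed_away_a p hp
  exact IsIntegrallyClosed.of_equiv (IsLocalization.ringEquivOfRingEquiv
    (M := Submonoid.powers (a p)) (T := Submonoid.powers (b p)) (Localization.Away (a p))
    (Localization.Away (b p)) (swap p).toRingEquiv (by
      rw [Submonoid.map_powers]
      congr 1
      exact swap_a p))

theorem isIntegrallyClosed (hp : p ≠ 0) : IsIntegrallyClosed (DoublePlane p) := by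
  have := isDomain p hp
  have := isIntegrallyClosed_away_a p hp
  have := isIntegrallyClosed_away_b p hp
  exact isIntegrallyClosed_of_away (a_ne_zero p) (b_ne_zero p)
    fun _ => a_dvd_of_dvd_b_mul p

theorem not_isUnit_a {α : k} (hα : p.IsRoot α) : ¬ IsUnit (a p) := fun h => by
  have := h.map (lift p α 0 0 (by rw [zero_mul, coe_aeval_eq_eval]; exact hα.symm))
  rw [lift_a] at this
  exact not_isUnit_zero this

/-- After multiplication by a power of a, a unit becomes a divisor of a power of the prime X in
k[x][X], so it is a constant times a power of a. The exponent is zero because a vanishes at the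
point over the root. -/
theorem bijective_units_map {α : k} (hα : p.IsRoot α) (hp : p ≠ 0) : Function.Bijective
    (Units.map (algebraMap k (DoublePlane p)).toMonoidHom : kˣ →* (DoublePlane p)ˣ) := by
  have := isDomain p hp
  have ha := a_ne_zero p
  constructor
  · exact Units.map_injective (algebraMap k (DoublePlane p)).injective
  · intro s
    obtain ⟨n, f, hf⟩ := exists_pow_a_mul_eq_ofPoly p s
    obtain ⟨m, g, hg⟩ := exists_pow_a_mul_eq_ofPoly p ↑s⁻¹
    have hfg : f * g = X ^ (n + m) := by
      apply ofPoly_injective p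
      rw [map_mul, ← hf, ← hg, map_pow, ofPoly_X, mul_mul_mul_comm, Units.mul_inv, mul_one,
        pow_add]
    obtain ⟨i, -, u, hu⟩ := (dvd_prime_pow prime_X _).mp (Dvd.intro g hfg)
    obtain ⟨w, hw, hwu⟩ := Polynomial.isUnit_iff.mp u.isUnit
    obtain ⟨c, hc, rfl⟩ := Polynomial.isUnit_iff.mp hw
    have key : a p ^ n * (s * algebraMap k _ c) = a p ^ i := by
      have := congrArg (ofPoly p) hu
      rw [map_mul, ← hf, ← hwu, map_pow, ofPoly_X, ofPoly_C, aeval_C] at this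
      rw [← this]; ring
    have hunit : IsUnit ((s : DoublePlane p) * algebraMap k _ c) := s.isUnit.mul (hc.map _)
    rcases lt_trichotomy i n with h | h | h
    · obtain ⟨d, rfl⟩ := Nat.exists_eq_add_of_lt h
      have : a p * (a p ^ d * (s * algebraMap k _ c)) = 1 := by
        apply mul_left_cancel₀ (pow_ne_zero i ha)
        rw [mul_one]
        refine Eq.trans ?_ key
        ring
      exact absurd (IsUnit.of_mul_eq_one _ this) (not_isUnit_a p hα)
    · subst h
      have h1 := mul_left_cancel₀ (pow_ne_zero i ha) (key.trans (mul_one _).symm)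
      obtain ⟨c, rfl⟩ := hc
      refine ⟨c⁻¹, Units.ext ?_⟩
      apply (c.isUnit.map (algebraMap k (DoublePlane p))).mul_right_cancel
      rw [h1]
      change algebraMap k (DoublePlane p) ↑c⁻¹ * _ = 1
      rw [← map_mul, Units.inv_mul, map_one]
    · obtain ⟨d, rfl⟩ := Nat.exists_eq_add_of_lt h
      have h1 : (s : DoublePlane p) * algebraMap k _ c = a p * a p ^ d := by
        apply mul_left_cancel₀ (pow_ne_zero n ha)
        rw [key]; ring
      rw [h1] at hunit
      exact absurd (isUnit_of_mul_isUnit_left hunit) (not_isUnit_a p hα)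

end DoublePlane

/-! ### Closed points and dimension. -/

namespace DoublePlane

open Polynomial IsLocalRing

section Points

variable {k : Type*} [Field k] (p : k[X]) [NeZero (2 : k)]

/-- Evaluation at the point `(x₀, a₀, b₀)`. -/
noncomputable def evalPt (x₀ a₀ b₀ : k) (h : a₀ * b₀ = p.eval x₀) : DoublePlane p →ₐ[k] k :=
  lift p x₀ a₀ b₀ (by rw [h, coe_aeval_eq_eval])

/-- The maximal ideal of the point `(x₀, a₀, b₀)`. -/
noncomputable def ptIdeal (x₀ a₀ b₀ : k) (h : a₀ * b₀ = p.eval x₀) : Ideal (DoublePlane p) :=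
  RingHom.ker (evalPt p x₀ a₀ b₀ h)

variable {p} {x₀ a₀ b₀ : k} (h : a₀ * b₀ = p.eval x₀)

instance ptIdeal_isMaximal : (ptIdeal p x₀ a₀ b₀ h).IsMaximal :=
  RingHom.ker_isMaximal_of_surjective _ fun c => ⟨algebraMap k _ c, AlgHom.commutes _ _⟩

theorem mem_ptIdeal_iff {s : DoublePlane p} :
    s ∈ ptIdeal p x₀ a₀ b₀ h ↔ evalPt p x₀ a₀ b₀ h s = 0 := Iff.rfl

theorem sub_algebraMap_mem_span (s : DoublePlane p) :
    s - algebraMap k _ (evalPt p x₀ a₀ b₀ h s) ∈ Ideal.span {x p - algebraMap k _ x₀,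
      a p - algebraMap k _ a₀, b p - algebraMap k _ b₀} := by
  induction s using induction_on p with
  | hC c => rw [AlgHom.commutes]; simp
  | hadd s t hs ht =>
    rw [map_add, map_add, add_sub_add_comm]
    exact add_mem hs ht
  | hmul s t hs ht =>
    rw [map_mul, map_mul, show ∀ s t s' t' : DoublePlane p,
      s * t - s' * t' = t * (s - s') + s' * (t - t') from fun _ _ _ _ => by ring]
    exact add_mem (Ideal.mul_mem_left _ _ hs) (Ideal.mul_mem_left _ _ ht)
  | hx => rw [evalPt, lift_x]; exact Ideal.subset_span (by simp)
  | ha => rw [evalPt, lift_a]; exact Ideal.subset_span (by simp)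
  | hb => rw [evalPt, lift_b]; exact Ideal.subset_span (by simp)

theorem ptIdeal_eq_span : ptIdeal p x₀ a₀ b₀ h = Ideal.span {x p - algebraMap k _ x₀,
    a p - algebraMap k _ a₀, b p - algebraMap k _ b₀} := by
  apply le_antisymm
  · intro s hs
    have := sub_algebraMap_mem_span h s
    rwa [(mem_ptIdeal_iff h).mp hs, map_zero, sub_zero] at this
  · rw [Ideal.span_le]
    rintro s (rfl | rfl | rfl) <;> rw [SetLike.mem_coe, mem_ptIdeal_iff] <;> simp [evalPt]

theorem point_asIdeal {α : k} (hα : p.IsRoot α) :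
    (point p α hα).asIdeal = ptIdeal p α 0 0 (by rw [zero_mul]; exact hα.symm) := by
  have : evalAt p α hα = evalPt p α 0 0 (by rw [zero_mul]; exact hα.symm) := by
    apply algHom_ext
    · rw [evalPt, lift_x]
      change MvPolynomial.aeval _ (MvPolynomial.X 0) = _
      simp
    · rw [evalPt, lift_a]
      change MvPolynomial.aeval _ (MvPolynomial.X 1 - MvPolynomial.X 2) = _
      simp
    · rw [evalPt, lift_b]
      change MvPolynomial.aeval _ (MvPolynomial.X 1 + MvPolynomial.X 2) = _
      simp
  change RingHom.ker (evalAt p α hα) = _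
  rw [ptIdeal, this]

/-- By the Nullstellensatz the residue field is finite over k, hence equal to k; the images of x, a
and b are the coordinates. -/
theorem exists_eq_ptIdeal [IsAlgClosed k] (M : Ideal (DoublePlane p)) [hM : M.IsMaximal] :
    ∃ (x₀ a₀ b₀ : k) (h : a₀ * b₀ = p.eval x₀), M = ptIdeal p x₀ a₀ b₀ h := by
  let _ : Field (DoublePlane p ⧸ M) := Ideal.Quotient.field M
  have : Module.Finite k (DoublePlane p ⧸ M) := finite_of_finite_type_of_isJacobsonRing _ _
  let e : k ≃ₐ[k] DoublePlane p ⧸ M := AlgEquiv.ofBijective (Algebra.ofId _ _)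
    IsAlgClosed.algebraMap_bijective_of_isIntegral
  let f : DoublePlane p →ₐ[k] k := e.symm.toAlgHom.comp (Ideal.Quotient.mkₐ k M)
  have hf : f (a p) * f (b p) = p.eval (f (x p)) := by
    rw [← map_mul, a_mul_b, ← aeval_algHom_apply, coe_aeval_eq_eval]
  refine ⟨f (x p), f (a p), f (b p), hf, ?_⟩
  have hfe : f = evalPt p (f (x p)) (f (a p)) (f (b p)) hf := by
    apply algHom_ext <;> simp [evalPt]
  rw [ptIdeal, ← hfe]
  ext s
  rw [RingHom.mem_ker, AlgHom.comp_apply]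
  simp [Ideal.Quotient.eq_zero_iff_mem]

/-- The chain is 0 < ker φ < M, where t shows the first inclusion to be strict and s the second. -/
theorem two_le_height_of_algHom (M : Ideal (DoublePlane p)) [M.IsMaximal] (hp : p ≠ 0)
    (φ : DoublePlane p →ₐ[k] k[X]) (hφ : RingHom.ker φ ≤ M) {s t : DoublePlane p}
    (hs : s ∈ M) (hs' : φ s ≠ 0) (ht : t ≠ 0) (ht' : φ t = 0) : 2 ≤ M.height := by
  have := isDomain p hp
  have hQ : (RingHom.ker φ).IsPrime := RingHom.ker_isPrime _
  have hlt : RingHom.ker φ < M := lt_of_le_of_ne hφ fun h => hs' (by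
    rw [← h] at hs; exact hs)
  have hlt' : ⊥ < RingHom.ker φ := bot_lt_iff_ne_bot.mpr fun h => ht (by
    have : t ∈ RingHom.ker φ := ht'
    rwa [h] at this)
  have h1 := Ideal.height_add_one_le_of_lt_of_isPrime hlt
  have h2 := Ideal.height_add_one_le_of_lt_of_isPrime hlt'
  calc (2 : ℕ∞) = 0 + 1 + 1 := by norm_num
    _ ≤ (⊥ : Ideal (DoublePlane p)).height + 1 + 1 := by gcongr; exact zero_le
    _ ≤ (RingHom.ker φ).height + 1 := by gcongr
    _ ≤ M.height := h1

theorem a_sub_algebraMap_ne_zero (c : k) : a p - algebraMap k _ c ≠ 0 := by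
  have : a p - algebraMap k _ c = ofPoly p (X - C (C c)) := by
    rw [map_sub, ofPoly_X, ofPoly_C, aeval_C]
  rw [this, ne_eq, map_eq_zero_iff _ (ofPoly_injective p)]
  exact X_sub_C_ne_zero _

/-- Every point lies on an affine line in the surface: the line x = x₀, a = 0 if a₀ = 0, and
otherwise the curve a = a₀, b = p(x)/a₀. -/
theorem two_le_height_ptIdeal (hp : p ≠ 0) : 2 ≤ (ptIdeal p x₀ a₀ b₀ h).height := by
  have hker : ∀ (φ : DoublePlane p →ₐ[k] k[X]) (c : k),
      (aeval c).comp φ = evalPt p x₀ a₀ b₀ h → RingHom.ker φ ≤ ptIdeal p x₀ a₀ b₀ h := by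
    intro φ c hc s hs
    rw [mem_ptIdeal_iff, ← hc, AlgHom.comp_apply, (hs : φ s = 0), map_zero]
  by_cases ha : a₀ = 0
  · subst ha
    have hx : p.eval x₀ = 0 := by rw [← h, zero_mul]
    let φ : DoublePlane p →ₐ[k] k[X] := lift p (C x₀) 0 X (by
      have := aeval_algHom_apply (Algebra.ofId k k[X]) x₀ p
      rw [coe_aeval_eq_eval, hx, map_zero] at this
      rw [zero_mul]
      exact this.symm)
    refine two_le_height_of_algHom _ hp φ (hker φ b₀ ?_) (s := b p - algebraMap k _ b₀)
      (t := a p) ?_ ?_ (a_ne_zero p) (lift_a _ _)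
    · apply algHom_ext <;> simp [φ, evalPt]
    · rw [mem_ptIdeal_iff]; simp [evalPt]
    · rw [map_sub, AlgHom.commutes]
      simpa [φ] using X_sub_C_ne_zero b₀
  · let φ : DoublePlane p →ₐ[k] k[X] := lift p X (C a₀) (C a₀⁻¹ * p) (by
      rw [← mul_assoc, ← C_mul, mul_inv_cancel₀ ha, C_1, one_mul, aeval_X_left_apply])
    refine two_le_height_of_algHom _ hp φ (hker φ x₀ ?_) (s := x p - algebraMap k _ x₀)
      (t := a p - algebraMap k _ a₀) ?_ ?_ (a_sub_algebraMap_ne_zero _) ?_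
    · apply algHom_ext <;> simp [φ, evalPt, coe_aeval_eq_eval, ← h, ha]
    · rw [mem_ptIdeal_iff]; simp [evalPt]
    · rw [map_sub, AlgHom.commutes]
      simpa [φ] using X_sub_C_ne_zero x₀
    · rw [map_sub, AlgHom.commutes]; simp [φ]

theorem doublePlaneEq_ne_zero : doublePlaneEq p ≠ 0 := fun h => by
  have := congrArg (MvPolynomial.aeval (R := k) ![(0 : k[X]), X, 0]) h
  have h1 : aeval (0 : k[X]) p = C (p.eval 0) := by
    have := aeval_algHom_apply (Algebra.ofId k k[X]) 0 p
    simpa [coe_aeval_eq_eval] using this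
  rw [doublePlaneEq, map_add, ← aeval_algHom_apply] at this
  simp only [map_sub, map_pow, MvPolynomial.aeval_X, Matrix.cons_val, map_zero, h1] at this
  refine (monic_X_pow_sub_C (p.eval 0) two_ne_zero).ne_zero ?_
  linear_combination -this

theorem ringKrullDim_le_two : ringKrullDim (DoublePlane p) ≤ 2 := by
  have h := ringKrullDim_quotient_succ_le_of_nonZeroDivisor
    (mem_nonZeroDivisors_of_ne_zero (doublePlaneEq_ne_zero (p := p)))
  rw [MvPolynomial.ringKrullDim_of_isNoetherianRing, ringKrullDim_eq_zero_of_field] at h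
  have h3 : (0 : WithBot ℕ∞) + Nat.card (Fin 3) = 2 + 1 := by
    rw [Nat.card_eq_fintype_card, Fintype.card_fin, zero_add]; norm_num
  rw [h3] at h
  exact (ENat.WithBot.add_le_add_one_right_iff).mp h

end Points

end DoublePlane

/-! ### Criteria for regularity and for its failure. -/

section Regularity

open IsLocalRing

variable {R : Type*} [CommRing R] [IsNoetherianRing R]

/-- A local ring of dimension at least two is regular if its maximal ideal is generated by
two elements. -/
theorem isRegularLocalRing_atPrime_of_forall_mem_span_pair {M : Ideal R} [M.IsPrime]
    (hM : 2 ≤ M.height) {u v : R} (hu : u ∈ M) (hv : v ∈ M)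
    (h : ∀ s ∈ M, ∃ c ∉ M, c * s ∈ Ideal.span {u, v}) :
    IsRegularLocalRing (Localization.AtPrime M) := by
  have huv : Ideal.span {u, v} ≤ M := by
    rw [Ideal.span_le]
    rintro s (rfl | rfl) <;> assumption
  have hmax : maximalIdeal (Localization.AtPrime M) =
      Ideal.span (algebraMap R (Localization.AtPrime M) '' {u, v}) := by
    rw [← Localization.AtPrime.map_eq_maximalIdeal, ← Ideal.map_span]
    refine le_antisymm (Ideal.map_le_iff_le_comap.mpr fun s hs => ?_) (Ideal.map_mono huv)
    exact (IsLocalization.algebraMap_mem_map_algebraMap_iff M.primeCompl _ _ _).mpr (h s hs)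
  apply IsRegularLocalRing.of_spanFinrank_maximalIdeal_le
  rw [IsLocalization.AtPrime.ringKrullDim_eq_height M]
  have h1 : (maximalIdeal (Localization.AtPrime M)).spanFinrank ≤ 2 := by
    rw [hmax]
    refine (Submodule.spanFinrank_span_le_ncard_of_finite ((Set.toFinite _).image _)).trans
      ((Set.ncard_image_le (Set.toFinite _)).trans ((Set.ncard_insert_le _ _).trans (by rw [Set.ncard_singleton])))
  have h2 : ((maximalIdeal (Localization.AtPrime M)).spanFinrank : ℕ∞) ≤ 2 := by exact_mod_cast h1
  exact_mod_cast h2.trans hM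

/-- A local ring whose cotangent space has a quotient of dimension `d` has embedding dimension
at least `d`. -/
theorem finrank_le_spanFinrank_maximalIdeal {k V O : Type*} [Field k] [AddCommGroup V] [Module k V]
    [Module kᵐᵒᵖ V] [IsCentralScalar k V]
    [CommRing O] [IsLocalRing O] [IsNoetherianRing O] (ψ : O →+* TrivSqZeroExt k V)
    (hψ : ∀ g ∈ maximalIdeal O, (ψ g).fst = 0) (s : Set O) (hs : s ⊆ maximalIdeal O)
    (hspan : Submodule.span k ((fun g => (ψ g).snd) '' s) = ⊤) :
    Module.finrank k V ≤ (maximalIdeal O).spanFinrank := by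
  have hfg : (maximalIdeal O).FG := IsNoetherian.noetherian _
  let G := Submodule.generators (maximalIdeal O)
  have hfin : G.Finite := Submodule.FG.finite_generators hfg
  -- On the maximal ideal the first component of ψ vanishes, so the second behaves like a derivation
  -- and is linear through the residue map; generators of the ideal give a spanning set.
  have key : ∀ g ∈ maximalIdeal O, (ψ g).snd ∈ Submodule.span k ((fun g => (ψ g).snd) '' G) := by
    intro g hg
    rw [← Submodule.span_generators (maximalIdeal O)] at hg
    induction hg using Submodule.span_induction with
    | mem g hg => exact Submodule.subset_span ⟨g, hg, rfl⟩
    | zero => simp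
    | add g h _ _ hg hh => rw [map_add, TrivSqZeroExt.snd_add]; exact add_mem hg hh
    | smul o g hg' hg =>
      rw [Submodule.span_generators (maximalIdeal O)] at hg'
      rw [smul_eq_mul, map_mul, TrivSqZeroExt.snd_mul, hψ g hg']
      simpa using Submodule.smul_mem _ _ hg
  have htop : Submodule.span k ((fun g => (ψ g).snd) '' G) = ⊤ := by
    rw [eq_top_iff, ← hspan, Submodule.span_le]
    rintro _ ⟨g, hg, rfl⟩
    exact key g (hs hg)
  rw [← Submodule.FG.generators_ncard hfg]
  calc Module.finrank k V = (⊤ : Submodule k V).spanFinrank := by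
        rw [Module.finrank_eq_spanFinrank_of_free]
    _ ≤ _ := by
      rw [← htop]
      exact (Submodule.spanFinrank_span_le_ncard_of_finite (hfin.image _)).trans
        (Set.ncard_image_le hfin)

end Regularity

/-! ### The singular locus. -/

namespace DoublePlane

open Polynomial IsLocalRing

variable {k : Type*} [Field k] {p : k[X]} [NeZero (2 : k)] {x₀ a₀ b₀ : k}

theorem exists_aeval_x_sub (x₀ : k) : ∃ q : k[X],
    aeval (x p) p = algebraMap k _ (p.eval x₀) + algebraMap k _ (p.derivative.eval x₀) *
      (x p - algebraMap k _ x₀) + (x p - algebraMap k _ x₀) ^ 2 * aeval (x p) q := by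
  obtain ⟨q, hq⟩ : (X - C x₀) ^ 2 ∣ p - C (p.eval x₀) - C (p.derivative.eval x₀) * (X - C x₀) := by
    rw [X_sub_C_pow_dvd_iff, ← taylor_apply, X_pow_dvd_iff]
    intro d hd
    interval_cases d
    · simp [taylor_coeff_zero]
    · simp [taylor_coeff_one]
  refine ⟨q, ?_⟩
  have := congrArg (aeval (x p)) hq
  simp only [map_sub, map_mul, map_pow, aeval_X, aeval_C] at this
  linear_combination this

/-- By Taylor expansion ab = p(x) is a linear relation among x - x₀, a - a₀ and b - b₀. A
coefficient that is nonzero at the point makes its generator redundant in the local ring: a for b -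
b₀, b for a - a₀, and p'(x₀) plus a multiple of x - x₀ for x - x₀. -/
theorem isRegularLocalRing_atPrime_ptIdeal (h : a₀ * b₀ = p.eval x₀) (hp : p ≠ 0)
    (hns : a₀ ≠ 0 ∨ b₀ ≠ 0 ∨ p.derivative.eval x₀ ≠ 0) :
    IsRegularLocalRing (Localization.AtPrime (ptIdeal p x₀ a₀ b₀ h)) := by
  have h2 := two_le_height_ptIdeal h hp
  obtain ⟨q, hq⟩ := exists_aeval_x_sub (p := p) x₀
  rw [← a_mul_b, ← h, map_mul] at hq
  set ξ := x p - algebraMap k _ x₀ with hξ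
  have hspan := ptIdeal_eq_span h
  have hmem : ∀ {c : DoublePlane p} {d : k}, evalPt p x₀ a₀ b₀ h c = d → d ≠ 0 →
      c ∉ ptIdeal p x₀ a₀ b₀ h := by
    intro c d hc hd hcM
    exact hd (hc.symm.trans ((mem_ptIdeal_iff h).mp hcM))
  have hred : ∀ {u v w c : DoublePlane p}, ptIdeal p x₀ a₀ b₀ h = Ideal.span {u, v, w} →
      c ∉ ptIdeal p x₀ a₀ b₀ h → c * w ∈ Ideal.span {u, v} →
      IsRegularLocalRing (Localization.AtPrime (ptIdeal p x₀ a₀ b₀ h)) := by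
    intro u v w c hM hc hcw
    refine isRegularLocalRing_atPrime_of_forall_mem_span_pair h2 (u := u) (v := v)
      (hM ▸ Ideal.subset_span (by simp)) (hM ▸ Ideal.subset_span (by simp))
      fun s hs => ⟨c, hc, ?_⟩
    rw [hM] at hs
    obtain ⟨r₁, r₂, r₃, rfl⟩ := Submodule.mem_span_triple.mp hs
    have hu : u ∈ Ideal.span {u, v} := Ideal.subset_span (by simp)
    have hv : v ∈ Ideal.span {u, v} := Ideal.subset_span (by simp)
    rw [show c * (r₁ • u + r₂ • v + r₃ • w) = c * r₁ * u + c * r₂ * v + r₃ * (c * w) by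
      simp only [smul_eq_mul]; ring]
    exact add_mem (add_mem (Ideal.mul_mem_left _ _ hu) (Ideal.mul_mem_left _ _ hv))
      (Ideal.mul_mem_left _ _ hcw)
  rcases hns with h0 | h0 | h0
  · refine hred hspan (hmem (c := a p) (by simp [evalPt]) h0) (Ideal.mem_span_pair.mpr
      ⟨algebraMap k _ (p.derivative.eval x₀) + ξ * aeval (x p) q, -algebraMap k _ b₀, ?_⟩)
    linear_combination -hq
  · refine hred (u := ξ) (v := b p - algebraMap k _ b₀) (w := a p - algebraMap k _ a₀)
      (hspan.trans (by rw [Set.pair_comm (a p - _)])) (hmem (c := b p) (by simp [evalPt]) h0)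
      (Ideal.mem_span_pair.mpr
      ⟨algebraMap k _ (p.derivative.eval x₀) + ξ * aeval (x p) q, -algebraMap k _ a₀, ?_⟩)
    linear_combination -hq
  · refine hred (u := a p - algebraMap k _ a₀) (v := b p - algebraMap k _ b₀) (w := ξ)
      (hspan.trans (by rw [Set.insert_comm, Set.pair_comm ξ]))
      (hmem (c := algebraMap k _ (p.derivative.eval x₀) + ξ * aeval (x p) q)
      (by rw [map_add, map_mul]; simp [hξ, evalPt]) h0)
      (Ideal.mem_span_pair.mpr ⟨b p, algebraMap k _ a₀, ?_⟩)
    linear_combination hq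

/-- The relation has no linear term here, so x - x₀, a, b can be sent to independent square-zero
vectors. The cotangent space then needs three generators in dimension at most two. -/
theorem not_isRegularLocalRing_atPrime_ptIdeal (h : (0 : k) * 0 = p.eval x₀)
    (hd : p.derivative.eval x₀ = 0) :
    ¬ IsRegularLocalRing (Localization.AtPrime (ptIdeal p x₀ 0 0 h)) := by
  intro hreg
  let V := Fin 3 → k
  let ψ : DoublePlane p →ₐ[k] TrivSqZeroExt k V := lift p
    (algebraMap k _ x₀ + TrivSqZeroExt.inr (Pi.single 0 1))
    (TrivSqZeroExt.inr (Pi.single 1 1)) (TrivSqZeroExt.inr (Pi.single 2 1)) (by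
      have hsq : (TrivSqZeroExt.inr (Pi.single 0 1) : TrivSqZeroExt k V) ^ 2 = 0 := by
        rw [sq, TrivSqZeroExt.inr_mul_inr]
      rw [TrivSqZeroExt.inr_mul_inr, aeval_add_of_sq_eq_zero _ _ _ hsq, aeval_algebraMap_apply,
        aeval_algebraMap_apply, coe_aeval_eq_eval, hd, ← h]
      simp)
  have hfst : ∀ s, (ψ s).fst = evalPt p x₀ 0 0 h s := by
    intro s
    have : (TrivSqZeroExt.fstHom k k V).comp ψ = evalPt p x₀ 0 0 h := by
      apply algHom_ext <;> simp [ψ, evalPt, TrivSqZeroExt.algebraMap_eq_inl]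
    rw [← this]; rfl
  have hu : ∀ c : (ptIdeal p x₀ 0 0 h).primeCompl, IsUnit (ψ.toRingHom c) := by
    intro c
    rw [TrivSqZeroExt.isUnit_iff_isUnit_fst]
    exact (hfst c).symm ▸ IsUnit.mk0 _ c.2
  let Ψ : Localization.AtPrime (ptIdeal p x₀ 0 0 h) →+* TrivSqZeroExt k V :=
    IsLocalization.lift hu
  have hΨ : ∀ s, Ψ (algebraMap _ _ s) = ψ s := fun s => IsLocalization.lift_eq hu s
  have h3 := finrank_le_spanFinrank_maximalIdeal
    (O := Localization.AtPrime (ptIdeal p x₀ 0 0 h)) Ψ ?_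
    (algebraMap _ _ '' {x p - algebraMap k _ x₀, a p - algebraMap k _ 0, b p - algebraMap k _ 0}) ?_ ?_
  · have h4 := hreg.spanFinrank_maximalIdeal
    rw [IsLocalization.AtPrime.ringKrullDim_eq_height (ptIdeal p x₀ 0 0 h)] at h4
    have h5 : ((ptIdeal p x₀ 0 0 h).height : WithBot ℕ∞) ≤ 2 :=
      (Ideal.height_le_ringKrullDim_of_ne_top (Ideal.IsPrime.ne_top')).trans ringKrullDim_le_two
    rw [← h4] at h5
    have h6 : (maximalIdeal (Localization.AtPrime (ptIdeal p x₀ 0 0 h))).spanFinrank ≤ 2 := by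
      exact_mod_cast h5
    have h7 : Module.finrank k V = 3 := by simp [V]
    omega
  · intro g hg
    rw [← Localization.AtPrime.map_eq_maximalIdeal] at hg
    have hle : (ptIdeal p x₀ 0 0 h).map (algebraMap _ (Localization.AtPrime (ptIdeal p x₀ 0 0 h))) ≤
      RingHom.ker ((TrivSqZeroExt.fstHom k k V).toRingHom.comp Ψ) := by
      rw [Ideal.map_le_iff_le_comap]
      intro s hs
      change (Ψ (algebraMap _ _ s)).fst = 0
      rw [hΨ, hfst]
      exact hs
    exact hle hg
  · rw [← Localization.AtPrime.map_eq_maximalIdeal]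
    rintro _ ⟨s, hs, rfl⟩
    exact Ideal.mem_map_of_mem _ ((ptIdeal_eq_span h).ge (Ideal.subset_span hs))
  · rw [← Set.image_comp]
    rw [eq_top_iff, ← (Pi.basisFun k (Fin 3)).span_eq, Submodule.span_le]
    rintro _ ⟨i, rfl⟩
    apply Submodule.subset_span
    rw [Pi.basisFun_apply]
    fin_cases i
    · exact ⟨_, Or.inl rfl, by simp [hΨ, ψ, TrivSqZeroExt.algebraMap_eq_inl]⟩
    · exact ⟨_, Or.inr (Or.inl rfl), by simp [hΨ, ψ]⟩
    · exact ⟨_, Or.inr (Or.inr rfl), by simp [hΨ, ψ]⟩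

/-- In dimension at most two a non-maximal prime has height at most one, so its local ring is a
field or, by normality, a discrete valuation ring. -/
theorem isRegularLocalRing_atPrime_of_not_isMaximal (hp : p ≠ 0) (P : Ideal (DoublePlane p))
    [P.IsPrime] (hP : ¬ P.IsMaximal) : IsRegularLocalRing (Localization.AtPrime P) := by
  have := isDomain p hp
  have := isIntegrallyClosed p hp
  obtain ⟨M, hM, hPM⟩ := Ideal.exists_le_maximal P (Ideal.IsPrime.ne_top')
  have hlt : P < M := lt_of_le_of_ne hPM fun h => hP (h ▸ hM)
  have h1 := Ideal.height_add_one_le_of_lt_of_isPrime hlt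
  have h2 : ((M.height : ℕ∞) : WithBot ℕ∞) ≤ 2 :=
    (Ideal.height_le_ringKrullDim_of_ne_top hM.ne_top).trans ringKrullDim_le_two
  have h3 : P.height ≤ 1 := by
    have h4 : P.height + 1 ≤ 1 + 1 := h1.trans (by
      rw [one_add_one_eq_two]; exact WithBot.coe_le_coe.mp h2)
    exact (ENat.add_le_add_iff_right (by norm_num)).mp h4
  rcases eq_or_ne P ⊥ with hbot | hbot
  · let _ : Field (Localization.AtPrime P) := IsField.toField <| by
      simp [isField_iff_maximalIdeal_eq, ← Localization.AtPrime.map_eq_maximalIdeal, hbot]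
    infer_instance
  · have h5 : P.height = 1 := le_antisymm h3 (Order.one_le_iff_ne_zero.mpr fun h => hbot (by
      by_contra hb
      have h6 := Ideal.height_add_one_le_of_lt_of_isPrime (bot_lt_iff_ne_bot.mpr hb)
      simp [h] at h6))
    let q : PrimeDivisor (DoublePlane p) := ⟨⟨P, inferInstance⟩, h5⟩
    have : IsNoetherianRing (DoublePlane p) := inferInstance
    have : IsDiscreteValuationRing (Localization.AtPrime q.1.asIdeal) :=
      PrimeDivisor.isDiscreteValuationRing q
    change IsRegularLocalRing (Localization.AtPrime q.1.asIdeal)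
    infer_instance

theorem singularLocus_eq [IsAlgClosed k] (hp : p ≠ 0) : singularLocus (DoublePlane p) =
    {P | ∃ (α : k) (hα : p.IsRoot α), p.derivative.IsRoot α ∧ P = point p α hα} := by
  ext P
  constructor
  · intro hP
    have hmax : P.asIdeal.IsMaximal := by
      by_contra h
      exact hP (isRegularLocalRing_atPrime_of_not_isMaximal hp _ h)
    obtain ⟨x₀, a₀, b₀, h, hPeq⟩ := exists_eq_ptIdeal P.asIdeal
    have hP' : P = ⟨ptIdeal p x₀ a₀ b₀ h, inferInstance⟩ := PrimeSpectrum.ext hPeq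
    subst hP'
    by_cases hns : a₀ ≠ 0 ∨ b₀ ≠ 0 ∨ p.derivative.eval x₀ ≠ 0
    · exact absurd (isRegularLocalRing_atPrime_ptIdeal h hp hns) hP
    · push Not at hns
      obtain ⟨rfl, rfl, hd⟩ := hns
      refine ⟨x₀, by rw [IsRoot, ← h, mul_zero], hd, PrimeSpectrum.ext ?_⟩
      rw [point_asIdeal]
  · rintro ⟨α, hα, hd, rfl⟩
    have hP : point p α hα = ⟨ptIdeal p α 0 0 (by rw [zero_mul]; exact hα.symm), inferInstance⟩ :=
      PrimeSpectrum.ext (point_asIdeal hα)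
    rw [hP]
    exact not_isRegularLocalRing_atPrime_ptIdeal _ hd

end DoublePlane

/-! ### Roots, multiplicities and the singular points. -/

section Factorization

open Polynomial

variable {k : Type*} [Field k] {v : ℕ} {α : Fin v → k} {e : Fin v → ℕ} {p : k[X]}

theorem exists_eq_pow_mul_of_factorization (hα : Function.Injective α)
    (hp : p = ∏ i, (X - C (α i)) ^ e i) (i : Fin v) :
    ∃ w : k[X], p = (X - C (α i)) ^ e i * w ∧ w.eval (α i) ≠ 0 := by
  classical
  refine ⟨∏ j ∈ Finset.univ.erase i, (X - C (α j)) ^ e j, ?_, ?_⟩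
  · rw [hp, Finset.mul_prod_erase _ (fun j => (X - C (α j)) ^ e j) (Finset.mem_univ i)]
  · rw [eval_prod, Finset.prod_ne_zero_iff]
    intro j hj
    simpa [sub_eq_zero] using fun h => absurd (hα h).symm (Finset.ne_of_mem_erase hj)

theorem exists_eq_of_isRoot_of_factorization (hp : p = ∏ i, (X - C (α i)) ^ e i) {c : k}
    (hc : p.IsRoot c) : ∃ i, α i = c := by
  rw [hp, IsRoot, eval_prod, Finset.prod_eq_zero_iff] at hc
  obtain ⟨i, -, hi⟩ := hc
  refine ⟨i, ?_⟩
  rw [eval_pow, eval_sub, eval_X, eval_C] at hi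
  exact (sub_eq_zero.mp (eq_zero_of_pow_eq_zero hi)).symm

theorem isRoot_derivative_iff_of_factorization (hα : Function.Injective α) (he : ∀ i, 1 ≤ e i)
    (hp : p = ∏ i, (X - C (α i)) ^ e i) (i : Fin v) : p.derivative.IsRoot (α i) ↔ 2 ≤ e i := by
  obtain ⟨w, hw, hwα⟩ := exists_eq_pow_mul_of_factorization hα hp i
  obtain ⟨n, hn⟩ := Nat.exists_eq_add_of_le' (he i)
  rw [hw, hn, IsRoot]
  rcases n with _ | n
  · simp [hwα]
  · simp [derivative_mul, derivative_pow, pow_succ]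

theorem DoublePlane.singularLocus_eq_of_factorization [IsAlgClosed k] [NeZero (2 : k)]
    (hp0 : p ≠ 0) (hα : Function.Injective α) (he : ∀ i, 1 ≤ e i)
    (hp : p = ∏ i, (X - C (α i)) ^ e i) : singularLocus (DoublePlane p) =
      {P | ∃ i, 2 ≤ e i ∧ P = DoublePlane.point p (α i) (isRoot_of_factorization hp he i)} := by
  rw [singularLocus_eq hp0]
  ext P
  constructor
  · rintro ⟨c, hc, hd, rfl⟩
    obtain ⟨i, rfl⟩ := exists_eq_of_isRoot_of_factorization hp hc
    exact ⟨i, (isRoot_derivative_iff_of_factorization hα he hp i).mp hd, rfl⟩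
  · rintro ⟨i, hi, rfl⟩
    exact ⟨α i, _, (isRoot_derivative_iff_of_factorization hα he hp i).mpr hi, rfl⟩

end Factorization

/-! ### Birationality with the affine plane. -/

section Rationality

open Polynomial CategoryTheory

variable {k R S : Type u} [Field k] [CommRing R] [CommRing S] [Algebra k R] [Algebra k S]

theorem birationalOver_of_isLocalization_away [Algebra R S] [IsScalarTower k R S] [IsDomain R] {f : R} (hf : f ≠ 0)
    [IsLocalization.Away f S] :
    Scheme.BirationalOver
      (Spec.map (CommRingCat.ofHom (algebraMap k S)) :
        Spec (CommRingCat.of S) ⟶ Spec (CommRingCat.of k))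
      (Spec.map (CommRingCat.ofHom (algebraMap k R)) :
        Spec (CommRingCat.of R) ⟶ Spec (CommRingCat.of k)) := by
  let g : Spec (CommRingCat.of S) ⟶ Spec (CommRingCat.of R) :=
    Spec.map (CommRingCat.ofHom (algebraMap R S))
  have : IsOpenImmersion g := IsOpenImmersion.of_isLocalization f
  have : IsDominant g := by
    refine ⟨(PrimeSpectrum.denseRange_comap_iff_ker_le_nilRadical (algebraMap R S)).mpr ?_⟩
    rw [(RingHom.injective_iff_ker_eq_bot _).mp (IsLocalization.injective S
      (powers_le_nonZeroDivisors_of_noZeroDivisors hf))]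
    exact bot_le
  refine Scheme.Hom.birationalOver g _ _ ?_
  rw [← Spec.map_comp, ← CommRingCat.ofHom_comp, ← IsScalarTower.algebraMap_eq]

theorem birationalOver_of_algEquiv (e : R ≃ₐ[k] S) :
    Scheme.BirationalOver
      (Spec.map (CommRingCat.ofHom (algebraMap k S)) :
        Spec (CommRingCat.of S) ⟶ Spec (CommRingCat.of k))
      (Spec.map (CommRingCat.ofHom (algebraMap k R)) :
        Spec (CommRingCat.of R) ⟶ Spec (CommRingCat.of k)) := by
  let g : Spec (CommRingCat.of S) ≅ Spec (CommRingCat.of R) :=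
    Scheme.Spec.mapIso e.toRingEquiv.toCommRingCatIso.op
  refine Scheme.Hom.birationalOver g.hom _ _ ?_
  change Spec.map (CommRingCat.ofHom e.toRingHom) ≫ _ = _
  rw [← Spec.map_comp, ← CommRingCat.ofHom_comp]
  congr 2
  exact e.toAlgHom.comp_algebraMap

/-- Spec S is a dense principal open subset of both Spec R and the plane; it is applied to S =
T[1/a]. -/
theorem isRationalSurface_of_isLocalization_away [Algebra R S] [IsScalarTower k R S] [IsDomain R]
    {f : R} (hf : f ≠ 0) [IsLocalization.Away f S] [Algebra k[X][X] S] [IsScalarTower k k[X][X] S] {g : k[X][X]}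
    (hg : g ≠ 0) [IsLocalization.Away g S] : IsRationalSurface k R := by
  refine ⟨inferInstance, (birationalOver_of_isLocalization_away (S := S) hf).symm.trans
    ((birationalOver_of_isLocalization_away hg).trans ?_)⟩
  let e : MvPolynomial (ULift.{u} (Fin 2)) k ≃ₐ[k] k[X][X] :=
    (MvPolynomial.renameEquiv k Equiv.ulift).trans ((MvPolynomial.finSuccEquiv k 1).trans
      (Polynomial.mapAlgEquiv (MvPolynomial.uniqueAlgEquiv k (Fin 1))))
  refine (birationalOver_of_algEquiv e).trans ?_
  exact Scheme.Hom.birationalOver (AffineSpace.SpecIso (ULift.{u} (Fin 2)) (CommRingCat.of k)).inv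
    _ _ (AffineSpace.SpecIso_inv_over _)

theorem DoublePlane.isRationalSurface {p : k[X]} [NeZero (2 : k)] (hp : p ≠ 0) :
    IsRationalSurface k (DoublePlane p) := by
  have := isDomain p hp
  let _ := polyAlgebraAway p
  have := isLocalization_away_X p hp
  have : IsScalarTower k k[X][X] (Localization.Away (a p)) := IsScalarTower.of_algebraMap_eq
    fun c => by
      change _ = algebraMap (DoublePlane p) _ (ofPoly p (algebraMap k k[X][X] c))
      rw [AlgHom.commutes, ← IsScalarTower.algebraMap_apply]
  exact isRationalSurface_of_isLocalization_away (S := Localization.Away (a p)) (a_ne_zero p)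
    (g := X) X_ne_zero

end Rationality

/-! ### The lines in V(a) and the class group of T. -/

namespace DoublePlane

open Polynomial

section Lines

variable {k : Type*} [Field k] {p : k[X]} [NeZero (2 : k)] {α : k} (hα : p.IsRoot α)

/-- The restriction of functions to the line `x = α`, `a = 0`, with coordinate `b`. -/
noncomputable def lineHom : DoublePlane p →ₐ[k] k[X] := lift p (C α) 0 X (by
  have h := aeval_algHom_apply (Algebra.ofId k k[X]) α p
  rw [coe_aeval_eq_eval, hα.eq_zero, map_zero] at h
  rw [zero_mul]
  exact h.symm)

theorem sub_aeval_lineHom_mem_span (s : DoublePlane p) : s - aeval (b p) (lineHom hα s) ∈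
    Ideal.span {a p, x p - algebraMap k _ α} := by
  induction s using induction_on p with
  | hC c => rw [AlgHom.commutes, AlgHom.commutes]; simp
  | hadd s t hs ht =>
    rw [map_add, map_add, add_sub_add_comm]
    exact add_mem hs ht
  | hmul s t hs ht =>
    rw [map_mul, map_mul, show ∀ s t s' t' : DoublePlane p,
      s * t - s' * t' = t * (s - s') + s' * (t - t') from fun _ _ _ _ => by ring]
    exact add_mem (Ideal.mul_mem_left _ _ hs) (Ideal.mul_mem_left _ _ ht)
  | hx => rw [lineHom, lift_x, aeval_C]; exact Ideal.subset_span (by simp)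
  | ha => rw [lineHom, lift_a, map_zero, sub_zero]; exact Ideal.subset_span (by simp)
  | hb => rw [lineHom, lift_b, aeval_X, sub_self]; exact zero_mem _

theorem ker_lineHom :
    RingHom.ker (lineHom hα) = Ideal.span {a p, x p - algebraMap k _ α} := by
  apply le_antisymm
  · intro s hs
    have := sub_aeval_lineHom_mem_span hα s
    rwa [(hs : lineHom hα s = 0), map_zero, sub_zero] at this
  · rw [Ideal.span_le]
    rintro s (rfl | rfl) <;> rw [SetLike.mem_coe, RingHom.mem_ker]
    · simp [lineHom]
    · rw [map_sub, AlgHom.commutes]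
      simp [lineHom]

theorem ker_lineHom_le_point : RingHom.ker (lineHom hα) ≤ (point p α hα).asIdeal := by
  rw [ker_lineHom, point_asIdeal, ptIdeal_eq_span, map_zero, sub_zero, Ideal.span_le]
  rintro s (rfl | rfl) <;> exact Ideal.subset_span (by simp)

/-- The prime divisor `x = α`, `a = 0`. -/
noncomputable def line [IsDomain (DoublePlane p)] : PrimeDivisor (DoublePlane p) :=
  ⟨⟨RingHom.ker (lineHom hα), RingHom.ker_isPrime _⟩, by
    have h0 : (0 : k) * 0 = p.eval α := by rw [zero_mul]; exact hα.symm
    have hne : RingHom.ker (lineHom hα) ≠ ⊥ := fun h => a_ne_zero p (by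
      rw [← Ideal.mem_bot, ← h, ker_lineHom]; exact Ideal.subset_span (by simp))
    have hprime : (RingHom.ker (lineHom hα)).IsPrime := RingHom.ker_isPrime _
    -- The line lies strictly inside the maximal ideal of a point, whose height is at most two, and
    -- it contains a ≠ 0.
    apply le_antisymm
    · have hlt : RingHom.ker (lineHom hα) < (point p α hα).asIdeal := by
        refine lt_of_le_of_ne (ker_lineHom_le_point hα) fun h => ?_
        have hb : b p ∈ RingHom.ker (lineHom hα) := by
          rw [h, point_asIdeal, mem_ptIdeal_iff]
          simp [evalPt]
        rw [RingHom.mem_ker, lineHom, lift_b] at hb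
        exact X_ne_zero hb
      have h1 := Ideal.height_add_one_le_of_lt_of_isPrime hlt
      have h2 : (((point p α hα).asIdeal.height : ℕ∞) : WithBot ℕ∞) ≤ 2 :=
        (Ideal.height_le_ringKrullDim_of_ne_top (point p α hα).2.ne_top).trans ringKrullDim_le_two
      have h4 : (RingHom.ker (lineHom hα)).height + 1 ≤ 1 + 1 := h1.trans (by
        rw [one_add_one_eq_two]; exact WithBot.coe_le_coe.mp h2)
      exact (ENat.add_le_add_iff_right (by norm_num)).mp h4
    · have h6 := Ideal.height_add_one_le_of_lt_of_isPrime (bot_lt_iff_ne_bot.mpr hne)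
      exact le_add_self.trans h6⟩

variable [IsDomain (DoublePlane p)]

theorem line_asIdeal :
    (line hα).1.asIdeal = Ideal.span {a p, x p - algebraMap k _ α} := ker_lineHom hα

theorem a_mem_line : a p ∈ (line hα).1.asIdeal := by
  rw [line_asIdeal]; exact Ideal.subset_span (by simp)

theorem b_notMem_line : b p ∉ (line hα).1.asIdeal := by
  change ¬ lineHom hα (b p) = 0
  rw [lineHom, lift_b]
  exact X_ne_zero

theorem aeval_x_notMem_line {w : k[X]} (hw : w.eval α ≠ 0) :
    aeval (x p) w ∉ (line hα).1.asIdeal := by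
  change ¬ lineHom hα (aeval (x p) w) = 0
  have h := aeval_algHom_apply (Algebra.ofId k k[X]) α w
  rw [← aeval_algHom_apply, lineHom, lift_x]
  rw [coe_aeval_eq_eval] at h
  refine fun h0 => hw ?_
  exact C_eq_zero.mp (h.symm.trans h0)

end Lines

section ClassGroup

variable {k : Type*} [Field k] {p : k[X]} [NeZero (2 : k)]
  [IsDomain (DoublePlane p)] [IsIntegrallyClosed (DoublePlane p)]

/-- A prime divisor outside of `V(a)` is, up to powers of `a`, generated by an irreducible
polynomial. -/
theorem exists_generator_of_a_notMem {r : PrimeDivisor (DoublePlane p)}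
    (ha : a p ∉ r.1.asIdeal) : ∃ g ∈ r.1.asIdeal, g ≠ 0 ∧
      ∀ s ∈ r.1.asIdeal, ∃ n : ℕ, g ∣ a p ^ n * s := by
  obtain ⟨s₀, hs₀, hs₀'⟩ := Submodule.exists_mem_ne_zero_of_ne_bot r.asIdeal_ne_bot
  obtain ⟨n₀, f₀, hf₀⟩ := exists_pow_a_mul_eq_ofPoly p s₀
  have hJ : r.1.asIdeal.comap (ofPoly p) ≠ ⊥ := fun h => by
    have h1 : f₀ ∈ r.1.asIdeal.comap (ofPoly p) := by
      rw [Ideal.mem_comap, ← hf₀]; exact Ideal.mul_mem_left _ _ hs₀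
    rw [h, Ideal.mem_bot] at h1
    rw [h1, map_zero] at hf₀
    exact mul_ne_zero (pow_ne_zero n₀ (a_ne_zero p)) hs₀' hf₀
  obtain ⟨π, hπ, hprime⟩ := Ideal.IsPrime.exists_mem_prime_of_ne_bot
    (Ideal.comap_isPrime (ofPoly p) r.1.asIdeal) hJ
  have hπX : ¬ π ∣ X := fun ⟨c, hc⟩ => ha (by
    rw [← ofPoly_X, hc, map_mul]; exact Ideal.mul_mem_right _ _ hπ)
  have hπn : ∀ {n : ℕ} {f : k[X][X]}, π ∣ X ^ n * f → π ∣ f := fun h =>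
    (hprime.dvd_or_dvd h).resolve_left fun h' => hπX (hprime.dvd_of_dvd_pow h')
  -- K is the contraction to T of the ideal generated by π in T[1/a], described without the
  -- localization. It is a nonzero prime inside r, so it equals r by height.
  let K : Ideal (DoublePlane p) :=
    { carrier := {s | ∃ (n : ℕ) (f : k[X][X]), a p ^ n * s = ofPoly p (π * f)}
      zero_mem' := ⟨0, 0, by simp⟩
      add_mem' := by
        rintro s t ⟨n, f, hf⟩ ⟨m, g, hg⟩
        refine ⟨n + m, X ^ m * f + X ^ n * g, ?_⟩
        rw [show π * (X ^ m * f + X ^ n * g) = X ^ m * (π * f) + X ^ n * (π * g) by ring, map_add,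
          map_mul _ (X ^ m), map_mul _ (X ^ n), ← hf, ← hg, map_pow, map_pow, ofPoly_X]
        ring
      smul_mem' := by
        rintro t s ⟨n, f, hf⟩
        obtain ⟨m, g, hg⟩ := exists_pow_a_mul_eq_ofPoly p t
        refine ⟨n + m, f * g, ?_⟩
        rw [← mul_assoc, map_mul, ← hf, ← hg, smul_eq_mul]
        ring }
  have hKle : K ≤ r.1.asIdeal := by
    rintro s ⟨n, f, hf⟩
    refine (r.1.2.mem_or_mem (?_ : a p ^ n * s ∈ _)).resolve_left
      fun h => ha (r.1.2.mem_of_pow_mem _ h)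
    rw [hf, map_mul]
    exact Ideal.mul_mem_right _ _ hπ
  have hKprime : K.IsPrime := by
    refine ⟨fun h => r.1.2.ne_top (top_le_iff.mp (h ▸ hKle)), ?_⟩
    rintro s t ⟨N, f, hf⟩
    obtain ⟨n, g, hg⟩ := exists_pow_a_mul_eq_ofPoly p s
    obtain ⟨m, h, hh⟩ := exists_pow_a_mul_eq_ofPoly p t
    have hdvd : π ∣ X ^ N * (g * h) := by
      refine ⟨X ^ (n + m) * f, ofPoly_injective p ?_⟩
      rw [show π * (X ^ (n + m) * f) = X ^ (n + m) * (π * f) by ring, map_mul _ (X ^ (n + m)),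
        map_mul, map_mul, ← hg, ← hh, ← hf, map_pow, map_pow, ofPoly_X]
      ring
    rcases hprime.dvd_or_dvd (hπn hdvd) with ⟨c, rfl⟩ | ⟨c, rfl⟩
    · exact Or.inl ⟨n, c, hg⟩
    · exact Or.inr ⟨m, c, hh⟩
  have hKne : ⊥ < K := bot_lt_iff_ne_bot.mpr fun h => by
    have : ofPoly p π ∈ K := ⟨0, 1, by simp⟩
    rw [h, Ideal.mem_bot, map_eq_zero_iff _ (ofPoly_injective p)] at this
    exact hprime.ne_zero this
  have hKr : K = r.1.asIdeal := by
    by_contra hne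
    have h1 := Ideal.height_add_one_le_of_lt_of_isPrime (lt_of_le_of_ne hKle hne)
    have h2 := Ideal.height_add_one_le_of_lt_of_isPrime hKne
    rw [r.2] at h1
    have h3 : (1 : ℕ∞) + 1 ≤ 0 + 1 := by
      refine (add_le_add_left (le_add_self.trans h2) 1).trans (h1.trans ?_)
      rw [zero_add]
    norm_num at h3
  refine ⟨ofPoly p π, hπ, ?_, fun s hs => ?_⟩
  · rw [ne_eq, map_eq_zero_iff _ (ofPoly_injective p)]
    exact hprime.ne_zero
  · rw [← hKr] at hs
    obtain ⟨n, f, hf⟩ := hs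
    exact ⟨n, ofPoly p f, by rw [hf, map_mul]⟩

/-- The divisors of units of `T[1/a]` are the multiples of the divisor of `a`. -/
theorem exists_elemDivisor_eq_of_mul_eq_pow {s t : DoublePlane p} {n : ℕ}
    (h : s * t = a p ^ n) : ∃ m : ℤ, elemDivisor s = m • elemDivisor (a p) := by
  have ha := a_ne_zero p
  obtain ⟨i, f, hf⟩ := exists_pow_a_mul_eq_ofPoly p s
  obtain ⟨j, g, hg⟩ := exists_pow_a_mul_eq_ofPoly p t
  have hs : s ≠ 0 := by rintro rfl; exact pow_ne_zero n ha (by rw [← h, zero_mul])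
  have hfg : f * g = X ^ (i + j + n) := by
    apply ofPoly_injective p
    rw [map_mul, ← hf, ← hg, map_pow, ofPoly_X, mul_mul_mul_comm, h]
    ring
  -- Up to a power of a, s divides a power of the prime X in k[x][X], so it is a unit times a power
  -- of a.
  obtain ⟨l, -, u, hu⟩ := (dvd_prime_pow prime_X _).mp (Dvd.intro g hfg)
  have key := congrArg (ofPoly p) hu
  rw [map_mul, ← hf, map_pow, ofPoly_X] at key
  have hunit : IsUnit (ofPoly p ↑u) := u.isUnit.map _
  have h1 := congrArg elemDivisor key
  rw [elemDivisor_mul (mul_ne_zero (pow_ne_zero i ha) hs) hunit.ne_zero,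
    elemDivisor_mul (pow_ne_zero i ha) hs, elemDivisor_of_isUnit hunit, elemDivisor_pow ha,
    elemDivisor_pow ha, add_zero] at h1
  refine ⟨l - i, ?_⟩
  rw [sub_smul, natCast_zsmul, natCast_zsmul, ← h1, add_sub_cancel_left]

variable {v : ℕ} {α : Fin v → k} {e : Fin v → ℕ}

/-- If a is in r, so is ab = p(x), hence some x - α_i; then r contains the line, and both have
height one. -/
theorem exists_eq_line (hr : ∀ i, p.IsRoot (α i)) (hp : p = ∏ i, (X - C (α i)) ^ e i)
    {r : PrimeDivisor (DoublePlane p)} (ha : a p ∈ r.1.asIdeal) : ∃ i, r = line (hr i) := by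
  have h1 : aeval (x p) p ∈ r.1.asIdeal := by
    rw [← a_mul_b]; exact Ideal.mul_mem_right _ _ ha
  have h2 : aeval (x p) p = ∏ i, (x p - algebraMap k _ (α i)) ^ e i := by
    refine (congrArg (aeval (x p)) hp).trans ?_
    rw [map_prod]
    simp
  rw [h2] at h1
  obtain ⟨i, -, hi⟩ := (Ideal.IsPrime.prod_mem_iff).mp h1
  refine ⟨i, (PrimeDivisor.eq_of_le ?_).symm⟩
  rw [line_asIdeal, Ideal.span_le]
  rintro s (rfl | rfl)
  · exact ha
  · exact r.1.2.mem_of_pow_mem _ hi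

theorem line_injective (hα : Function.Injective α) (hr : ∀ i, p.IsRoot (α i)) :
    Function.Injective fun i => line (hr i) := by
  intro i j hij
  by_contra hne
  have h1 : aeval (x p) (X - C (α i)) ∈ (line (hr i)).1.asIdeal := by
    rw [line_asIdeal, map_sub, aeval_X, aeval_C]
    exact Ideal.subset_span (by simp)
  refine aeval_x_notMem_line (hr j) ?_ ((show line (hr i) = line (hr j) from hij) ▸ h1)
  rw [eval_sub, eval_X, eval_C]
  exact sub_ne_zero.mpr fun h => hne (hα h).symm

theorem elemDivisor_a_line (hα : Function.Injective α) (hr : ∀ i, p.IsRoot (α i))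
    (he : ∀ i, 1 ≤ e i) (hp : p = ∏ i, (X - C (α i)) ^ e i) (i : Fin v) :
    elemDivisor (a p) (line (hr i)) = e i := by
  obtain ⟨w, hw, hwα⟩ := exists_eq_pow_mul_of_factorization hα hp i
  rw [elemDivisor_apply (a_ne_zero p)]
  refine congrArg _ (multAlong_eq_of_mul_eq_pow_mul (he i) (line_asIdeal (hr i))
    (b_notMem_line (hr i)) (aeval_x_notMem_line (hr i) hwα) ?_)
  rw [a_mul_b]
  refine (congrArg (aeval (x p)) hw).trans ?_
  simp

theorem elemDivisor_a_apply_of_notMem {r : PrimeDivisor (DoublePlane p)}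
    (ha : a p ∉ r.1.asIdeal) : elemDivisor (a p) r = 0 := by
  rw [elemDivisor_apply (a_ne_zero p),
    (multAlong_eq_zero_iff (span_singleton_ne_bot (a_ne_zero p))).mpr]
  · rfl
  · rwa [Ideal.span_singleton_le_iff_mem]

/-- The divisor `∑ n i` times the line over the `i`-th root. -/
noncomputable def lineDivisor (hr : ∀ i, p.IsRoot (α i)) :
    (Fin v → ℤ) →+ WeilDivisor (DoublePlane p) where
  toFun n := ∑ i, Finsupp.single (line (hr i)) (n i)
  map_zero' := by simp
  map_add' n m := by simp [Finset.sum_add_distrib]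

theorem lineDivisor_apply_line (hα : Function.Injective α) (hr : ∀ i, p.IsRoot (α i))
    (n : Fin v → ℤ) (i : Fin v) : lineDivisor hr n (line (hr i)) = n i := by
  classical
  change (∑ j, Finsupp.single (line (hr j)) (n j)) (line (hr i)) = n i
  rw [Finsupp.finsetSum_apply, Finset.sum_eq_single i]
  · simp
  · intro j _ hj
    rw [Finsupp.single_apply, if_neg fun h => hj (line_injective hα hr h)]
  · simp

theorem lineDivisor_apply_of_notMem (hr : ∀ i, p.IsRoot (α i)) (n : Fin v → ℤ)
    {r : PrimeDivisor (DoublePlane p)} (ha : a p ∉ r.1.asIdeal) : lineDivisor hr n r = 0 := by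
  classical
  change (∑ j, Finsupp.single (line (hr j)) (n j)) r = 0
  rw [Finsupp.finsetSum_apply]
  refine Finset.sum_eq_zero fun j _ => ?_
  rw [Finsupp.single_apply, if_neg]
  rintro rfl
  exact ha (a_mem_line _)

theorem eq_lineDivisor (hα : Function.Injective α) (hr : ∀ i, p.IsRoot (α i))
    (hp : p = ∏ i, (X - C (α i)) ^ e i) {D : WeilDivisor (DoublePlane p)}
    (hD : ∀ r : PrimeDivisor (DoublePlane p), a p ∉ r.1.asIdeal → D r = 0) :
    D = lineDivisor hr fun i => D (line (hr i)) := by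
  ext r
  by_cases ha : a p ∈ r.1.asIdeal
  · obtain ⟨i, rfl⟩ := exists_eq_line hr hp ha
    rw [lineDivisor_apply_line hα]
  · rw [hD r ha, lineDivisor_apply_of_notMem hr _ ha]

theorem elemDivisor_a (hα : Function.Injective α) (hr : ∀ i, p.IsRoot (α i))
    (he : ∀ i, 1 ≤ e i) (hp : p = ∏ i, (X - C (α i)) ^ e i) :
    elemDivisor (a p) = lineDivisor hr fun i => (e i : ℤ) := by
  rw [eq_lineDivisor hα hr hp fun r => elemDivisor_a_apply_of_notMem]
  simp_rw [elemDivisor_a_line hα hr he hp]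

/-- A prime divisor off V(a) is cut out by some g after inverting a, so it differs from div g by a
combination of lines. -/
theorem divisorClass_lineDivisor_surjective (hα : Function.Injective α) (hr : ∀ i, p.IsRoot (α i))
    (hp : p = ∏ i, (X - C (α i)) ^ e i) : Function.Surjective
      ((QuotientAddGroup.mk' (principalDivisors (DoublePlane p))).comp (lineDivisor hr)) := by
  rw [← AddMonoidHom.range_eq_top, eq_top_iff]
  rintro c -
  obtain ⟨D, rfl⟩ := QuotientAddGroup.mk'_surjective _ c
  induction D using Finsupp.induction_linear with
  | zero => exact zero_mem _
  | add D E hD hE => rw [map_add]; exact add_mem hD hE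
  | single r n =>
    have hn : Finsupp.single r n = n • (Finsupp.single r 1 : WeilDivisor (DoublePlane p)) := by simp
    rw [hn, map_zsmul]
    refine zsmul_mem ?_ n
    by_cases ha : a p ∈ r.1.asIdeal
    · obtain ⟨i, rfl⟩ := exists_eq_line hr hp ha
      refine ⟨Pi.single i 1, ?_⟩
      rw [AddMonoidHom.comp_apply]
      congr 1
      change (∑ j, Finsupp.single (line (hr j)) ((Pi.single i 1 : Fin v → ℤ) j)) = _
      rw [Finset.sum_eq_single i]
      · simp
      · intro j _ hj
        rw [Pi.single_eq_of_ne hj, Finsupp.single_zero]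
      · simp
    · obtain ⟨g, hg, hg0, hgr⟩ := exists_generator_of_a_notMem ha
      have h := eq_lineDivisor hα hr hp (D := Finsupp.single r 1 - elemDivisor g) fun s hs => by
        rw [Finsupp.sub_apply, elemDivisor_apply_of_forall_dvd hg0 hg hgr hs, sub_self]
      refine ⟨_, (congrArg _ h.symm).trans ?_⟩
      change divisorClass (_ - _) = divisorClass _
      rw [sub_eq_add_neg, divisorClass_add, add_eq_left]
      exact neg_eq_zero.mpr (divisorClass_elemDivisor hg0)

/-- If a combination of lines is div(f/g), then f/g and g/f become regular after multiplication by a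
power of a. So f/g is a unit of T[1/a], and its divisor is a multiple of div a. -/
theorem divisorClass_lineDivisor_eq_zero_iff (hα : Function.Injective α)
    (hr : ∀ i, p.IsRoot (α i)) (he : ∀ i, 1 ≤ e i) (hp : p = ∏ i, (X - C (α i)) ^ e i)
    (n : Fin v → ℤ) : lineDivisor hr n ∈ principalDivisors (DoublePlane p) ↔
      n ∈ AddSubgroup.zmultiples fun i => (e i : ℤ) := by
  have ha := a_ne_zero p
  constructor
  · intro h
    obtain ⟨f, g, hf, hg, hfg⟩ := mem_principalDivisors_iff.mp h
    -- As every e_i ≥ 1, this N makes N div a dominate the combination of lines and its negative.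
    let N : ℕ := ∑ i, (n i).natAbs
    have hN : ∀ r : PrimeDivisor (DoublePlane p),
        |lineDivisor hr n r| ≤ (N • elemDivisor (a p)) r := by
      intro r
      by_cases har : a p ∈ r.1.asIdeal
      · obtain ⟨i, rfl⟩ := exists_eq_line hr hp har
        rw [lineDivisor_apply_line hα, Finsupp.smul_apply, elemDivisor_a_line hα hr he hp,
          Int.abs_eq_natAbs, nsmul_eq_mul]
        have h1 : (n i).natAbs ≤ N :=
          Finset.single_le_sum (f := fun i => (n i).natAbs) (fun _ _ => Nat.zero_le _)
            (Finset.mem_univ i)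
        exact_mod_cast h1.trans (Nat.le_mul_of_pos_right _ (he i))
      · rw [lineDivisor_apply_of_notMem hr _ har, Finsupp.smul_apply,
          elemDivisor_a_apply_of_notMem har]
        simp
    have haN := pow_ne_zero N ha
    obtain ⟨s, hs⟩ : g ∣ a p ^ N * f := by
      refine dvd_of_elemDivisor_le hg (mul_ne_zero haN hf) fun r => ?_
      have := neg_le_of_abs_le (hN r)
      rw [hfg] at this
      rw [elemDivisor_mul haN hf, elemDivisor_pow ha, Finsupp.add_apply]
      rw [Finsupp.sub_apply] at this
      linarith
    obtain ⟨t, ht⟩ : f ∣ a p ^ N * g := by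
      refine dvd_of_elemDivisor_le hf (mul_ne_zero haN hg) fun r => ?_
      have := le_of_abs_le (hN r)
      rw [hfg] at this
      rw [elemDivisor_mul haN hg, elemDivisor_pow ha, Finsupp.add_apply]
      rw [Finsupp.sub_apply] at this
      linarith
    have hst : s * t = a p ^ (N + N) := by
      apply mul_left_cancel₀ (mul_ne_zero hf hg)
      linear_combination -(f * t) * hs - a p ^ N * f * ht
    have hs0 : s ≠ 0 := by rintro rfl; exact mul_ne_zero haN hf (by rw [hs, mul_zero])
    obtain ⟨m, hm⟩ := exists_elemDivisor_eq_of_mul_eq_pow hst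
    have h1 := congrArg elemDivisor hs
    rw [elemDivisor_mul haN hf, elemDivisor_mul hg hs0, elemDivisor_pow ha, hm] at h1
    have h2 : lineDivisor hr n = (m - N) • elemDivisor (a p) := by
      rw [hfg, sub_smul, natCast_zsmul, sub_eq_sub_iff_add_eq_add, add_comm, h1, add_comm]
    refine AddSubgroup.mem_zmultiples_iff.mpr ⟨m - N, ?_⟩
    ext i
    rw [← lineDivisor_apply_line hα hr n i, h2, Finsupp.smul_apply,
      elemDivisor_a_line hα hr he hp, Pi.smul_apply]
  · rintro ⟨m, rfl⟩
    change lineDivisor hr (m • _) ∈ _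
    rw [map_zsmul, ← elemDivisor_a hα hr he hp]
    refine zsmul_mem ?_ m
    exact (QuotientAddGroup.eq_zero_iff _).mp (divisorClass_elemDivisor ha)

theorem nonempty_divisorClassGroup_addEquiv (hα : Function.Injective α)
    (hr : ∀ i, p.IsRoot (α i)) (he : ∀ i, 1 ≤ e i) (hp : p = ∏ i, (X - C (α i)) ^ e i)
    (hv : 0 < v) :
    Nonempty (DivisorClassGroup (DoublePlane p) ≃+
      ZMod (Finset.univ.gcd e) × (Fin (v - 1) → ℤ)) := by
  obtain ⟨E⟩ := nonempty_quotient_zmultiples_addEquiv hv e he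
  let φ := (QuotientAddGroup.mk' (principalDivisors (DoublePlane p))).comp (lineDivisor hr)
  have hker : φ.ker = AddSubgroup.zmultiples fun i => (e i : ℤ) := by
    ext n
    rw [← divisorClass_lineDivisor_eq_zero_iff hα hr he hp]
    exact QuotientAddGroup.eq_zero_iff _
  exact ⟨(QuotientAddGroup.quotientKerEquivOfSurjective φ
    (divisorClass_lineDivisor_surjective hα hr hp)).symm.trans
    ((QuotientAddGroup.quotientAddEquivOfEq hker).trans E)⟩

end ClassGroup

end DoublePlane

/-! ### Recognizing a completion. -/

section CompletionCriterion

/-- A quotient of a precomplete ring is precomplete. -/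
theorem isPrecomplete_quotient {R : Type*} [CommRing R] (I K : Ideal R) [IsPrecomplete I R] :
    IsPrecomplete (I.map (Ideal.Quotient.mk K)) (R ⧸ K) := by
  refine IsPrecomplete.map_algebraMap_iff.mpr (AdicCompletion.of_surjective_iff.mp fun y => ?_)
  obtain ⟨z, rfl⟩ := AdicCompletion.map_surjective I (f := K.mkQ) (Submodule.mkQ_surjective K) y
  obtain ⟨w, rfl⟩ := AdicCompletion.of_surjective I R z
  exact ⟨K.mkQ w, (AdicCompletion.map_of I K.mkQ w).symm⟩

variable {k O A : Type*} [CommRing k] [CommRing O] [CommRing A] [Algebra k O] [Algebra k A]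

/-- A criterion for a complete ring `A` to be the completion of `O`. -/
theorem exists_adicCompletion_algEquiv (I : Ideal O) (J : Ideal A) [IsAdicComplete J A]
    (f : O →ₐ[k] A) (hIJ : ∀ n, ∀ s ∈ I ^ n, f s ∈ J ^ n) (hJI : ∀ n s, f s ∈ J ^ n → s ∈ I ^ n)
    (hd : ∀ n y, ∃ s, y - f s ∈ J ^ n) :
    ∃ F : AdicCompletion I O ≃ₐ[k] A, ∀ s, F (algebraMap O _ s) = f s := by
  let fn : ∀ n : ℕ, AdicCompletion I O →ₐ[k] A ⧸ J ^ n := fun n =>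
    (Ideal.quotientMapₐ (J ^ n) f (hIJ n)).comp
      ((AdicCompletion.evalₐ I n).restrictScalars k)
  have hfn : ∀ n (z : AdicCompletion I O) (s : O), AdicCompletion.evalₐ I n z =
      Ideal.Quotient.mk _ s → fn n z = Ideal.Quotient.mk _ (f s) := by
    intro n z s h
    change Ideal.quotientMapₐ (J ^ n) f (hIJ n) (AdicCompletion.evalₐ I n z) = _
    rw [h]; rfl
  have hex : ∀ n (z : AdicCompletion I O), ∃ s : O, AdicCompletion.evalₐ I n z =
      Ideal.Quotient.mk _ s := fun n z => by
    obtain ⟨s, hs⟩ := Ideal.Quotient.mk_surjective (AdicCompletion.evalₐ I n z)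
    exact ⟨s, hs.symm⟩
  have hcomp : ∀ {m n : ℕ} (hle : m ≤ n),
      (Ideal.Quotient.factorₐ k (Ideal.pow_le_pow_right hle)).comp (fn n) = fn m := by
    intro m n hle
    ext z
    obtain ⟨s, hs⟩ := hex n z
    have hs' : AdicCompletion.evalₐ I m z = Ideal.Quotient.mk _ s := by
      induction z using AdicCompletion.induction_on with
      | _ c =>
        rw [AdicCompletion.evalₐ_mk, Ideal.Quotient.mk_eq_mk_iff_sub_mem] at hs ⊢
        have h1 := c.2 hle
        rw [SModEq.sub_mem, smul_eq_mul, Ideal.mul_top] at h1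
        rw [← sub_add_sub_cancel _ (c.val n)]
        exact add_mem h1 (Ideal.pow_le_pow_right hle hs)
    rw [AlgHom.comp_apply, hfn n z s hs, hfn m z s hs']
    rfl
  let F := IsAdicComplete.liftAlgHom J fn hcomp
  have hF : ∀ n z, Ideal.Quotient.mk (J ^ n) (F z) = fn n z := fun n z =>
    IsAdicComplete.mk_liftAlgHom J fn hcomp n z
  have hinj : Function.Injective F := by
    rw [injective_iff_map_eq_zero]
    intro z hz
    refine AdicCompletion.ext_evalₐ fun n => ?_
    obtain ⟨s, hs⟩ := hex n z
    have h1 := hF n z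
    rw [hz, map_zero, hfn n z s hs] at h1
    rw [hs, map_zero, Ideal.Quotient.eq_zero_iff_mem]
    exact hJI n s (Ideal.Quotient.eq_zero_iff_mem.mp h1.symm)
  have hsurj : Function.Surjective F := by
    intro y
    -- Approximations of y from O form a Cauchy sequence because f reflects the filtration, not
    -- merely preserves it.
    choose s hs using fun n => hd n y
    let c : AdicCompletion.AdicCauchySequence I O := AdicCompletion.AdicCauchySequence.mk I O s (by
      intro n
      rw [SModEq.sub_mem, smul_eq_mul, Ideal.mul_top]
      apply hJI
      rw [map_sub, show f (s n) - f (s (n + 1)) = (y - f (s (n + 1))) - (y - f (s n)) by ring]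
      exact sub_mem (Ideal.pow_le_pow_right n.le_succ (hs (n + 1))) (hs n))
    refine ⟨AdicCompletion.mk I O c, ?_⟩
    rw [IsHausdorff.eq_iff_smodEq (I := J)]
    intro n
    rw [SModEq.sub_mem, smul_eq_mul, Ideal.mul_top, ← Ideal.Quotient.mk_eq_mk_iff_sub_mem, hF,
      hfn n _ (s n) (AdicCompletion.evalₐ_mk I n c), eq_comm, Ideal.Quotient.mk_eq_mk_iff_sub_mem]
    exact hs n
  refine ⟨AlgEquiv.ofBijective F ⟨hinj, hsurj⟩, fun s => ?_⟩
  change F _ = _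
  rw [IsHausdorff.eq_iff_smodEq (I := J)]
  intro n
  rw [SModEq.sub_mem, smul_eq_mul, Ideal.mul_top, ← Ideal.Quotient.mk_eq_mk_iff_sub_mem, hF]
  exact hfn n _ s (AlgHom.commutes _ _)

end CompletionCriterion

/-! ### Power series modulo powers of the ideal of the variables. -/

section EvalTruncated

open MvPowerSeries

variable {k B : Type*} [Field k] [CommRing B] [Algebra k B] {m : ℕ}

/-- Evaluation of power series modulo the `n`-th power of an ideal containing the arguments. -/
theorem exists_powerSeries_eval_mod (I : Ideal B) (t : Fin m → B) (ht : ∀ i, t i ∈ I) (n : ℕ) :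
    ∃ g : MvPowerSeries (Fin m) k →ₐ[k] B ⧸ I ^ n,
      (∀ i, g (X i) = Ideal.Quotient.mk _ (t i)) ∧
      ∀ F ∈ Ideal.span (Set.range (X : Fin m → MvPowerSeries (Fin m) k)) ^ n, g F = 0 := by
  have hle : MvPolynomial.idealOfVars (Fin m) k ^ n ≤ (I ^ n).comap (MvPolynomial.aeval t) := by
    have h1 : MvPolynomial.idealOfVars (Fin m) k ≤ I.comap (MvPolynomial.aeval (R := k) t) := by
      rw [Ideal.span_le]
      rintro _ ⟨i, rfl⟩
      simpa using ht i
    exact (Ideal.pow_right_mono h1 n).trans (Ideal.le_comap_pow _ n)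
  let h : MvPolynomial (Fin m) k ⧸ MvPolynomial.idealOfVars (Fin m) k ^ n →ₐ[k] B ⧸ I ^ n :=
    Ideal.Quotient.liftₐ _ ((Ideal.Quotient.mkₐ k (I ^ n)).comp (MvPolynomial.aeval t))
      fun F hF => Ideal.Quotient.eq_zero_iff_mem.mpr (hle hF)
  have hh : ∀ P, h (Ideal.Quotient.mk _ P) = Ideal.Quotient.mk _ (MvPolynomial.aeval t P) :=
    fun P => Ideal.Quotient.lift_mk _ _ _
  let g : MvPowerSeries (Fin m) k →ₐ[k] B ⧸ I ^ n :=
    h.comp ((truncTotalAlgHom (Fin m) k n).restrictScalars k)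
  have hX : ∀ i, g (X i) = Ideal.Quotient.mk _ (t i) := by
    intro i
    have h1 := (truncTotalAlgHom (Fin m) k n).commutes (MvPolynomial.X i)
    have h2 : algebraMap (MvPolynomial (Fin m) k) (MvPowerSeries (Fin m) k) (MvPolynomial.X i) =
      X i := MvPolynomial.coe_X i
    rw [h2] at h1
    rw [AlgHom.comp_apply, AlgHom.restrictScalars_apply, h1]
    refine (hh _).trans ?_
    rw [MvPolynomial.aeval_X]
  refine ⟨g, hX, fun F hF => ?_⟩
  -- The variables land in I/I^n, whose n-th power is zero, so no convergence is involved.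
  have h2 : Ideal.span (Set.range (X : Fin m → MvPowerSeries (Fin m) k)) ≤
      (I.map (Ideal.Quotient.mk (I ^ n))).comap g := by
    rw [Ideal.span_le]
    rintro _ ⟨i, rfl⟩
    rw [SetLike.mem_coe, Ideal.mem_comap, hX]
    exact Ideal.mem_map_of_mem _ (ht i)
  have h3 := (Ideal.pow_right_mono h2 n).trans (Ideal.le_comap_pow _ n) hF
  rwa [Ideal.mem_comap, ← Ideal.map_pow, Ideal.map_quotient_self, Ideal.mem_bot] at h3

/-- Modulo powers of the ideal of the variables, power series are polynomials. -/
theorem exists_sub_aeval_X_mem (F : MvPowerSeries (Fin m) k) (n : ℕ) :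
    ∃ P : MvPolynomial (Fin m) k, F - MvPolynomial.aeval (X : Fin m → MvPowerSeries (Fin m) k) P ∈
      Ideal.span (Set.range (X : Fin m → MvPowerSeries (Fin m) k)) ^ n := by
  let I := MvPolynomial.idealOfVars (Fin m) k
  let E : MvPowerSeries (Fin m) k ≃ₗ[MvPolynomial (Fin m) k]
    AdicCompletion I (MvPolynomial (Fin m) k) := (toAdicCompletionAlgEquiv (Fin m) k).toLinearEquiv
  let P := truncTotal n F
  have hP : MvPolynomial.aeval (X : Fin m → MvPowerSeries (Fin m) k) P =
      algebraMap (MvPolynomial (Fin m) k) (MvPowerSeries (Fin m) k) P := by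
    have h := MvPolynomial.aeval_unique
      (IsScalarTower.toAlgHom k (MvPolynomial (Fin m) k) (MvPowerSeries (Fin m) k))
    rw [show (IsScalarTower.toAlgHom k (MvPolynomial (Fin m) k) (MvPowerSeries (Fin m) k)) ∘
      MvPolynomial.X = X from funext fun i => MvPolynomial.coe_X i] at h
    exact (congrArg (fun φ => φ P) h).symm
  have h1 : E (F - algebraMap _ _ P) ∈
      I ^ n • (⊤ : Submodule (MvPolynomial (Fin m) k) (AdicCompletion I (MvPolynomial (Fin m) k))) := by
    rw [AdicCompletion.pow_smul_top_eq_ker_eval (MvPolynomial.idealOfVars_fg _ _), map_sub,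
      LinearMap.mem_ker, map_sub, sub_eq_zero]
    have h2 : E (algebraMap _ _ P) = AdicCompletion.of I _ P := toAdicCompletion_coe P
    rw [h2, AdicCompletion.eval_of]
    rfl
  refine ⟨P, ?_⟩
  rw [hP]
  have h3 := Submodule.mem_map_of_mem (f := E.symm.toLinearMap) h1
  rw [Submodule.map_smul''] at h3
  have h4 : E.symm.toLinearMap (E (F - algebraMap _ _ P)) = F - algebraMap _ _ P :=
    E.symm_apply_apply _
  rw [h4] at h3
  have h5 := Submodule.smul_mono le_rfl le_top h3
  rw [Ideal.smul_top_eq_map, Ideal.map_pow, Ideal.map_span, ← Set.range_comp] at h5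
  have h6 : (algebraMap (MvPolynomial (Fin m) k) (MvPowerSeries (Fin m) k)) ∘ MvPolynomial.X = X :=
    funext fun i => MvPolynomial.coe_X i
  rw [h6] at h5
  exact h5

end EvalTruncated

/-! ### The complete local ring of type A_n. -/

namespace CompleteA

open MvPowerSeries

variable {k : Type*} [Field k] (n : ℕ)

/-- The coordinates of `k[[a, b, c]] / (a b + c ^ (n + 1))`. -/
noncomputable def coord (i : Fin 3) : CompleteA k n := Ideal.Quotient.mk _ (X i)

theorem coord_relation : coord (k := k) n 0 * coord n 1 + coord n 2 ^ (n + 1) = 0 := by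
  rw [coord, coord, coord, ← map_mul, ← map_pow, ← map_add, Ideal.Quotient.eq_zero_iff_mem]
  exact Ideal.mem_span_singleton_self _

variable (k) in
/-- The ideal defining `CompleteA k n`. -/
noncomputable abbrev relIdeal : Ideal (MvPowerSeries (Fin 3) k) :=
  Ideal.span {(X 0 * X 1 + X 2 ^ (n + 1) : MvPowerSeries (Fin 3) k)}

/-- The constant coefficient. -/
noncomputable def constCoeff : CompleteA k n →+* k :=
  Ideal.Quotient.lift (relIdeal k n) constantCoeff (by
    intro F hF
    obtain ⟨G, rfl⟩ := Ideal.mem_span_singleton'.mp hF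
    simp)

@[simp] theorem constCoeff_mk (F : MvPowerSeries (Fin 3) k) :
    constCoeff n (Ideal.Quotient.mk (relIdeal k n) F) = constantCoeff F :=
  Ideal.Quotient.lift_mk _ _ _

@[simp] theorem constCoeff_coord (i : Fin 3) : constCoeff (k := k) n (coord n i) = 0 := by
  rw [coord, constCoeff_mk, constantCoeff_X]

@[simp] theorem constCoeff_algebraMap (c : k) :
    constCoeff n (algebraMap k (CompleteA k n) c) = c := by
  change constCoeff n (Ideal.Quotient.mk (relIdeal k n) (algebraMap k _ c)) = c
  rw [constCoeff_mk]
  simp [MvPowerSeries.algebraMap_apply]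

variable {n}

theorem isUnit_of_constCoeff_ne_zero {y : CompleteA k n} (h : constCoeff n y ≠ 0) : IsUnit y := by
  obtain ⟨F, rfl⟩ := Ideal.Quotient.mk_surjective y
  rw [constCoeff_mk] at h
  exact (MvPowerSeries.isUnit_iff_constantCoeff.mpr (IsUnit.mk0 _ h)).map _

variable (k n) in
/-- The ideal generated by the coordinates. -/
noncomputable abbrev coordIdeal : Ideal (CompleteA k n) :=
  (Ideal.span (Set.range X)).map (Ideal.Quotient.mk (relIdeal k n))

theorem coord_mem (i : Fin 3) : coord (k := k) n i ∈ coordIdeal k n :=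
  Ideal.mem_map_of_mem _ (Ideal.subset_span ⟨i, rfl⟩)

instance : Nontrivial (CompleteA k n) := (constCoeff (k := k) n).domain_nontrivial

instance : IsLocalRing (CompleteA k n) :=
  IsLocalRing.of_surjective' (Ideal.Quotient.mk (relIdeal k n)) Ideal.Quotient.mk_surjective

theorem coordIdeal_ne_top : coordIdeal k n ≠ ⊤ := by
  have h : coordIdeal k n ≤ RingHom.ker (constCoeff (k := k) n) := by
    rw [coordIdeal, Ideal.map_span, Ideal.span_le]
    rintro _ ⟨_, ⟨i, rfl⟩, rfl⟩
    exact constCoeff_coord n i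
  exact fun h' => RingHom.ker_ne_top (constCoeff (k := k) n) (top_le_iff.mp (h'.ge.trans h))

instance : IsAdicComplete (coordIdeal k n) (CompleteA k n) where
  toIsHausdorff := IsHausdorff.of_isLocalRing _ _ coordIdeal_ne_top
  toIsPrecomplete := isPrecomplete_quotient _ _

end CompleteA

/-! ### The completion of T at a point over a root. -/

namespace DoublePlane

open Polynomial CompleteA

variable {k : Type*} [Field k] [NeZero (2 : k)] {p : k[X]} {α : k} {n : ℕ} {w : k[X]}

/-- The map from `T` to the complete local ring of type `A_n`. -/
noncomputable def toCompleteA (hp : p = (X - C α) ^ (n + 1) * w) :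
    DoublePlane p →ₐ[k] CompleteA k n :=
  lift p (algebraMap k (CompleteA k n) α + coord n 2) (coord n 0)
    -- The factor -w(x) is put into b, so that ab = (x - α)^(n+1) w becomes ab + c^(n+1) = 0.
    (-coord n 1 * aeval (algebraMap k (CompleteA k n) α + coord n 2) w) (by
      refine Eq.trans ?_ (congrArg (aeval (algebraMap k (CompleteA k n) α + coord n 2)) hp).symm
      rw [map_mul, map_pow, map_sub, aeval_X, aeval_C, add_sub_cancel_left]
      linear_combination -(aeval (algebraMap k (CompleteA k n) α + coord n 2) w) * coord_relation (k := k) n)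

theorem constCoeff_toCompleteA (h0 : (0 : k) * 0 = p.eval α)
    (hp : p = (X - C α) ^ (n + 1) * w) (s : DoublePlane p) :
    constCoeff n (toCompleteA hp s) = evalPt p α 0 0 h0 s := by
  induction s using induction_on p with
  | hC c => rw [AlgHom.commutes, AlgHom.commutes]; exact constCoeff_algebraMap n c
  | hadd s t hs ht => rw [map_add, map_add, hs, ht, map_add]
  | hmul s t hs ht => rw [map_mul, map_mul, hs, ht, map_mul]
  | hx => rw [toCompleteA, lift_x, evalPt, lift_x, map_add]; simp
  | ha => rw [toCompleteA, lift_a, evalPt, lift_a]; simp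
  | hb => rw [toCompleteA, lift_b, evalPt, lift_b, map_mul]; simp

/-- The completion of the local ring of the double plane at the point over a root of `p` of
multiplicity `n + 1`. -/
theorem exists_adicCompletion_algEquiv_completeA (h0 : (0 : k) * 0 = p.eval α)
    (hp : p = (X - C α) ^ (n + 1) * w) (hw : w.eval α ≠ 0)
    {P : Ideal (DoublePlane p)} [P.IsPrime] (hP : P = ptIdeal p α 0 0 h0)
    (O : Type*) [CommRing O] [IsLocalRing O] [Algebra k O] [Algebra (DoublePlane p) O]
    [IsScalarTower k (DoublePlane p) O] [IsLocalization.AtPrime O P] :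
    ∃ F : AdicCompletion (IsLocalRing.maximalIdeal O) O ≃ₐ[k] CompleteA k n,
      ∀ s : DoublePlane p,
        F (algebraMap O _ (algebraMap (DoublePlane p) O s)) = toCompleteA hp s := by
  have hunit : ∀ c : P.primeCompl, IsUnit (toCompleteA hp c) := by
    intro c
    apply isUnit_of_constCoeff_ne_zero
    rw [constCoeff_toCompleteA h0]
    exact fun h => c.2 (hP.ge h)
  let f : O →ₐ[k] CompleteA k n := IsLocalization.liftAlgHom (M := P.primeCompl) hunit
  have hf : ∀ s, f (algebraMap _ O s) = toCompleteA hp s := fun s =>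
    IsLocalization.lift_eq (M := P.primeCompl) (g := (toCompleteA hp).toRingHom) hunit s
  have hwO : IsUnit (algebraMap (DoublePlane p) O (aeval (x p) w)) := by
    refine IsLocalization.map_units O (⟨aeval (x p) w, fun h => hw ?_⟩ : P.primeCompl)
    have h1 := (mem_ptIdeal_iff h0).mp (hP.le h)
    rwa [← aeval_algHom_apply, evalPt, lift_x, coe_aeval_eq_eval] at h1
  obtain ⟨u, hu⟩ := hwO
  -- Preimages in O of the three coordinates; the second exists because w(x) is a unit at the point.
  let t : Fin 3 → O := ![algebraMap _ O (a p), -algebraMap _ O (b p) * ↑u⁻¹,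
    algebraMap _ O (x p - algebraMap k _ α)]
  have hft : ∀ i, f (t i) = coord n i := by
    intro i
    fin_cases i
    · simp only [t, hf, toCompleteA, Matrix.cons_val, Fin.zero_eta, lift_a]
    · apply (u.isUnit.map f).mul_right_cancel
      have h1 : t 1 * u = -algebraMap _ O (b p) := by
        simp only [t, Matrix.cons_val, Units.inv_mul_cancel_right]
      have h2 : f (t 1) * f u = -f (algebraMap _ O (b p)) := by rw [← map_mul, h1, map_neg]
      refine h2.trans ?_
      rw [hu, hf, hf, ← aeval_algHom_apply (toCompleteA hp), toCompleteA, lift_b, lift_x]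
      change _ = coord n 1 * _
      ring
    · simp only [t, Fin.reduceFinMk, Matrix.cons_val, hf, map_sub, AlgHom.commutes]
      rw [toCompleteA, lift_x, add_sub_cancel_left]
  have hmax : IsLocalRing.maximalIdeal O = P.map (algebraMap _ O) :=
    (IsLocalization.AtPrime.map_eq_maximalIdeal P O).symm
  have htm : ∀ i, t i ∈ IsLocalRing.maximalIdeal O := by
    have hmem : ∀ s ∈ ptIdeal p α 0 0 h0, algebraMap _ O s ∈ IsLocalRing.maximalIdeal O := by
      intro s hs
      rw [hmax]
      exact Ideal.mem_map_of_mem _ (hP.ge hs)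
    intro i
    fin_cases i
    · exact hmem _ (by rw [mem_ptIdeal_iff]; simp [evalPt])
    · exact Ideal.mul_mem_right _ _ (Ideal.neg_mem_iff _ |>.mpr
        (hmem _ (by rw [mem_ptIdeal_iff]; simp [evalPt])))
    · exact hmem _ (by rw [mem_ptIdeal_iff]; simp [evalPt])
  have hIJ : IsLocalRing.maximalIdeal O ≤ (coordIdeal k n).comap f := by
    rw [hmax, hP, ptIdeal_eq_span, Ideal.map_span, Ideal.span_le]
    rintro _ ⟨s, (rfl | rfl | rfl), rfl⟩ <;> rw [SetLike.mem_coe, Ideal.mem_comap, hf, map_sub,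
      AlgHom.commutes, toCompleteA]
    · rw [lift_x, add_sub_cancel_left]; exact coord_mem 2
    · rw [lift_a, map_zero, sub_zero]; exact coord_mem 0
    · rw [lift_b, map_zero, sub_zero]
      exact Ideal.mul_mem_right _ _ (Ideal.neg_mem_iff _ |>.mpr (coord_mem 1))
  have htrel : t 0 * t 1 + t 2 ^ (n + 1) = 0 := by
    have h2 := (a_mul_b p).trans (congrArg (aeval (x p)) hp)
    simp only [map_mul, map_pow, map_sub, aeval_X, aeval_C] at h2
    have h3 := congrArg (algebraMap (DoublePlane p) O) h2
    rw [map_mul, map_mul _ _ (aeval (x p) w), ← hu, map_pow] at h3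
    apply u.isUnit.mul_right_cancel
    simp only [t, Matrix.cons_val]
    linear_combination -h3 -
      algebraMap (DoublePlane p) O (a p) * algebraMap (DoublePlane p) O (b p) * u.inv_mul
  suffices h : (∀ m s, f s ∈ coordIdeal k n ^ m → s ∈ IsLocalRing.maximalIdeal O ^ m) ∧
      ∀ m y, ∃ s, y - f s ∈ coordIdeal k n ^ m by
    obtain ⟨F, hF⟩ := exists_adicCompletion_algEquiv (IsLocalRing.maximalIdeal O)
      (coordIdeal k n) f (fun m s hs => Ideal.le_comap_pow f m (Ideal.pow_right_mono hIJ m hs))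
      h.1 h.2
    exact ⟨F, fun s => (hF _).trans (hf s)⟩
  constructor
  -- Evaluation of power series at t, modulo the m-th power of the maximal ideal, descends along the
  -- A_n relation to a map G with G ∘ f the quotient map. An element whose image lies in the m-th
  -- power of the coordinate ideal is killed by G.
  · intro m s hs
    obtain ⟨g, hgX, hg⟩ := exists_powerSeries_eval_mod (k := k) (IsLocalRing.maximalIdeal O) t htm m
    let G : CompleteA k n →ₐ[k] O ⧸ IsLocalRing.maximalIdeal O ^ m :=
      Ideal.Quotient.liftₐ (relIdeal k n) g (by
        intro y hy
        obtain ⟨z, rfl⟩ := Ideal.mem_span_singleton'.mp hy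
        rw [map_mul, map_add, map_mul, map_pow, hgX, hgX, hgX, ← map_mul, ← map_pow, ← map_add,
          htrel, map_zero, mul_zero])
    have hGc : ∀ i, G (coord n i) = Ideal.Quotient.mk _ (t i) := hgX
    have hGx : G (algebraMap k _ α + coord n 2) =
        Ideal.Quotient.mk _ (algebraMap (DoublePlane p) O (x p)) := by
      rw [map_add, AlgHom.commutes, hGc]
      change Ideal.Quotient.mk _ (algebraMap k O α) + _ = _
      rw [← map_add]
      simp only [t, Matrix.cons_val]
      rw [map_sub, ← IsScalarTower.algebraMap_apply, add_sub_cancel]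
    have hG : ∀ s, G (f s) = Ideal.Quotient.mk _ s := by
      have h1 : G.comp (toCompleteA hp) = (Ideal.Quotient.mkₐ k _).comp
          (IsScalarTower.toAlgHom k (DoublePlane p) O) := by
        apply algHom_ext
        · rw [AlgHom.comp_apply, toCompleteA, lift_x, hGx]; rfl
        · rw [AlgHom.comp_apply, toCompleteA, lift_a, hGc]; rfl
        · rw [AlgHom.comp_apply, toCompleteA, lift_b, map_mul, map_neg, hGc,
            ← aeval_algHom_apply G, hGx]
          change -Ideal.Quotient.mkₐ k _ (t 1) * aeval (Ideal.Quotient.mkₐ k _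
            (IsScalarTower.toAlgHom k (DoublePlane p) O (x p))) w = Ideal.Quotient.mkₐ k _ _
          rw [aeval_algHom_apply, aeval_algHom_apply, ← map_neg, ← map_mul]
          congr 1
          change -(-algebraMap _ O (b p) * ↑u⁻¹) * algebraMap _ O (aeval (x p) w) =
            algebraMap _ O (b p)
          rw [← hu, neg_mul, Units.inv_mul_cancel_right, neg_neg]
      have h2 : (G.comp f).toRingHom = Ideal.Quotient.mk _ := by
        apply IsLocalization.ringHom_ext P.primeCompl
        refine RingHom.ext fun s => ?_
        change G (f (algebraMap _ O s)) = _
        rw [hf]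
        exact congrArg (fun φ => φ s) h1
      exact fun s => RingHom.congr_fun h2 s
    obtain ⟨y, hy, hys⟩ : ∃ y ∈ Ideal.span (Set.range MvPowerSeries.X) ^ m,
        Ideal.Quotient.mk _ y = f s := by
      rw [coordIdeal, ← Ideal.map_pow] at hs
      exact (Ideal.mem_map_iff_of_surjective _ Ideal.Quotient.mk_surjective).mp hs
    rw [← Ideal.Quotient.eq_zero_iff_mem, ← hG, ← hys]
    exact hg y hy
  · intro m y
    obtain ⟨y, rfl⟩ := Ideal.Quotient.mk_surjective y
    obtain ⟨P, hP⟩ := exists_sub_aeval_X_mem y m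
    refine ⟨MvPolynomial.aeval t P, ?_⟩
    have h1 : f.comp (MvPolynomial.aeval t) = (Ideal.Quotient.mkₐ k (relIdeal k n)).comp
        (MvPolynomial.aeval MvPowerSeries.X) := by
      apply MvPolynomial.algHom_ext
      intro i
      rw [AlgHom.comp_apply, AlgHom.comp_apply, MvPolynomial.aeval_X, MvPolynomial.aeval_X, hft]
      rfl
    rw [show f (MvPolynomial.aeval t P) = _ from congrArg (fun φ => φ P) h1, coordIdeal, ← Ideal.map_pow]
    have := Ideal.mem_map_of_mem (Ideal.Quotient.mk (relIdeal k n)) hP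
    rwa [map_sub] at this

end DoublePlane

/-! ### The ℤ/e-grading on power series in two variables. -/

namespace MvPowerSeries

variable {k : Type*} [Field k]

instance isDomain_of_field {σ : Type*} : IsDomain (MvPowerSeries σ k) := NoZeroDivisors.to_isDomain _

/-- Power series over a principal ideal domain form a factorial ring, and k[[u]] is such a domain.
-/
instance uniqueFactorizationMonoid_fin_two : UniqueFactorizationMonoid (MvPowerSeries (Fin 2) k) := by
  let f : PowerSeries k ≃ₐ[k] MvPowerSeries (Fin 1) k :=
    renameEquiv k (Equiv.ofUnique Unit (Fin 1))
  have : IsPrincipalIdealRing (MvPowerSeries (Fin 1) k) :=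
    IsPrincipalIdealRing.of_surjective f f.surjective
  exact (finSuccEquiv k 1).symm.toMulEquiv.uniqueFactorizationMonoid inferInstance

theorem prime_X_zero {n : ℕ} : Prime (X 0 : MvPowerSeries (Fin (n + 1)) k) := by
  rw [← MulEquiv.prime_iff (finSuccEquiv k n), finSuccEquiv_X_zero]
  exact PowerSeries.X_prime

/-- The degree in `ℤ / e` of a monomial in two variables of degrees `1` and `-1`. -/
def twist (e : ℕ) (d : Fin 2 →₀ ℕ) : ZMod e := d 0 - d 1

theorem twist_add (e : ℕ) (c d : Fin 2 →₀ ℕ) : twist e (c + d) = twist e c + twist e d := by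
  simp only [twist, Finsupp.add_apply, Nat.cast_add]; ring

/-- A power series in two variables of degrees `1` and `-1` in `ℤ / e` is homogeneous. -/
def IsTwisted (e : ℕ) (i : ZMod e) (s : MvPowerSeries (Fin 2) k) : Prop :=
  ∀ d, coeff d s ≠ 0 → twist e d = i

/-- The homogeneous components for the grading by `ℤ / e`. -/
def twistComponent (e : ℕ) (i : ZMod e) (s : MvPowerSeries (Fin 2) k) : MvPowerSeries (Fin 2) k :=
  fun d => if twist e d = i then coeff d s else 0

variable {e : ℕ} {i j : ZMod e} {s t : MvPowerSeries (Fin 2) k}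

theorem coeff_twistComponent (d : Fin 2 →₀ ℕ) :
    coeff d (twistComponent e i s) = if twist e d = i then coeff d s else 0 := rfl

theorem isTwisted_twistComponent : IsTwisted e i (twistComponent e i s) := by
  intro d hd
  rw [coeff_twistComponent] at hd
  by_contra h
  exact hd (if_neg h)

theorem IsTwisted.twistComponent_eq (hs : IsTwisted e i s) : twistComponent e i s = s := by
  ext d
  rw [coeff_twistComponent]
  split_ifs with h
  · rfl
  · by_contra h'
    exact h (hs d fun h0 => h' h0.symm)

theorem sum_twistComponent [NeZero e] : ∑ i : ZMod e, twistComponent e i s = s := by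
  ext d
  rw [map_sum]
  simp [coeff_twistComponent]

theorem IsTwisted.twistComponent_mul (hs : IsTwisted e i s) :
    twistComponent e (i + j) (s * t) = s * twistComponent e j t := by
  classical
  ext d
  rw [coeff_twistComponent, coeff_mul, coeff_mul]
  have h : ∀ x ∈ Finset.HasAntidiagonal.antidiagonal d, coeff x.1 s * coeff x.2 (twistComponent e j t) =
      if twist e d = i + j then coeff x.1 s * coeff x.2 t else 0 := by
    rintro ⟨c, c'⟩ hc
    by_cases h0 : coeff c s = 0
    · simp [h0]
    · rw [Finset.HasAntidiagonal.mem_antidiagonal] at hc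
      simp only at hc
      have hiff : twist e d = i + j ↔ twist e c' = j := by
        rw [← hc, twist_add, hs c h0, add_right_inj]
      simp only [coeff_twistComponent, hiff, mul_ite, mul_zero]
  rw [Finset.sum_congr rfl h]
  split_ifs <;> simp

theorem IsTwisted.mul (hs : IsTwisted e i s) (ht : IsTwisted e j t) :
    IsTwisted e (i + j) (s * t) := by
  rw [← ht.twistComponent_eq, ← hs.twistComponent_mul]
  exact isTwisted_twistComponent

theorem isTwisted_one : IsTwisted e 0 (1 : MvPowerSeries (Fin 2) k) := by
  classical
  intro d hd
  rw [coeff_one] at hd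
  rw [(ite_ne_right_iff.mp hd).1]
  simp [twist]

theorem IsTwisted.pow (hs : IsTwisted e i s) (n : ℕ) : IsTwisted e (n * i) (s ^ n) := by
  induction n with
  | zero => simpa using isTwisted_one
  | succ n ih =>
    rw [pow_succ, show ((n + 1 : ℕ) : ZMod e) * i = n * i + i by push_cast; ring]
    exact ih.mul hs

/-- Multiplication by s shifts components, so s times the component of t is all of st, and s
cancels. -/
theorem IsTwisted.of_mul (hs : IsTwisted e i s) (hs0 : s ≠ 0) (hst : IsTwisted e (i + j) (s * t)) :
    IsTwisted e j t := by
  have h := hst.twistComponent_eq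
  rw [hs.twistComponent_mul] at h
  rw [← mul_left_cancel₀ hs0 h]
  exact isTwisted_twistComponent

theorem isTwisted_X_zero : IsTwisted e 1 (X 0 : MvPowerSeries (Fin 2) k) := by
  classical
  intro d hd
  rw [coeff_X] at hd
  rw [(ite_ne_right_iff.mp hd).1]
  simp [twist]

theorem isTwisted_X_one : IsTwisted e (-1) (X 1 : MvPowerSeries (Fin 2) k) := by
  classical
  intro d hd
  rw [coeff_X] at hd
  rw [(ite_ne_right_iff.mp hd).1]
  simp [twist]

theorem isTwisted_X_zero_pow : IsTwisted e 0 (X 0 ^ e : MvPowerSeries (Fin 2) k) := by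
  simpa using isTwisted_X_zero.pow (k := k) (e := e) e

theorem isTwisted_X_mul_X : IsTwisted e 0 (X 0 * X 1 : MvPowerSeries (Fin 2) k) := by
  simpa using isTwisted_X_zero.mul (k := k) (e := e) isTwisted_X_one

/-- The conductor of a homogeneous element modulo another one is generated by a homogeneous
element. -/
theorem exists_isTwisted_forall_dvd_mul_iff [NeZero e] (hs : IsTwisted e 0 s) (hs0 : s ≠ 0)
    (ht : IsTwisted e 0 t) :
    ∃ (d : ZMod e) (h : MvPowerSeries (Fin 2) k), IsTwisted e d h ∧ h ≠ 0 ∧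
      ∀ z, s ∣ t * z ↔ h ∣ z := by
  -- After removing the common factor, the conductor is the ideal generated by s'. Because s and t
  -- have degree zero, it is stable under taking components, so s' divides each of its own
  -- components.
  obtain ⟨t', s', c, hrel, rfl, rfl⟩ := UniqueFactorizationMonoid.exists_reduced_factors' t s hs0
  have hc : c ≠ 0 := left_ne_zero_of_mul hs0
  have hs' : s' ≠ 0 := right_ne_zero_of_mul hs0
  have hdvd : ∀ z, c * s' ∣ c * t' * z ↔ s' ∣ z := fun z => by
    rw [mul_assoc, mul_dvd_mul_iff_left hc]
    exact ⟨hrel.symm.dvd_of_dvd_mul_left, fun h => h.mul_left _⟩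
  have hcomp : ∀ d : ZMod e, s' ∣ twistComponent e d s' := by
    intro d
    rw [← hdvd]
    obtain ⟨z, hz⟩ := (hdvd s').mpr dvd_rfl
    have h1 := ht.twistComponent_mul (j := d) (t := s')
    rw [hz, hs.twistComponent_mul] at h1
    exact ⟨_, h1.symm⟩
  choose z hz using hcomp
  have h1 : ∑ d, z d = 1 := by
    apply mul_left_cancel₀ hs'
    rw [Finset.mul_sum, mul_one]
    simp_rw [← hz]
    exact sum_twistComponent
  -- The cofactors sum to 1 in a local ring, so one is a unit; that component of s' is an associate
  -- of s' and generates the conductor.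
  obtain ⟨d, hd⟩ : ∃ d, IsUnit (z d) := by
    by_contra! hcon
    have h2 : ∑ d, z d ∈ IsLocalRing.maximalIdeal (MvPowerSeries (Fin 2) k) :=
      Ideal.sum_mem _ fun d _ => (IsLocalRing.mem_maximalIdeal _).mpr (hcon d)
    rw [h1] at h2
    exact (IsLocalRing.mem_maximalIdeal _).mp h2 isUnit_one
  have hass : Associated s' (twistComponent e d s') := ⟨hd.unit, (hz d).symm⟩
  refine ⟨d, twistComponent e d s', isTwisted_twistComponent, fun h => hs' ?_, fun y => ?_⟩
  · exact hass.eq_zero_iff.mpr h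
  · rw [hdvd, hass.dvd_iff_dvd_left]

/-- Homogeneous power series of degree zero divisible by `X 0`. -/
theorem IsTwisted.exists_eq_add_of_X_zero_dvd [NeZero e] (hs : IsTwisted e 0 s) (h : X 0 ∣ s) :
    ∃ y z : MvPowerSeries (Fin 2) k, IsTwisted e 0 y ∧ IsTwisted e 0 z ∧
      s = X 0 ^ e * y + X 0 * X 1 * z := by
  let s₁ : MvPowerSeries (Fin 2) k := fun d => if e ≤ d 0 then coeff d s else 0
  have hc : ∀ d, coeff d s₁ = if e ≤ d 0 then coeff d s else 0 := fun d => rfl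
  have hs₁ : IsTwisted e 0 s₁ := fun d hd => hs d fun h0 => hd (by rw [hc, h0, ite_self])
  obtain ⟨y, hy⟩ : X 0 ^ e ∣ s₁ := by
    rw [X_pow_dvd_iff]
    intro d hd
    rw [hc, if_neg (not_le.mpr hd)]
  have hs₂ : IsTwisted e 0 (s - s₁) := fun d hd => hs d fun h0 => hd (by
    rw [map_sub, hc, h0, ite_self, sub_zero])
  obtain ⟨z, hz⟩ : X 0 * X 1 ∣ s - s₁ := by
    -- A remaining degree-zero monomial u^i v^j has 0 < i < e and e dividing i - j, which excludes j
    -- = 0; so it is divisible by uv.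
    have h0 : ∀ d : Fin 2 →₀ ℕ, d 0 = 0 ∨ d 1 = 0 → coeff d (s - s₁) = 0 := by
      intro d hd
      by_contra hne
      rw [map_sub, hc] at hne
      split_ifs at hne with hle
      · simp at hne
      · rw [sub_zero] at hne
        have h1 := X_dvd_iff.mp h d
        rcases hd with hd | hd
        · exact hne (h1 hd)
        · have h2 := hs d hne
          rw [twist, hd, Nat.cast_zero, sub_zero, ZMod.natCast_eq_zero_iff] at h2
          exact hne (h1 (Nat.eq_zero_of_dvd_of_lt h2 (not_le.mp hle)))
    obtain ⟨z, hz⟩ : X 0 ∣ s - s₁ := X_dvd_iff.mpr fun d hd => h0 d (Or.inl hd)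
    obtain ⟨z', hz'⟩ : X 1 ∣ z := by
      refine X_dvd_iff.mpr fun d hd => ?_
      have h2 := h0 (Finsupp.single 0 1 + d) (Or.inr (by simp [hd]))
      rwa [hz, X, coeff_add_monomial_mul, one_mul] at h2
    exact ⟨z', by rw [hz, hz', mul_assoc]⟩
  refine ⟨y, z, ?_, ?_, ?_⟩
  · refine isTwisted_X_zero_pow.of_mul (pow_ne_zero _ prime_X_zero.ne_zero) ?_
    rwa [← hy, add_zero]
  · refine isTwisted_X_mul_X.of_mul (s := X 0 * X 1) ?_ ?_
    · exact mul_ne_zero prime_X_zero.ne_zero fun h1 => one_ne_zero (α := k) (by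
        rw [← coeff_index_single_self_X (R := k) (1 : Fin 2), h1, map_zero])
    · rwa [← hz, add_zero]
  · rw [← hy, ← hz, add_sub_cancel]

end MvPowerSeries

/-! ### Class groups of degree-zero subrings. -/

section

open MvPowerSeries

/-- If `div a = e q` with `a` irreducible and every other prime divisor is principal away from
`V(a)`, then the class group is cyclic of order `e`, generated by the class of `q`. -/
theorem addOrderOf_divisorClass_single_and_forall_mem_zmultiples {R : Type*} [CommRing R]
    [IsDomain R] [IsNoetherianRing R] [IsIntegrallyClosed R] {q : PrimeDivisor R} {a b c w : R}
    {e : ℕ} (he : 1 ≤ e) (hq : q.1.asIdeal = Ideal.span {a, c}) (hb : b ∉ q.1.asIdeal)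
    (hw : w ∉ q.1.asIdeal) (h : a * b = c ^ e * w) (ha : Irreducible a)
    (huniq : ∀ s : PrimeDivisor R, a ∈ s.1.asIdeal → s = q)
    (hgen : ∀ r : PrimeDivisor R, a ∉ r.1.asIdeal →
      ∃ g ∈ r.1.asIdeal, g ≠ 0 ∧ ∀ s ∈ r.1.asIdeal, ∃ n : ℕ, g ∣ a ^ n * s) :
    addOrderOf (divisorClass (Finsupp.single q 1) : DivisorClassGroup R) = e ∧
      ∀ x : DivisorClassGroup R, x ∈ AddSubgroup.zmultiples (divisorClass (Finsupp.single q 1)) := by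
  classical
  have haq : a ∈ q.1.asIdeal := by rw [hq]; exact Ideal.subset_span (by simp)
  refine ⟨addOrderOf_divisorClass_single he ha ?_, mem_zmultiples_of_forall_single fun r => ?_⟩
  · ext s
    rw [elemDivisor_apply ha.ne_zero, Finsupp.single_apply]
    split_ifs with hs
    · rw [← hs, multAlong_eq_of_mul_eq_pow_mul he hq hb hw h]
    · rw [(multAlong_eq_zero_iff (span_singleton_ne_bot ha.ne_zero)).mpr fun hle => hs
        (huniq s ((Ideal.span_singleton_le_iff_mem _).mp hle)).symm]
      rfl
  · by_cases hr : a ∈ r.1.asIdeal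
    · rw [huniq r hr]; exact AddSubgroup.mem_zmultiples _
    · obtain ⟨g, hg, hg0, hgr⟩ := hgen r hr
      obtain ⟨m, hm⟩ := exists_divisorClass_single_eq_smul huniq hg0 hg hgr
        fun hrq => hr (by rw [hrq]; exact haq)
      rw [hm]
      exact AddSubgroup.zsmul_mem_zmultiples _ m

theorem MvPowerSeries.X_zero_not_dvd_X_one_pow {k : Type*} [Field k] (n : ℕ) :
    ¬ (X 0 : MvPowerSeries (Fin 2) k) ∣ X 1 ^ n := by
  intro h
  have h1 := X_dvd_iff.mp (prime_X_zero.dvd_of_dvd_pow h) (Finsupp.single 1 1) (by simp)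
  rw [coeff_index_single_self_X] at h1
  exact one_ne_zero h1

/-- `ψ` identifies `B` with the ring of power series of degree zero for the grading of `k[[u, v]]`
by `ℤ / e` in which `u` has degree `1` and `v` has degree `-1`. -/
structure IsDegreeZeroSubring {k B : Type*} [Field k] [CommRing B] (e : ℕ)
    (ψ : B →+* MvPowerSeries (Fin 2) k) : Prop where
  injective : Function.Injective ψ
  mem_range_iff : ∀ s, s ∈ ψ.range ↔ IsTwisted e 0 s

namespace IsDegreeZeroSubring

variable {k B : Type*} [Field k] [CommRing B] {e : ℕ} [NeZero e]
  {ψ : B →+* MvPowerSeries (Fin 2) k} (hψ : IsDegreeZeroSubring e ψ)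

include hψ

theorem isTwisted (y : B) : IsTwisted e 0 (ψ y) := (hψ.mem_range_iff _).mp ⟨y, rfl⟩

theorem exists_eq {s : MvPowerSeries (Fin 2) k} (hs : IsTwisted e 0 s) : ∃ y, ψ y = s :=
  (hψ.mem_range_iff s).mpr hs

theorem map_ne_zero {y : B} (hy : y ≠ 0) : ψ y ≠ 0 := by
  rwa [ne_eq, map_eq_zero_iff _ hψ.injective]

theorem isDomain : IsDomain B := hψ.injective.isDomain ψ

/-- A quotient of degree-zero elements has degree zero, so divisibility descends from k[[u,v]]. -/
theorem dvd_of_map_dvd {y z : B} (h : ψ y ∣ ψ z) : y ∣ z := by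
  by_cases hy : y = 0
  · rw [hy, map_zero, zero_dvd_iff, map_eq_zero_iff _ hψ.injective] at h
    rw [h]; exact dvd_zero y
  · obtain ⟨s, hs⟩ := h
    have h1 : IsTwisted e 0 s := by
      refine (hψ.isTwisted y).of_mul (hψ.map_ne_zero hy) ?_
      rw [← hs, add_zero]
      exact hψ.isTwisted z
    obtain ⟨w, rfl⟩ := hψ.exists_eq h1
    exact ⟨w, hψ.injective (by rw [hs, map_mul])⟩

theorem isUnit_of_map {y : B} (h : IsUnit (ψ y)) : IsUnit y :=
  isUnit_of_dvd_one (hψ.dvd_of_map_dvd (by rw [map_one]; exact h.dvd))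

/-- A fraction integral over B is integral over the normal ring k[[u,v]], hence a divisibility
there, and divisibility descends. -/
theorem isIntegrallyClosed : IsIntegrallyClosed B := by
  have := hψ.isDomain
  let S := MvPowerSeries (Fin 2) k
  let φ : FractionRing B →+* FractionRing S := IsFractionRing.map hψ.injective
  have hφ : ∀ y, φ (algebraMap B _ y) = algebraMap S _ (ψ y) := fun y =>
    IsLocalization.map_eq _ y
  rw [isIntegrallyClosed_iff (FractionRing B)]
  intro x hx
  obtain ⟨r, s, hs, rfl⟩ := IsFractionRing.div_surjective (A := B) x
  have h1 : IsIntegral S (φ (algebraMap B _ r / algebraMap B _ s)) :=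
    hx.map_of_comp_eq ψ φ (RingHom.ext fun y => (hφ y).symm)
  obtain ⟨t, ht⟩ := IsIntegrallyClosed.isIntegral_iff.mp h1
  have hs0 : s ≠ 0 := nonZeroDivisors.ne_zero hs
  have hs1 : algebraMap S (FractionRing S) (ψ s) ≠ 0 := by
    rw [ne_eq, IsFractionRing.to_map_eq_zero_iff]
    exact hψ.map_ne_zero hs0
  have hs2 : algebraMap B (FractionRing B) s ≠ 0 := by
    rwa [ne_eq, IsFractionRing.to_map_eq_zero_iff]
  rw [map_div₀, hφ, hφ, eq_div_iff hs1, ← map_mul] at ht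
  have h2 := IsFractionRing.injective S (FractionRing S) ht
  obtain ⟨w, rfl⟩ := hψ.dvd_of_map_dvd (y := s) (z := r) ⟨t, by rw [← h2, mul_comm]⟩
  exact ⟨w, by rw [map_mul, mul_div_cancel_left₀ _ hs2]⟩

/-- A factor of u^e is u^i times a unit, whose nonzero constant term has degree zero. A factor of
degree zero thus needs e to divide i, leaving i = 0 or i = e. -/
theorem irreducible {a : B} (ha : ψ a = X 0 ^ e) : Irreducible a := by
  have hX : Prime (X 0 : MvPowerSeries (Fin 2) k) := prime_X_zero
  have hX0 : IsTwisted e 1 (X 0 : MvPowerSeries (Fin 2) k) := isTwisted_X_zero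
  refine ⟨fun h => ?_, fun y z hyz => ?_⟩
  · have h1 := h.map ψ
    rw [ha, isUnit_pow_iff (NeZero.ne e)] at h1
    exact hX.not_isUnit h1
  · have h1 : ψ y ∣ X 0 ^ e := ⟨ψ z, by rw [← ha, hyz, map_mul]⟩
    obtain ⟨i, hi, hass⟩ := (dvd_prime_pow hX e).mp h1
    obtain ⟨u, hu⟩ := hass.symm
    have h2 : IsTwisted e (-(i : ZMod e)) (u : MvPowerSeries (Fin 2) k) := by
      have h3 := hX0.pow i
      rw [mul_one] at h3
      refine h3.of_mul (pow_ne_zero _ hX.ne_zero) ?_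
      rw [hu, add_neg_cancel]
      exact hψ.isTwisted y
    have h4 : (i : ZMod e) = 0 := by
      have h5 := h2 0 (by
        rw [coeff_zero_eq_constantCoeff_apply]
        exact (u.isUnit.map _).ne_zero)
      simpa [twist, eq_comm] using h5
    rw [ZMod.natCast_eq_zero_iff] at h4
    rcases Nat.eq_zero_or_pos i with h0 | h0
    · left
      apply hψ.isUnit_of_map
      rw [← hu, h0, pow_zero, one_mul]
      exact u.isUnit
    · right
      have hie : i = e := le_antisymm hi (Nat.le_of_dvd h0 h4)
      rw [hie] at hu
      have h6 : (u : MvPowerSeries (Fin 2) k) * ψ z = 1 := by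
        apply mul_left_cancel₀ (pow_ne_zero e hX.ne_zero)
        rw [← mul_assoc, hu, ← map_mul, ← hyz, ha, mul_one]
      exact hψ.isUnit_of_map (IsUnit.of_mul_eq_one_right _ h6)

theorem comap_span_X_zero {a c : B} (ha : ψ a = X 0 ^ e) (hc : ψ c = X 0 * X 1) :
    (Ideal.span {X 0}).comap ψ = Ideal.span {a, c} := by
  apply le_antisymm
  · intro y hy
    rw [Ideal.mem_comap, Ideal.mem_span_singleton] at hy
    obtain ⟨z, w, hz, hw, h⟩ := (hψ.isTwisted y).exists_eq_add_of_X_zero_dvd hy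
    obtain ⟨z, rfl⟩ := hψ.exists_eq hz
    obtain ⟨w, rfl⟩ := hψ.exists_eq hw
    rw [← ha, ← hc, ← map_mul, ← map_mul, ← map_add] at h
    rw [hψ.injective h, Ideal.mem_span_pair]
    exact ⟨z, w, by ring⟩
  · rw [Ideal.span_le]
    rintro _ (rfl | rfl) <;> rw [SetLike.mem_coe, Ideal.mem_comap, Ideal.mem_span_singleton]
    · rw [ha]; exact dvd_pow_self _ (NeZero.ne e)
    · rw [hc]; exact dvd_mul_right _ _

section

variable [IsNoetherianRing B] {a b c : B} (ha : ψ a = X 0 ^ e) (hb : ψ b = X 1 ^ e)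
  (hc : ψ c = X 0 * X 1)

include ha hb hc

theorem mul_eq_pow : a * b = c ^ e := by
  apply hψ.injective
  rw [map_mul, map_pow, ha, hb, hc, mul_pow]

/-- There is exactly one prime divisor containing `u ^ e`, and it is `(u ^ e, u v)`. -/
theorem exists_primeDivisor : ∃ q : PrimeDivisor B, q.1.asIdeal = Ideal.span {a, c} ∧
    b ∉ q.1.asIdeal ∧ ∀ s : PrimeDivisor B, a ∈ s.1.asIdeal → s = q := by
  have := hψ.isDomain
  have := hψ.isIntegrallyClosed
  have hP : (Ideal.span {(X 0 : MvPowerSeries (Fin 2) k)}).IsPrime :=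
    (Ideal.span_singleton_prime prime_X_zero.ne_zero).mpr prime_X_zero
  have hP' : (Ideal.span {a, c}).IsPrime := by
    rw [← hψ.comap_span_X_zero ha hc]
    exact Ideal.comap_isPrime ψ _
  -- Since c^e = ab, a prime containing a contains c. So (a, c) is minimal over (a), and its height
  -- is at most one by Krull.
  have hle : ∀ P : Ideal B, P.IsPrime → a ∈ P → Ideal.span {a, c} ≤ P := by
    intro P hP h
    rw [Ideal.span_le]
    rintro _ (rfl | rfl)
    · exact h
    · refine hP.mem_of_pow_mem e ?_
      rw [← hψ.mul_eq_pow ha hb hc]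
      exact Ideal.mul_mem_right _ _ h
  have ha0 : a ≠ 0 := (hψ.irreducible ha).ne_zero
  have hht : (Ideal.span {a, c}).height = 1 := by
    apply le_antisymm
    · refine Ideal.height_le_one_of_isPrincipal_of_mem_minimalPrimes (Ideal.span {a}) _ ?_
      refine ⟨⟨hP', Ideal.span_mono (by simp)⟩, fun P hP _ => hle P hP.1 ?_⟩
      exact hP.2 (Ideal.mem_span_singleton_self a)
    · refine Order.one_le_iff_ne_zero.mpr fun h0 => ha0 ?_
      rw [Ideal.height_eq_zero_iff_eq_bot] at h0
      rw [← Ideal.mem_bot, ← h0]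
      exact Ideal.subset_span (by simp)
  refine ⟨⟨⟨_, hP'⟩, hht⟩, rfl, fun h => ?_, fun s hs => ?_⟩
  · have h1 : b ∈ Ideal.span {a, c} := h
    rw [← hψ.comap_span_X_zero ha hc, Ideal.mem_comap, Ideal.mem_span_singleton, hb] at h1
    exact X_zero_not_dvd_X_one_pow e h1
  · exact (PrimeDivisor.eq_of_le (hle _ s.1.2 hs)).symm

/-- Away from `u ^ e`, prime divisors are principal. -/
theorem exists_generator (r : PrimeDivisor B) :
    ∃ g ∈ r.1.asIdeal, g ≠ 0 ∧ ∀ s ∈ r.1.asIdeal, ∃ n : ℕ, g ∣ a ^ n * s := by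
  have := hψ.isDomain
  have := hψ.isIntegrallyClosed
  obtain ⟨f, hf, hf0⟩ := Submodule.exists_mem_ne_zero_of_ne_bot r.asIdeal_ne_bot
  have hmin : r.1.asIdeal ∈ (Ideal.span {f}).minimalPrimes := by
    have hr : r.1.asIdeal.FiniteHeight := ⟨Or.inr (by rw [r.2]; simp)⟩
    refine Ideal.mem_minimalPrimes_of_height_le ((Ideal.span_singleton_le_iff_mem _).mpr hf) ?_
    rw [r.2]
    refine Order.one_le_iff_ne_zero.mpr fun h0 => hf0 ?_
    rwa [Ideal.height_eq_zero_iff_eq_bot, Ideal.span_singleton_eq_bot] at h0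
  -- A minimal prime of (f) is an associated prime, so r is a conductor and has a homogeneous
  -- generator h in k[[u,v]].
  obtain ⟨y, hy⟩ : ∃ y, ∀ z, z ∈ r.1.asIdeal ↔ f ∣ y * z := by
    have h1 : (Ideal.span {f}).colon {(1 : B)} = Ideal.span {f} := by
      ext z; rw [Submodule.mem_colon_singleton, smul_eq_mul, mul_one]
    rw [← h1] at hmin
    obtain ⟨y, hy⟩ := Submodule.exists_eq_colon_of_mem_minimalPrimes hmin
    refine ⟨y, fun z => ?_⟩
    rw [hy, Submodule.mem_colon_singleton, smul_eq_mul, Ideal.mem_span_singleton, mul_comm]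
  obtain ⟨d, h, hd, h0, hiff⟩ := exists_isTwisted_forall_dvd_mul_iff (hψ.isTwisted f)
    (hψ.map_ne_zero hf0) (hψ.isTwisted y)
  have hmem : ∀ z, z ∈ r.1.asIdeal ↔ h ∣ ψ z := fun z => by
    rw [hy, ← hiff, ← map_mul]
    exact ⟨fun hd => map_dvd ψ hd, hψ.dvd_of_map_dvd⟩
  -- Multiplying h by u^j with j ≡ -d moves it into degree zero. As j < e, the extra factor divides
  -- u^e = ψ a, so one power of a suffices.
  let j := (-d).val
  have hj : ((j : ℕ) : ZMod e) = -d := ZMod.natCast_zmod_val _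
  have hX : IsTwisted e (-d) (X 0 ^ j : MvPowerSeries (Fin 2) k) := by
    have h1 := isTwisted_X_zero.pow (k := k) (e := e) j
    rwa [mul_one, hj] at h1
  have hX0 : (X 0 : MvPowerSeries (Fin 2) k) ≠ 0 := prime_X_zero.ne_zero
  obtain ⟨g, hg⟩ := hψ.exists_eq (s := h * X 0 ^ j) (by simpa using hd.mul hX)
  refine ⟨g, (hmem g).mpr ⟨_, hg⟩, fun hg0 => ?_, fun s hs => ⟨1, hψ.dvd_of_map_dvd ?_⟩⟩
  · rw [hg0, map_zero] at hg
    exact mul_ne_zero h0 (pow_ne_zero _ hX0) hg.symm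
  · rw [hg, pow_one, map_mul, ha, mul_comm h]
    exact mul_dvd_mul (pow_dvd_pow _ (ZMod.val_lt _).le) ((hmem s).mp hs)

/-- The class group is cyclic of order `e`, generated by the class of `(u ^ e, u v)`. -/
theorem exists_divisorClass_generates [IsDomain B] [IsIntegrallyClosed B] :
    ∃ q : PrimeDivisor B, q.1.asIdeal = Ideal.span {a, c} ∧ b ∉ q.1.asIdeal ∧
      addOrderOf (divisorClass (Finsupp.single q 1) : DivisorClassGroup B) = e ∧
      ∀ x : DivisorClassGroup B,
        x ∈ AddSubgroup.zmultiples (divisorClass (Finsupp.single q 1)) := by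
  obtain ⟨q, hq, hbq, huniq⟩ := hψ.exists_primeDivisor ha hb hc
  refine ⟨q, hq, hbq, addOrderOf_divisorClass_single_and_forall_mem_zmultiples
    (Nat.one_le_iff_ne_zero.mpr (NeZero.ne e)) hq hbq q.1.2.one_notMem ?_ (hψ.irreducible ha) huniq
    fun r _ => hψ.exists_generator ha hb hc r⟩
  rw [mul_one, hψ.mul_eq_pow ha hb hc]

end

end IsDegreeZeroSubring

end

/-! ### The cyclic cover of the A_n singularity. -/

namespace CompleteA

open MvPowerSeries

variable {k : Type*} [Field k] {n : ℕ}

/-- The exponent vector of a monomial in two variables. -/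
noncomputable def exp₂ (i j : ℕ) : Fin 2 →₀ ℕ := Finsupp.single 0 i + Finsupp.single 1 j

/-- The exponent vector of a monomial in three variables. -/
noncomputable def exp₃ (i j l : ℕ) : Fin 3 →₀ ℕ :=
  Finsupp.single 0 i + Finsupp.single 1 j + Finsupp.single 2 l

@[simp] theorem exp₂_zero (i j : ℕ) : exp₂ i j 0 = i := by simp [exp₂]
@[simp] theorem exp₂_one (i j : ℕ) : exp₂ i j 1 = j := by simp [exp₂]
@[simp] theorem exp₃_zero (i j l : ℕ) : exp₃ i j l 0 = i := by simp [exp₃]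
@[simp] theorem exp₃_one (i j l : ℕ) : exp₃ i j l 1 = j := by simp [exp₃]
@[simp] theorem exp₃_two (i j l : ℕ) : exp₃ i j l 2 = l := by simp [exp₃]

theorem eq_exp₂ (d : Fin 2 →₀ ℕ) : d = exp₂ (d 0) (d 1) := by
  ext i; fin_cases i <;> simp

theorem eq_exp₃ (d : Fin 3 →₀ ℕ) : d = exp₃ (d 0) (d 1) (d 2) := by
  ext i; fin_cases i <;> simp

variable (k n) in
/-- The images `u ^ (n + 1)`, `-v ^ (n + 1)`, `u v` of the coordinates of the singularity `A_n` in
the ring of power series in two variables. -/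
noncomputable def coverCoord : Fin 3 → MvPowerSeries (Fin 2) k :=
  ![X 0 ^ (n + 1), -X 1 ^ (n + 1), X 0 * X 1]

theorem hasSubst_coverCoord : HasSubst (coverCoord k n) := by
  apply hasSubst_of_constantCoeff_zero
  intro i
  fin_cases i <;> simp [coverCoord]

theorem coverCoord_prod (d : Fin 3 →₀ ℕ) : (d.prod fun i m => coverCoord k n i ^ m) =
    monomial (exp₂ ((n + 1) * d 0 + d 2) ((n + 1) * d 1 + d 2)) ((-1) ^ d 1) := by
  rw [Finsupp.prod_fintype _ _ fun _ => pow_zero _, Fin.prod_univ_three]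
  have h : (monomial (exp₂ ((n + 1) * d 0 + d 2) ((n + 1) * d 1 + d 2)) ((-1) ^ d 1) :
      MvPowerSeries (Fin 2) k) = C ((-1) ^ d 1) *
        (X 0 ^ ((n + 1) * d 0 + d 2) * X 1 ^ ((n + 1) * d 1 + d 2)) := by
    rw [X_pow_eq, X_pow_eq, monomial_mul_monomial, ← monomial_zero_eq_C_apply,
      monomial_mul_monomial, zero_add, mul_one, mul_one, exp₂]
  rw [h, map_pow, map_neg (C : k →+* MvPowerSeries (Fin 2) k), map_one (C : k →+* MvPowerSeries (Fin 2) k)]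
  simp only [coverCoord, Matrix.cons_val]
  rw [neg_pow (X 1 ^ (n + 1) : MvPowerSeries (Fin 2) k)]
  ring

/-- The coefficients of the substitution `a = u ^ (n + 1)`, `b = -v ^ (n + 1)`, `c = u v`. -/
theorem coeff_subst_coverCoord (F : MvPowerSeries (Fin 3) k) (i j l : ℕ) (hl : l ≤ n) :
    coeff (exp₂ ((n + 1) * i + l) ((n + 1) * j + l)) (subst (coverCoord k n) F) =
      ∑ m ∈ Finset.range (min i j + 1),
        (-1) ^ (j - m) * coeff (exp₃ (i - m) (j - m) ((n + 1) * m + l)) F := by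
  classical
  rw [coeff_subst hasSubst_coverCoord]
  simp_rw [coverCoord_prod, coeff_monomial, smul_eq_mul]
  have hinj : Set.InjOn (fun m => exp₃ (i - m) (j - m) ((n + 1) * m + l))
      (Finset.range (min i j + 1)) := by
    intro m _ m' _ h
    have h1 := DFunLike.congr_fun h 2
    simp only [exp₃_two] at h1
    exact Nat.eq_of_mul_eq_mul_left n.succ_pos (Nat.add_right_cancel h1)
  -- The monomials with the same image up to sign arise from a^i b^j c^l by trading m factors ab for
  -- c^((n+1)m); the bound l ≤ n makes l the remainder of the exponent of c.
  rw [finsum_eq_sum_of_support_subset (s := (Finset.range (min i j + 1)).image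
    fun m => exp₃ (i - m) (j - m) ((n + 1) * m + l)), Finset.sum_image hinj]
  · refine Finset.sum_congr rfl fun m hm => ?_
    rw [Finset.mem_range] at hm
    obtain ⟨i', rfl⟩ := Nat.exists_eq_add_of_le' (show m ≤ i by omega)
    obtain ⟨j', rfl⟩ := Nat.exists_eq_add_of_le' (show m ≤ j by omega)
    rw [if_pos, mul_comm]
    · simp
    · simp only [exp₃_zero, exp₃_one, exp₃_two, Nat.add_sub_cancel]
      congr 1 <;> ring
  · intro d hd
    rw [Function.mem_support] at hd
    have h1 := (ite_ne_right_iff.mp (right_ne_zero_of_mul hd)).1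
    have h2 := DFunLike.congr_fun h1 0
    have h3 := DFunLike.congr_fun h1 1
    simp only [exp₂_zero, exp₂_one] at h2 h3
    have hmod : d 2 % (n + 1) = l := by
      have := congrArg (· % (n + 1)) h2
      simp only [Nat.mul_add_mod] at this
      rw [← this, Nat.mod_eq_of_lt (by omega)]
    have hdiv := Nat.div_add_mod (d 2) (n + 1)
    rw [hmod] at hdiv
    set m := d 2 / (n + 1)
    have h4 : i = d 0 + m := by
      apply Nat.eq_of_mul_eq_mul_left n.succ_pos
      apply Nat.add_right_cancel (m := l)
      rw [h2, ← hdiv, Nat.succ_eq_add_one]; ring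
    have h5 : j = d 1 + m := by
      apply Nat.eq_of_mul_eq_mul_left n.succ_pos
      apply Nat.add_right_cancel (m := l)
      rw [h3, ← hdiv, Nat.succ_eq_add_one]; ring
    simp only [Finset.coe_image, Set.mem_image, Finset.mem_coe, Finset.mem_range]
    refine ⟨m, by omega, ?_⟩
    rw [eq_exp₃ d, h4, h5]
    simp [hdiv]

theorem isTwisted_subst_coverCoord (F : MvPowerSeries (Fin 3) k) :
    IsTwisted (n + 1) 0 (subst (coverCoord k n) F) := by
  classical
  intro d hd
  rw [coeff_subst hasSubst_coverCoord] at hd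
  obtain ⟨c, hc⟩ : ∃ c, coeff c F • coeff d (c.prod fun i m => coverCoord k n i ^ m) ≠ 0 := by
    by_contra! h
    exact hd (finsum_eq_zero_of_forall_eq_zero h)
  rw [coverCoord_prod, coeff_monomial, smul_eq_mul] at hc
  rw [(ite_ne_right_iff.mp (right_ne_zero_of_mul hc)).1, twist]
  simp

/-- Exponents of degree zero. -/
theorem exists_eq_exp₂_of_twist_eq_zero {d : Fin 2 →₀ ℕ} (hd : twist (n + 1) d = 0) :
    ∃ i j l, l ≤ n ∧ d = exp₂ ((n + 1) * i + l) ((n + 1) * j + l) := by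
  rw [twist, sub_eq_zero, ZMod.natCast_eq_natCast_iff'] at hd
  refine ⟨d 0 / (n + 1), d 1 / (n + 1), d 0 % (n + 1),
    Nat.lt_succ_iff.mp (Nat.mod_lt _ n.succ_pos), ?_⟩
  rw [Nat.div_add_mod, hd, Nat.div_add_mod]
  exact eq_exp₂ d

/-- Up to sign, the monomials with exponent of c at most n correspond bijectively to the degree-zero
monomials in u and v, so a preimage can be written down coefficientwise. -/
theorem exists_subst_coverCoord_eq {s : MvPowerSeries (Fin 2) k} (hs : IsTwisted (n + 1) 0 s) :
    ∃ F : MvPowerSeries (Fin 3) k, subst (coverCoord k n) F = s := by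
  let F : MvPowerSeries (Fin 3) k := fun d => if d 2 ≤ n then
    (-1) ^ d 1 * coeff (exp₂ ((n + 1) * d 0 + d 2) ((n + 1) * d 1 + d 2)) s else 0
  have hF : ∀ d, coeff d F = if d 2 ≤ n then
    (-1) ^ d 1 * coeff (exp₂ ((n + 1) * d 0 + d 2) ((n + 1) * d 1 + d 2)) s else 0 := fun d => rfl
  refine ⟨F, ?_⟩
  ext d
  by_cases hd : twist (n + 1) d = 0
  · obtain ⟨i, j, l, hl, rfl⟩ := exists_eq_exp₂_of_twist_eq_zero hd
    rw [coeff_subst_coverCoord F i j l hl, Finset.sum_eq_single 0]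
    · rw [hF]
      simp [hl, ← mul_assoc, ← mul_pow]
    · intro m _ hm
      rw [hF, if_neg, mul_zero]
      rw [exp₃_two]
      have : n + 1 ≤ (n + 1) * m := Nat.le_mul_of_pos_right _ (Nat.pos_of_ne_zero hm)
      omega
    · simp
  · have h1 : coeff d s = 0 := by by_contra h; exact hd (hs d h)
    rw [h1]
    by_contra h
    exact hd (isTwisted_subst_coverCoord F d h)

/-- The kernel of the substitution. -/
theorem dvd_of_subst_coverCoord_eq_zero {F : MvPowerSeries (Fin 3) k}
    (hF : subst (coverCoord k n) F = 0) : X 0 * X 1 + X 2 ^ (n + 1) ∣ F := by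
  -- This is F/(c^(n+1) + ab) expanded formally in powers of ab/c^(n+1). In the product with the
  -- relation the sums telescope to their m = 0 term.
  let H : MvPowerSeries (Fin 3) k := fun d => ∑ m ∈ Finset.range (min (d 0) (d 1) + 1),
    (-1) ^ m * coeff (exp₃ (d 0 - m) (d 1 - m) ((n + 1) * (m + 1) + d 2)) F
  have hH : ∀ i j l, coeff (exp₃ i j l) H = ∑ m ∈ Finset.range (min i j + 1),
      (-1) ^ m * coeff (exp₃ (i - m) (j - m) ((n + 1) * (m + 1) + l)) F := by
    intro i j l
    change (∑ m ∈ Finset.range (min (exp₃ i j l 0) (exp₃ i j l 1) + 1), _) = _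
    simp
  have hab : (X 0 * X 1 : MvPowerSeries (Fin 3) k) = monomial (exp₃ 1 1 0) 1 := by
    rw [X, X, monomial_mul_monomial, mul_one]
    simp [exp₃]
  have hc : (X 2 ^ (n + 1) : MvPowerSeries (Fin 3) k) = monomial (exp₃ 0 0 (n + 1)) 1 := by
    rw [X_pow_eq]
    simp [exp₃]
  have hle : ∀ i j l i' j' l', exp₃ i j l ≤ exp₃ i' j' l' ↔ i ≤ i' ∧ j ≤ j' ∧ l ≤ l' := by
    intro i j l i' j' l'
    rw [Finsupp.le_def, Fin.forall_fin_succ, Fin.forall_fin_two]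
    simp
  have hsub : ∀ i j l i' j' l', exp₃ i j l - exp₃ i' j' l' = exp₃ (i - i') (j - j') (l - l') := by
    intro i j l i' j' l'
    rw [eq_exp₃ (exp₃ i j l - exp₃ i' j' l')]
    simp
  refine ⟨H, ?_⟩
  ext d
  rw [eq_exp₃ d]
  generalize d 0 = i
  generalize d 1 = j
  generalize d 2 = l
  let G : ℕ → k := fun m => (-1) ^ m * coeff (exp₃ (i - m) (j - m) ((n + 1) * m + l)) F
  have hG0 : coeff (exp₃ i j l) F = G 0 := by simp [G]
  have h1 : coeff (exp₃ i j l) (X 0 * X 1 * H) = -∑ m ∈ Finset.range (min i j), G (m + 1) := by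
    rw [hab, coeff_monomial_mul, hsub, one_mul, hH]
    split_ifs with h <;> rw [hle] at h
    · rw [Nat.sub_zero, show min (i - 1) (j - 1) + 1 = min i j by omega, ← Finset.sum_neg_distrib]
      refine Finset.sum_congr rfl fun m _ => ?_
      rw [Nat.sub_sub, Nat.sub_sub, add_comm 1 m]
      simp only [G, pow_succ]
      ring
    · rw [show min i j = 0 by omega, Finset.range_zero, Finset.sum_empty, neg_zero]
  have h2 : coeff (exp₃ i j l) (X 2 ^ (n + 1) * H) =
      ∑ m ∈ Finset.range (min i j + 1), G m := by
    rw [hc, coeff_monomial_mul, hsub, one_mul, hH]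
    split_ifs with h <;> rw [hle] at h
    · rw [Nat.sub_zero, Nat.sub_zero]
      refine Finset.sum_congr rfl fun m _ => ?_
      rw [show (n + 1) * (m + 1) + (l - (n + 1)) = (n + 1) * m + l by
        rw [Nat.mul_succ]; omega]
    -- For l ≤ n the product with c^(n+1) has no such coefficient, so the sum must vanish; up to
    -- sign it is a coefficient of the image of F.
    · have h3 := coeff_subst_coverCoord (n := n) F i j l (by omega)
      rw [hF, map_zero] at h3
      have h4 : ∑ m ∈ Finset.range (min i j + 1), G m = (-1) ^ j * 0 := by
        rw [h3, Finset.mul_sum]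
        refine Finset.sum_congr rfl fun m hm => ?_
        rw [Finset.mem_range] at hm
        obtain ⟨j', rfl⟩ := Nat.exists_eq_add_of_le' (show m ≤ j by omega)
        rw [Nat.add_sub_cancel, ← mul_assoc, ← pow_add, show j' + m + j' = m + 2 * j' by ring,
          pow_add, pow_mul, neg_one_sq, one_pow, mul_one]
        simp [G]
      rw [h4, mul_zero]
  rw [hG0, add_mul, map_add, h1, h2, Finset.sum_range_succ']
  ring

variable (k n) in
/-- The embedding of the singularity `A_n` into its cyclic cover `k[[u, v]]`. -/
noncomputable def toCover : CompleteA k n →+* MvPowerSeries (Fin 2) k :=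
  Ideal.Quotient.lift (relIdeal k n)
    (substAlgHom (R := k) (hasSubst_coverCoord (k := k) (n := n))).toRingHom (by
      intro F hF
      obtain ⟨G, rfl⟩ := Ideal.mem_span_singleton'.mp hF
      change substAlgHom (R := k) (hasSubst_coverCoord (k := k) (n := n)) _ = 0
      simp only [map_mul, map_add, map_pow, substAlgHom_X]
      simp only [coverCoord, Matrix.cons_val]
      ring)

theorem toCover_mk (F : MvPowerSeries (Fin 3) k) :
    toCover k n (Ideal.Quotient.mk _ F) = subst (coverCoord k n) F := by
  rw [← coe_substAlgHom hasSubst_coverCoord]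
  exact Ideal.Quotient.lift_mk _ _ _

theorem toCover_coord (i : Fin 3) : toCover k n (coord n i) = coverCoord k n i := by
  rw [coord, toCover_mk, subst_X hasSubst_coverCoord]

theorem isDegreeZeroSubring_toCover : IsDegreeZeroSubring (n + 1) (toCover k n) where
  injective := by
    rw [injective_iff_map_eq_zero]
    intro y hy
    obtain ⟨F, rfl⟩ := Ideal.Quotient.mk_surjective y
    rw [toCover_mk] at hy
    rw [Ideal.Quotient.eq_zero_iff_mem, Ideal.mem_span_singleton]
    exact dvd_of_subst_coverCoord_eq_zero hy
  mem_range_iff s := by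
    constructor
    · rintro ⟨y, rfl⟩
      obtain ⟨F, rfl⟩ := Ideal.Quotient.mk_surjective y
      rw [toCover_mk]
      exact isTwisted_subst_coverCoord F
    · intro hs
      obtain ⟨F, rfl⟩ := exists_subst_coverCoord_eq hs
      exact ⟨_, toCover_mk F⟩

end CompleteA

/-! ### Transfer between a local ring and its completion. -/

theorem IsDegreeZeroSubring.comp_ringEquiv {k B A : Type*} [Field k] [CommRing B] [CommRing A]
    {e : ℕ} {ψ : A →+* MvPowerSeries (Fin 2) k} (hψ : IsDegreeZeroSubring e ψ) (σ : B ≃+* A) :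
    IsDegreeZeroSubring e (ψ.comp σ.toRingHom) where
  injective := hψ.injective.comp σ.injective
  mem_range_iff s := by
    rw [← hψ.mem_range_iff]
    constructor
    · rintro ⟨y, rfl⟩; exact ⟨σ y, rfl⟩
    · rintro ⟨y, rfl⟩; exact ⟨σ.symm y, congrArg ψ (σ.apply_symm_apply y)⟩

theorem isLocalHom_algebraMap_localCompletion (O : Type*) [CommRing O] [IsLocalRing O] :
    IsLocalHom (algebraMap O (LocalCompletion O)) := by
  refine ⟨fun y hy => ?_⟩
  by_contra hnu
  have h1 := hy.map (AdicCompletion.evalₐ (IsLocalRing.maximalIdeal O) 1)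
  rw [AlgHom.commutes] at h1
  have h2 : algebraMap O (O ⧸ IsLocalRing.maximalIdeal O ^ 1) y = 0 := by
    refine Ideal.Quotient.eq_zero_iff_mem.mpr ?_
    rw [pow_one]
    exact (IsLocalRing.mem_maximalIdeal y).mpr hnu
  rw [h2, isUnit_zero_iff] at h1
  have h3 : (1 : O) ∈ IsLocalRing.maximalIdeal O ^ 1 := by
    rw [← Ideal.Quotient.eq_zero_iff_mem, map_one]
    exact h1.symm
  rw [pow_one] at h3
  exact (IsLocalRing.mem_maximalIdeal _).mp h3 isUnit_one

theorem algebraMap_localCompletion_injective (O : Type*) [CommRing O] [IsLocalRing O]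
    [IsNoetherianRing O] : Function.Injective (algebraMap O (LocalCompletion O)) := by
  have : IsHausdorff (IsLocalRing.maximalIdeal O) O :=
    IsHausdorff.of_isLocalRing _ _ Ideal.IsPrime.ne_top'
  exact AdicCompletion.of_injective (IsLocalRing.maximalIdeal O) O

/-- A homomorphism between cyclic groups of the same finite order that sends a generator to a
generator is bijective. -/
theorem bijective_of_map_generator {G H : Type*} [AddCommGroup G] [AddCommGroup H] (φ : G →+ H)
    {g : G} {h : H} (hgh : φ g = h) (hg : ∀ x, x ∈ AddSubgroup.zmultiples g)
    (hh : ∀ x, x ∈ AddSubgroup.zmultiples h) (ho : addOrderOf g = addOrderOf h) :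
    Function.Bijective φ := by
  constructor
  · rw [injective_iff_map_eq_zero]
    intro x hx
    obtain ⟨m, rfl⟩ := AddSubgroup.mem_zmultiples_iff.mp (hg x)
    rw [map_zsmul, hgh, ← addOrderOf_dvd_iff_zsmul_eq_zero, ← ho] at hx
    exact addOrderOf_dvd_iff_zsmul_eq_zero.mp hx
  · intro y
    obtain ⟨m, rfl⟩ := AddSubgroup.mem_zmultiples_iff.mp (hh y)
    exact ⟨m • g, by rw [map_zsmul, hgh]⟩

/-! ### Class groups of the local ring and of its completion. -/

namespace DoublePlane

open Polynomial CompleteA IsLocalRing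

variable {k : Type*} [Field k] [NeZero (2 : k)] {p : k[X]} {α : k} {n : ℕ} {w : k[X]}

/-- The contraction of r to T has height one and a generator away from V(a); elements of r reach it
after multiplication by a unit denominator. -/
theorem exists_generator_localization [IsDomain (DoublePlane p)]
    [IsIntegrallyClosed (DoublePlane p)] (P : Ideal (DoublePlane p)) [P.IsPrime] (O : Type*)
    [CommRing O] [Algebra (DoublePlane p) O] [IsLocalization.AtPrime O P] {r : PrimeDivisor O}
    (hr : algebraMap _ O (a p) ∉ r.1.asIdeal) :
    ∃ g ∈ r.1.asIdeal, g ≠ 0 ∧ ∀ s ∈ r.1.asIdeal, ∃ m : ℕ, g ∣ algebraMap _ O (a p) ^ m * s := by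
  let r' : PrimeDivisor (DoublePlane p) :=
    ⟨⟨r.1.asIdeal.comap (algebraMap _ O), Ideal.comap_isPrime _ _⟩, 
      (IsLocalization.height_under P.primeCompl _).trans r.2⟩
  obtain ⟨g, hg, hg0, h⟩ := exists_generator_of_a_notMem (r := r') hr
  have hinj : Function.Injective (algebraMap (DoublePlane p) O) :=
    IsLocalization.injective _ P.primeCompl_le_nonZeroDivisors
  refine ⟨algebraMap _ O g, hg, by rwa [ne_eq, map_eq_zero_iff _ hinj], fun s hs => ?_⟩
  obtain ⟨⟨y, c⟩, hy⟩ := IsLocalization.surj P.primeCompl s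
  have hc : IsUnit (algebraMap (DoublePlane p) O c) := IsLocalization.map_units O c
  obtain ⟨m, hm⟩ := h y (by
    change algebraMap _ O y ∈ r.1.asIdeal
    rw [← hy]
    exact Ideal.mul_mem_right _ _ hs)
  refine ⟨m, ?_⟩
  rw [← hc.dvd_mul_right, mul_assoc, hy, ← map_pow, ← map_mul]
  exact map_dvd _ hm

section LocalRing

variable (hα : p.IsRoot α) {P : Ideal (DoublePlane p)} [P.IsPrime]
  (hP : P = (point p α hα).asIdeal)
  (O : Type*) [CommRing O] [Algebra (DoublePlane p) O] [IsLocalization.AtPrime O P]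

include hP

theorem isUnit_algebraMap_aeval_x (hw : w.eval α ≠ 0) :
    IsUnit (algebraMap (DoublePlane p) O (aeval (x p) w)) := by
  refine IsLocalization.map_units O (⟨aeval (x p) w, fun h => hw ?_⟩ : P.primeCompl)
  rw [hP, point_asIdeal] at h
  have h1 := (mem_ptIdeal_iff _).mp h
  rwa [← aeval_algHom_apply, evalPt, lift_x, coe_aeval_eq_eval] at h1

variable [IsDomain (DoublePlane p)] [IsIntegrallyClosed (DoublePlane p)]

/-- The prime divisor of the local ring cut out by the line over the root. -/
theorem exists_primeDivisor_localization : ∃ q : PrimeDivisor O,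
    q.1.asIdeal = Ideal.span {algebraMap _ O (a p), algebraMap _ O (x p - algebraMap k _ α)} ∧
    q.1.asIdeal.comap (algebraMap (DoublePlane p) O) = (line hα).1.asIdeal := by
  have hdisj : Disjoint (P.primeCompl : Set (DoublePlane p)) ((line hα).1.asIdeal) := by
    rw [Set.disjoint_left]
    intro s hs hs'
    exact hs (hP.ge (ker_lineHom_le_point hα hs'))
  have hprime := IsLocalization.isPrime_of_isPrime_disjoint P.primeCompl O _ (line hα).1.2 hdisj
  refine ⟨⟨⟨(line hα).1.asIdeal.map (algebraMap _ O), hprime⟩, ?_⟩, ?_, ?_⟩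
  · exact (IsLocalization.height_map_of_disjoint P.primeCompl _ hdisj).trans (line hα).2
  · change (line hα).1.asIdeal.map (algebraMap _ O) = _
    rw [line_asIdeal, Ideal.map_span, Set.image_pair]
  · exact IsLocalization.under_map_of_isPrime_disjoint P.primeCompl O (line hα).1.2 hdisj

/-- As w(x) is a unit at the point, ab = (x - α)^(n+1) w puts x - α in s; only one of the lines
survives locally. -/
theorem eq_of_a_mem_localization (hp : p = (X - C α) ^ (n + 1) * w) (hw : w.eval α ≠ 0)
    [IsDomain O] [IsNoetherianRing O] [IsIntegrallyClosed O] {q : PrimeDivisor O}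
    (hq : q.1.asIdeal =
      Ideal.span {algebraMap _ O (a p), algebraMap _ O (x p - algebraMap k _ α)})
    {s : PrimeDivisor O} (hs : algebraMap _ O (a p) ∈ s.1.asIdeal) : s = q := by
  refine (PrimeDivisor.eq_of_le ?_).symm
  rw [hq, Ideal.span_le]
  rintro _ (rfl | rfl)
  · exact hs
  · have h1 := (a_mul_b p).trans (congrArg (aeval (x p)) hp)
    simp only [map_mul, map_pow, map_sub, aeval_X, aeval_C] at h1
    have h2 := congrArg (algebraMap (DoublePlane p) O) h1
    rw [map_mul, map_mul _ _ (aeval (x p) w), map_pow] at h2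
    have h3 := s.1.asIdeal.mul_mem_right (algebraMap _ O (b p)) hs
    rw [h2] at h3
    refine (s.1.2.mem_or_mem h3).elim (fun h4 => s.1.2.mem_of_pow_mem _ h4) fun h4 => ?_
    exact absurd (Ideal.eq_top_of_isUnit_mem _ h4 (isUnit_algebraMap_aeval_x hα hP O hw))
      s.1.2.ne_top

end LocalRing

section Completion

variable [IsDomain (DoublePlane p)] [IsIntegrallyClosed (DoublePlane p)]

/-- The natural map of class groups for the completion of the local ring at a point over a root
of multiplicity `n + 1`. -/
theorem exists_isNaturalClassMap_localCompletion (hα : p.IsRoot α)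
    (hp : p = (X - C α) ^ (n + 1) * w) (hw : w.eval α ≠ 0) {P : Ideal (DoublePlane p)} [P.IsPrime]
    (hP : P = (point p α hα).asIdeal)
    (O : Type*) [CommRing O] [IsLocalRing O] [Algebra k O] [Algebra (DoublePlane p) O]
    [IsScalarTower k (DoublePlane p) O] [IsLocalization.AtPrime O P] :
    (IsNoetherianRing (LocalCompletion O) ∧ IsDomain (LocalCompletion O) ∧
        IsIntegrallyClosed (LocalCompletion O)) ∧
      (∃ φ : DivisorClassGroup O →+ DivisorClassGroup (LocalCompletion O),
        IsNaturalClassMap φ ∧ Function.Bijective φ) ∧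
      (IsAddCyclic (DivisorClassGroup O) ∧ Nat.card (DivisorClassGroup O) = n + 1) ∧
      (IsAddCyclic (DivisorClassGroup (LocalCompletion O)) ∧
        Nat.card (DivisorClassGroup (LocalCompletion O)) = n + 1) := by
  have hle := P.primeCompl_le_nonZeroDivisors
  have hOd : IsDomain O := IsLocalization.isDomain_of_le_nonZeroDivisors O hle
  have hOn : IsNoetherianRing O := IsLocalization.isNoetherianRing P.primeCompl O inferInstance
  have hOi : IsIntegrallyClosed O := isIntegrallyClosed_of_isLocalization O P.primeCompl hle
  have hαP := hP.trans (point_asIdeal hα)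
  obtain ⟨F, hF⟩ := exists_adicCompletion_algEquiv_completeA _ hp hw hαP O
  let ι := algebraMap O (LocalCompletion O)
  let j := algebraMap (DoublePlane p) O
  let ψ : LocalCompletion O →+* MvPowerSeries (Fin 2) k :=
    (toCover k n).comp F.toRingEquiv.toRingHom
  have hψ : IsDegreeZeroSubring (n + 1) ψ :=
    isDegreeZeroSubring_toCover.comp_ringEquiv F.toRingEquiv
  have hψι : ∀ s, ψ (ι (j s)) = toCover k n (toCompleteA hp s) := fun s =>
    congrArg (toCover k n) (hF s)
  have hCn : IsNoetherianRing (LocalCompletion O) :=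
    isNoetherianRing_of_ringEquiv (CompleteA k n) F.toRingEquiv.symm
  have hCd : IsDomain (LocalCompletion O) := hψ.isDomain
  have hCi : IsIntegrallyClosed (LocalCompletion O) := hψ.isIntegrallyClosed
  have hψa : ψ (ι (j (a p))) = MvPowerSeries.X 0 ^ (n + 1) := by
    rw [hψι, toCompleteA, lift_a, toCover_coord]; rfl
  have hψc : ψ (ι (j (x p - algebraMap k _ α))) = MvPowerSeries.X 0 * MvPowerSeries.X 1 := by
    rw [hψι, toCompleteA, map_sub, AlgHom.commutes, lift_x, add_sub_cancel_left, toCover_coord]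
    rfl
  -- This preimage of v^(n+1) differs from the image of b by the unit w(x).
  have hψb : ψ (F.symm (-coord n 1)) = MvPowerSeries.X 1 ^ (n + 1) := by
    change toCover k n (F (F.symm (-coord n 1))) = _
    rw [AlgEquiv.apply_symm_apply, map_neg, toCover_coord]
    exact neg_neg _
  obtain ⟨q', hq', hbq', hord', hgen'⟩ := hψ.exists_divisorClass_generates hψa hψb hψc
  obtain ⟨q, hq, hqT⟩ := exists_primeDivisor_localization hα hP O
  have hwO : IsUnit (j (aeval (x p) w)) := isUnit_algebraMap_aeval_x hα hP O hw
  have hrel : j (a p) * j (b p) = j (x p - algebraMap k _ α) ^ (n + 1) * j (aeval (x p) w) := by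
    have h1 := (a_mul_b p).trans (congrArg (aeval (x p)) hp)
    simp only [map_mul, map_pow, map_sub, aeval_X, aeval_C] at h1
    rw [← map_mul, h1, map_mul, map_pow]
  have hbq : j (b p) ∉ q.1.asIdeal := fun h => b_notMem_line hα (by
    rw [← hqT]; exact h)
  have hwq : j (aeval (x p) w) ∉ q.1.asIdeal := fun h =>
    q.1.2.ne_top (Ideal.eq_top_of_isUnit_mem _ h hwO)
  -- Irreducibility descends along the local homomorphism from O to its completion.
  have hirr : Irreducible (j (a p)) := by
    have := isLocalHom_algebraMap_localCompletion O
    exact (hψ.irreducible hψa).of_map (f := ι)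
  obtain ⟨hord, hgen⟩ := addOrderOf_divisorClass_single_and_forall_mem_zmultiples
    (Nat.succ_pos n) hq hbq hwq hrel hirr
    (fun s hs => eq_of_a_mem_localization hα hP O hp hw hq hs)
    (fun r hr => exists_generator_localization P O hr)
  have hinj : Function.Injective ι := algebraMap_localCompletion_injective O
  -- In dimension two only contraction to the maximal ideal must be excluded. Such an r would
  -- contain a and x - α, so r = q', and also b, hence the preimage of v^(n+1), which is not in q'.
  have hht : ∀ r : PrimeDivisor (LocalCompletion O), r.1.asIdeal.comap ι ≠ ⊥ →
      (r.1.asIdeal.comap ι).height = 1 := by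
    intro r hr
    have hrprime : (r.1.asIdeal.comap ι).IsPrime := Ideal.comap_isPrime _ _
    have hne : r.1.asIdeal.comap ι ≠ maximalIdeal O := by
      intro h
      have hmem : ∀ s ∈ ptIdeal p α 0 0 (by rw [zero_mul]; exact hα.symm),
          ι (j s) ∈ r.1.asIdeal := by
        intro s hs
        rw [← Ideal.mem_comap, h, ← IsLocalization.AtPrime.map_eq_maximalIdeal P O]
        exact Ideal.mem_map_of_mem _ (hαP.ge hs)
      have ha := hmem (a p) (by rw [mem_ptIdeal_iff]; simp [evalPt])
      have hb := hmem (b p) (by rw [mem_ptIdeal_iff]; simp [evalPt])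
      have hx := hmem (x p - algebraMap k _ α) (by rw [mem_ptIdeal_iff]; simp [evalPt])
      have hqr : q' = r := by
        refine PrimeDivisor.eq_of_le ?_
        rw [hq', Ideal.span_le]
        rintro _ (rfl | rfl)
        · exact ha
        · exact hx
      have hb' : ι (j (b p)) = F.symm (-coord n 1) * ι (j (aeval (x p) w)) := by
        apply F.injective
        rw [map_mul, AlgEquiv.apply_symm_apply]
        refine (hF _).trans ?_
        rw [show F (ι (j (aeval (x p) w))) = _ from hF _, ← aeval_algHom_apply (toCompleteA hp),
          toCompleteA, lift_b, lift_x]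
      rw [hb'] at hb
      rcases r.1.2.mem_or_mem hb with h1 | h1
      · exact hbq' (by rw [hqr]; exact h1)
      · exact r.1.2.ne_top (Ideal.eq_top_of_isUnit_mem _ h1 (hwO.map ι))
    apply le_antisymm
    · have h1 := Ideal.height_add_one_le_of_lt_of_isPrime
        (lt_of_le_of_ne (IsLocalRing.le_maximalIdeal hrprime.ne_top) hne)
      have h2 : (((maximalIdeal O).height : ℕ∞) : WithBot ℕ∞) ≤ 2 := by
        rw [maximalIdeal_height_eq_ringKrullDim, IsLocalization.AtPrime.ringKrullDim_eq_height P O]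
        exact (Ideal.height_le_ringKrullDim_of_ne_top Ideal.IsPrime.ne_top').trans
          ringKrullDim_le_two
      have h4 : (r.1.asIdeal.comap ι).height + 1 ≤ 1 + 1 := h1.trans (by
        rw [one_add_one_eq_two]; exact WithBot.coe_le_coe.mp h2)
      exact (ENat.add_le_add_iff_right (by norm_num)).mp h4
    · refine Order.one_le_iff_ne_zero.mpr fun h0 => hr ?_
      rwa [Ideal.height_eq_zero_iff_eq_bot] at h0
  obtain ⟨φ, hφ, hφq⟩ := exists_isNaturalClassMap hinj hht
  -- Both primes are generated by a and x - α, so q extends exactly to q'.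
  have hφ' : φ (divisorClass (Finsupp.single q 1)) = divisorClass (Finsupp.single q' 1) := by
    rw [hφq, ← idealDivisor_asIdeal q', hq', hq, Ideal.map_span, Set.image_pair]
  refine ⟨⟨hCn, hCd, hCi⟩, ⟨φ, hφ, bijective_of_map_generator φ hφ' hgen hgen'
    (hord.trans hord'.symm)⟩, ⟨⟨_, hgen⟩, ?_⟩, ⟨⟨_, hgen'⟩, ?_⟩⟩
  · rw [← addOrderOf_eq_card_of_forall_mem_zmultiples hgen, hord]
  · rw [← addOrderOf_eq_card_of_forall_mem_zmultiples hgen', hord']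

end Completion

end DoublePlane

theorem proposition4p1 {k : Type*} [Field k] [IsAlgClosed k] (h2 : (2 : k) ≠ 0)
    (p : Polynomial k) (hmonic : p.Monic) (hdeg : 2 ≤ p.natDegree)
    {v : ℕ} (α : Fin v → k) (e : Fin v → ℕ)
    (hα : Function.Injective α) (he : ∀ i, 1 ≤ e i)
    (hp : p = ∏ i, (Polynomial.X - Polynomial.C (α i)) ^ e i) :
    -- `T` is a normal domain
    (IsDomain (DoublePlane p) ∧ IsIntegrallyClosed (DoublePlane p)) ∧
    -- the singular points are the `P_i` with `e i ≥ 2`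
    singularLocus (DoublePlane p) =
      {P | ∃ i, 2 ≤ e i ∧ P = DoublePlane.point p (α i) (isRoot_of_factorization hp he i)} ∧
    -- `T` is rational
    IsRationalSurface k (DoublePlane p) ∧
    -- `Cl(T) ≅ ℤ/D ⊕ ℤ^(v-1)` with `D = gcd (e 1, …, e v)`
    Nonempty (DivisorClassGroup (DoublePlane p) ≃+
      ZMod (Finset.univ.gcd e) × (Fin (v - 1) → ℤ)) ∧
    -- `T^* = k^*`
    Function.Bijective
      (Units.map (algebraMap k (DoublePlane p)).toMonoidHom : kˣ →* (DoublePlane p)ˣ) ∧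
    -- type of the singular points
    (∀ i, 2 ≤ e i → IsRationalDoublePointA k
      (DoublePlane.localRing p (α i) (isRoot_of_factorization hp he i)) (e i - 1)) ∧
    -- the completed local rings are Noetherian normal domains, and the natural map of class groups
    -- is an isomorphism of cyclic groups of order `e i`
    (∀ i,
      let O := DoublePlane.localRing p (α i) (isRoot_of_factorization hp he i)
      (IsNoetherianRing (LocalCompletion O) ∧ IsDomain (LocalCompletion O) ∧
        IsIntegrallyClosed (LocalCompletion O)) ∧
      (∃ φ : DivisorClassGroup O →+ DivisorClassGroup (LocalCompletion O),
        IsNaturalClassMap φ ∧ Function.Bijective φ) ∧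
      (IsAddCyclic (DivisorClassGroup O) ∧ Nat.card (DivisorClassGroup O) = e i) ∧
      (IsAddCyclic (DivisorClassGroup (LocalCompletion O)) ∧
        Nat.card (DivisorClassGroup (LocalCompletion O)) = e i)) := by
  have : NeZero (2 : k) := ⟨h2⟩
  have hp0 : p ≠ 0 := hmonic.ne_zero
  have hv : 0 < v := by
    rcases Nat.eq_zero_or_pos v with rfl | hv
    · rw [hp, Finset.univ_eq_empty, Finset.prod_empty, Polynomial.natDegree_one] at hdeg
      omega
    · exact hv
  have hdom := DoublePlane.isDomain p hp0
  have hic := DoublePlane.isIntegrallyClosed p hp0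
  have hroot := isRoot_of_factorization hp he
  have hfac : ∀ i, ∃ (n : ℕ) (w : Polynomial k), e i = n + 1 ∧
      p = (Polynomial.X - Polynomial.C (α i)) ^ (n + 1) * w ∧ w.eval (α i) ≠ 0 := fun i => by
    obtain ⟨n, hn⟩ := Nat.exists_eq_add_of_le' (he i)
    obtain ⟨w, hw, hw'⟩ := exists_eq_pow_mul_of_factorization hα hp i
    exact ⟨n, w, hn, by rw [← hn]; exact hw, hw'⟩
  refine ⟨⟨hdom, hic⟩, DoublePlane.singularLocus_eq_of_factorization hp0 hα he hp,
    DoublePlane.isRationalSurface hp0, DoublePlane.nonempty_divisorClassGroup_addEquiv hα hroot he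
      hp hv, DoublePlane.bijective_units_map p (hroot ⟨0, hv⟩) hp0, fun i hi => ?_, fun i => ?_⟩
  · obtain ⟨n, w, hn, hw, hw'⟩ := hfac i
    obtain ⟨F, -⟩ := DoublePlane.exists_adicCompletion_algEquiv_completeA _ hw hw'
      (DoublePlane.point_asIdeal (hroot i)) (DoublePlane.localRing p (α i) (hroot i))
    refine ⟨by omega, IsLocalization.isNoetherianRing
      (DoublePlane.point p (α i) (hroot i)).asIdeal.primeCompl _ inferInstance, ?_⟩
    rw [hn, Nat.add_sub_cancel]
    exact ⟨F⟩
  · obtain ⟨n, w, hn, hw, hw'⟩ := hfac i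
    rw [hn]
    exact DoublePlane.exists_isNaturalClassMap_localCompletion (hroot i) hw hw' rfl
      (DoublePlane.localRing p (α i) (hroot i))
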